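/- Let $g\ge 1$ and $g+2\le d\le 2g+1$ be integers. Then there are a closed (compact, connected) Riemann surface $\Sigma$ of genus $g$, a set $P\subset\Sigma$ of exactly $d$ points, and a map $X:\Sigma\setminus P\to\mathbb R^4$ such that: 1. $X$ is a smooth conformal immersion with vanishing mean curvature (a minimal immersion), the induced metric on $\Sigma\setminus P$ is complete, and the total curvature is finite: $\int_{\Sigma\setminus P}|K|\,dA<\infty$. 2. $X$ has an embedded planar end at every $p\in P$: $X(q)\to\infty$ as $q\to p$, and some punctured neighbourhood of $p$ is mapped bijectively onto the graph, over the exterior of a disc in an affine 2-plane, of a smooth function with values in the orthogonal complement of the plane which tends to $0$ at infinity (in particular there is no logarithmic growth). 3. The surface is symmetric with respect to the origin: there is a holomorphic involution $\sigma$ of $\Sigma$ preserving $P$ with $X\circ\sigma=-X$. 4. If $g\ge 2$, then $\Sigma$ is hyperelliptic, that is, it has a holomorphic map of degree $2$ to the Riemann sphere. 5. $X$ is a holomorphic curve of the following form: there are distinct $\lambda_1,\dots,\lambda_{2g+2}\in\mathbb C$ and subsets $I\ne J$ of $\{1,\dots,2g+2\}$ with $|I|,|J|\ge g+1$ such that $\Sigma$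 is the compact Riemann surface of the curve $y^2=\prod_{j=1}^{2g+2}(x-\lambda_j)$ (with two points over $x=\infty$), $P=\{(\lambda_k,0):k\in I\cup J\}$, and $$X=(f_I,f_J):\Sigma\setminus P\to\mathbb C^2\simeq\mathbb R^4,\qquad f_I=\frac{y}{\prod_{i\in I}(x-\lambda_i)},$$ where $(z,w)\in\mathbb C^2$ is identified with $(\operatorname{Re}z,\operatorname{Im}z,\operatorname{Re}w,\operatorname{Im}w)\in\mathbb R^4$. Moreover, for $g=1$ and $d=3$ there are such $\Sigma$, $P$, $X$ for which $X$ is in addition an embedding (a homeomorphism onto its image). -/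

import Mathlib

open Set Filter
open scoped Manifold ContDiff Topology

noncomputable section

namespace PlanarEnds

/-- Euclidean four-space. -/
abbrev R4 : Type := EuclideanSpace ℝ (Fin 4)

/-- The identification of `ℂ²` with `ℝ⁴`: `(z, w) ↦ (Re z, Im z, Re w, Im w)`. -/
def toR4 (z w : ℂ) : R4 := !₂[z.re, z.im, w.re, w.im]

/-! ### Closed Riemann surfaces, genus, hyperellipticity -/

/-- A closed Riemann surface: a compact connected Hausdorff space with an atlas of complex charts
whose changes of coordinates are holomorphic. -/
structure IsClosedRiemannSurface (S : Type*) [TopologicalSpace S] [ChartedSpace ℂ S] : Prop where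
  isManifold : IsManifold 𝓘(ℂ) ω S
  t2 : T2Space S
  compact : CompactSpace S
  connected : ConnectedSpace S

section RiemannSurface

variable {S : Type*} [TopologicalSpace S] [ChartedSpace ℂ S]

/-- The coefficient `a` of a field of covectors `α = a dz` in the coordinate `z` of the chart `e`. -/
def coeffIn (α : ∀ p : S, TangentSpace 𝓘(ℂ) p →L[ℂ] ℂ) (e : OpenPartialHomeomorph S ℂ) (z : ℂ) : ℂ :=
  α (e.symm z) (mfderiv 𝓘(ℂ) 𝓘(ℂ) e.symm z (1 : ℂ))

variable (S) in
/-- The complex vector space of holomorphic 1-forms: fields of complex covectors whose coefficient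
in every chart of the atlas is holomorphic. -/
def holomorphicOneForms : Submodule ℂ (∀ p : S, TangentSpace 𝓘(ℂ) p →L[ℂ] ℂ) where
  carrier := {α | ∀ e ∈ atlas ℂ S, DifferentiableOn ℂ (coeffIn α e) e.target}
  add_mem' := fun ha hb e he => (ha e he).add (hb e he)
  zero_mem' := fun _ _ => differentiableOn_const (0 : ℂ)
  smul_mem' := fun c _ ha e he => (ha e he).const_smul c

variable (S) in
/-- The genus of a closed Riemann surface: the dimension of its space of holomorphic 1-forms. -/
def genus : ℕ := Module.finrank ℂ (holomorphicOneForms S)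

/-- The affine coordinate on the Riemann sphere `ℂ ∪ {∞}` (with a junk value at `∞`). -/
def affine (a : OnePoint ℂ) : ℂ := a.elim 0 (fun z => z)

/-- The coordinate `1 / z` at `∞` on the Riemann sphere, vanishing at `∞` (junk value at `0`). -/
def affineInv (a : OnePoint ℂ) : ℂ := a.elim 0 (fun z => z⁻¹)

/-- Holomorphic maps to the Riemann sphere `ℂ ∪ {∞}`, that is, meromorphic functions
(the constant `∞` included): the map is continuous, holomorphic in the affine coordinate where it
is finite, and holomorphic in the coordinate `1 / z` where it is infinite. -/
structure IsHolomorphicToSphere (f : S → OnePoint ℂ) : Prop where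
  continuous : Continuous f
  finite : ∀ p, f p ≠ OnePoint.infty → MDifferentiableAt 𝓘(ℂ) 𝓘(ℂ) (fun q => affine (f q)) p
  infinite : ∀ p, f p = OnePoint.infty → MDifferentiableAt 𝓘(ℂ) 𝓘(ℂ) (fun q => affineInv (f q)) p

variable (S) in
/-- A closed Riemann surface is hyperelliptic if its genus is at least two and it has a holomorphic
map of degree two to the Riemann sphere. The degree is the largest cardinality of a fibre. -/
def IsHyperelliptic : Prop :=
  2 ≤ genus S ∧ ∃ f : S → OnePoint ℂ, IsHolomorphicToSphere f ∧
    (∀ c, (f ⁻¹' {c}).encard ≤ 2) ∧ ∃ c, (f ⁻¹' {c}).encard = 2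

/-- `S`, with the meromorphic functions `x` and `y`, is the compact Riemann surface of the curve
`y² = ∏ⱼ (x - lamⱼ)` with `2 g + 2` distinct branch values: the points with finite `x` are
identified with the affine curve by `(x, y)`, and there are two points over `x = ∞`. -/
structure IsHyperellipticCurve (g : ℕ) (lam : Fin (2 * g + 2) → ℂ) (x y : S → OnePoint ℂ) :
    Prop where
  distinct : Function.Injective lam
  holomorphic_x : IsHolomorphicToSphere x
  holomorphic_y : IsHolomorphicToSphere y
  infinite_iff : ∀ p, y p = OnePoint.infty ↔ x p = OnePoint.infty
  bijOn : BijOn (fun p => (affine (x p), affine (y p))) {p | x p ≠ OnePoint.infty}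
    {c : ℂ × ℂ | c.2 ^ 2 = ∏ j, (c.1 - lam j)}
  two_infinite : (x ⁻¹' {OnePoint.infty}).ncard = 2

end RiemannSurface

/-! ### Geometry of a parametrized surface `u : ℂ → ℝ⁴` in the real coordinates of `ℂ` -/

/-- The tangent plane, spanned by the two first partial derivatives. -/
def tangentPlane (u : ℂ → R4) (z : ℂ) : Submodule ℝ R4 :=
  Submodule.span ℝ {fderiv ℝ u z 1, fderiv ℝ u z Complex.I}

/-- The first fundamental form. -/
def firstForm (u : ℂ → R4) (z v w : ℂ) : ℝ := inner ℝ (fderiv ℝ u z v) (fderiv ℝ u z w)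

/-- The second fundamental form: the normal part of the second derivative. -/
def secondForm (u : ℂ → R4) (z v w : ℂ) : R4 :=
  (tangentPlane u z)ᗮ.starProjection (fderiv ℝ (fun ζ => fderiv ℝ u ζ v) z w)

/-- The determinant `E G - F²` of the first fundamental form. -/
def metricDet (u : ℂ → R4) (z : ℂ) : ℝ :=
  firstForm u z 1 1 * firstForm u z Complex.I Complex.I - firstForm u z 1 Complex.I ^ 2

/-- The mean curvature vector: half of the trace of the second fundamental form. -/
def meanCurvature (u : ℂ → R4) (z : ℂ) : R4 :=
  (2 * metricDet u z)⁻¹ •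
    (firstForm u z Complex.I Complex.I • secondForm u z 1 1
      - (2 * firstForm u z 1 Complex.I) • secondForm u z 1 Complex.I
      + firstForm u z 1 1 • secondForm u z Complex.I Complex.I)

/-- The Gauss curvature (through the Gauss equation). -/
def gaussCurvature (u : ℂ → R4) (z : ℂ) : ℝ :=
  (inner ℝ (secondForm u z 1 1) (secondForm u z Complex.I Complex.I)
    - ‖secondForm u z 1 Complex.I‖ ^ 2) / metricDet u z

/-! ### Immersions of an open subset `U` of a Riemann surface `S`

The maps `X` are functions on `S`; only their values on `U` matter. -/

/-- Completeness of the metric induced on `U` by `X`: every divergent curve in `U`, that is, one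
which leaves every compact subset of `U`, has infinite length. The length of a curve in the induced
metric is the length of its image in `ℝ⁴`. -/
def IsCompleteOn {S : Type*} [TopologicalSpace S] (X : S → R4) (U : Set S) : Prop :=
  ∀ γ : ℝ → S, ContinuousOn γ (Ico 0 1) → MapsTo γ (Ico 0 1) U →
    (∀ K ⊆ U, IsCompact K → ∀ᶠ t in 𝓝[<] (1 : ℝ), γ t ∉ K) →
    eVariationOn (X ∘ γ) (Ico 0 1) = ⊤

section Immersions

variable {S : Type*} [TopologicalSpace S] [ChartedSpace ℂ S]

/-- The map `X` is on `U` a smooth conformal immersion with vanishing mean curvature. -/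
structure IsMinimalImmersionOn (X : S → R4) (U : Set S) : Prop where
  smooth : ContMDiffOn 𝓘(ℝ, ℂ) 𝓘(ℝ, R4) ∞ X U
  immersion : ∀ e ∈ atlas ℂ S, ∀ p ∈ e.source ∩ U,
    Function.Injective (fderiv ℝ (X ∘ e.symm) (e p))
  conformal : ∀ e ∈ atlas ℂ S, ∀ p ∈ e.source ∩ U,
    firstForm (X ∘ e.symm) (e p) 1 1 = firstForm (X ∘ e.symm) (e p) Complex.I Complex.I ∧
      firstForm (X ∘ e.symm) (e p) 1 Complex.I = 0
  minimal : ∀ e ∈ atlas ℂ S, ∀ p ∈ e.source ∩ U, meanCurvature (X ∘ e.symm) (e p) = 0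

/-- The integral over `U` of `|K|` with respect to the area of the induced metric, as the supremum
of its integrals over finite disjoint unions of measurable pieces of `U`, each of them contained in
the domain of a chart. -/
def totalAbsCurvature (X : S → R4) (U : Set S) : ENNReal :=
  ⨆ (n : ℕ) (e : Fin n → OpenPartialHomeomorph S ℂ) (A : Fin n → Set S)
    (_ : ∀ i, e i ∈ atlas ℂ S ∧ A i ⊆ (e i).source ∩ U ∧ MeasurableSet (e i '' A i))
    (_ : Pairwise fun i j => Disjoint (A i) (A j)),
    ∑ i, ∫⁻ z in e i '' A i,
      ENNReal.ofReal (|gaussCurvature (X ∘ (e i).symm) z| * √(metricDet (X ∘ (e i).symm) z))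

/-- An embedded planar end at the puncture `p` of `S \ P`: a punctured neighbourhood of `p` is
mapped bijectively (so with multiplicity one) onto the graph over the exterior of a disc in the
plane `b + V` of a smooth function `h` with values in the normal space; the surface goes to
infinity at `p`, and it is asymptotic to the plane, that is, `h` tends to zero at infinity.
In particular no component of `h` has logarithmic growth. -/
def HasEmbeddedPlanarEnd (X : S → R4) (P : Set S) (p : S) : Prop :=
  Tendsto X (𝓝[≠] p) (Bornology.cobounded R4) ∧
  ∃ N : Set S, IsOpen N ∧ p ∈ N ∧ N \ {p} ⊆ Pᶜ ∧ InjOn X (N \ {p}) ∧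
  ∃ (b : R4) (V : Submodule ℝ R4) (h : V → Vᗮ) (r : ℝ),
    Module.finrank ℝ V = 2 ∧ 0 < r ∧
    ContDiffOn ℝ ∞ h {q | r < ‖q‖} ∧
    Tendsto h (Bornology.cobounded V) (𝓝 0) ∧
    X '' (N \ {p}) = (fun q : V => b + (q : R4) + (h q : R4)) '' {q | r < ‖q‖}

/-- Symmetry of the immersed surface `X : S \ P → ℝ⁴` with respect to the origin: the map `x ↦ -x`
of `ℝ⁴` carries the surface to itself, through a holomorphic involution of `S` which preserves the
set of punctures. -/
def IsSymmetricAboutOrigin (X : S → R4) (P : Set S) : Prop :=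
  ∃ s : S → S, Function.Involutive s ∧ MDifferentiable 𝓘(ℂ) 𝓘(ℂ) s ∧
    ∀ p ∉ P, s p ∉ P ∧ X (s p) = - X p

/-- On `S \ P`, the map `X` is the holomorphic curve `(f_I, f_J)` in `ℂ² = ℝ⁴`, where
`f_I = y / ∏ i ∈ I, (x - lam i)` on the curve `y² = ∏ⱼ (x - lamⱼ)`, and the punctures are the branch
points with index in `I ∪ J`. At the points over `x = ∞`, a continuous `X` is determined by this. -/
def IsCurvePair (g : ℕ) (X : S → R4) (P : Set S) : Prop :=
  ∃ (lam : Fin (2 * g + 2) → ℂ) (x y : S → OnePoint ℂ) (I J : Finset (Fin (2 * g + 2))),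
    IsHyperellipticCurve g lam x y ∧ I ≠ J ∧ g + 1 ≤ I.card ∧ g + 1 ≤ J.card ∧
    (∀ p, p ∈ P ↔ ∃ k ∈ I ∪ J, x p = (lam k : OnePoint ℂ)) ∧
    ∀ p ∉ P, x p ≠ OnePoint.infty →
      X p = toR4 (affine (y p) / ∏ i ∈ I, (affine (x p) - lam i))
        (affine (y p) / ∏ j ∈ J, (affine (x p) - lam j))

end Immersions

end PlanarEnds

end

/-!
The surface is the compactification of the curve `y² = ∏ j, (x - lam j)`, with the branch values
`0, …, 2 g + 1`, where `I` is the upper half of the indices and `J ⊇ I` consists of the `d` largest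
ones; write `A = J \ I` and `m(x) = ∏ a ∈ A, (x - lam a)`, so that `f_J = f_I / m(x)`.

*The Riemann surface.* With `w = f_I = y / ∏ i ∈ I, (x - lam i)` the equation becomes
`den(x) w² = num(x)`, both sides of degree `g + 1`. Its closure in the product of two Riemann spheres
is already smooth, and one of `x`, `1 / x`, `w`, `1 / w` is a coordinate at each point
(`exists_coordChart`): hence a compact Hausdorff space with an explicit atlas. It is connected because
`x` is an open and closed map with one-point fibres over the branch values (`isClosedRiemannSurface`).

*The genus.* The quotient of a holomorphic 1-form by `dx / y` has limits at the branch points and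
grows at most like `|x| ^ (g - 1)`. The square of its odd part under `y ↦ -y` descends to a polynomial
in `x` of degree at most `2 g - 2` which vanishes at `2 g + 2` points, so the quotient itself is a
polynomial in `x` of degree less than `g` (`exists_quot_eq`). Conversely all of these give holomorphic
forms (`formOf_mem`), and the genus is `g` (`genus_eq`).

*Geometry.* A holomorphic curve in `ℂ²` is conformal and minimal where it is immersed
(`meanCurvature_toR4`), and its curvature density is bounded by that of the Gauss map `[F' : G']` into
the projective line (`curvature_density_le`). At each puncture the pair `(f_I, f_J)` has a simple pole
(`exists_simplePole`). This gives an embedded planar end (`hasEmbeddedPlanarEnd_of_simplePole`): in the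
coordinate in which the component along the asymptotic complex line is exactly `1 / s`, the orthogonal
component is holomorphic. The Gauss map extends across a simple pole (`speedSq_bounded_pole`), so the
total curvature is finite; and `X` is proper, so the metric is complete (`isCompleteOn_of_tendsto`).

*Immersivity* (`deriv_ne_zero`) is where the branch values matter. At a point over `x = ∞`, a critical
point of `f_I` would force `∑ i ∈ I, lam i = ∑ i ∉ I, lam i`. Where `w = 0`, the function `f_I = w` is
a coordinate. At the points which are neither of these, a common critical point of
`f_I` and `f_J = f_I / m(x)` is a zero of `∑ a ∈ A, 1 / (x - lam a)`, and also satisfies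
`∑ i ∈ I, 1 / (x - lam i) = ∑ i ∉ I, 1 / (x - lam i)`. The first condition puts `re x` between the
least and greatest elements of `A`; then the left-hand side of the second has negative real part, while
the right-hand side has non-negative real part (`isAdmissible_integral`).

For `g = 1` and `d = 3` the set `A` has one element, so `f_I / f_J` determines `x`; this gives
injectivity (`injOn_pairMap`), and a proper injective map is an embedding.
-/

noncomputable section

namespace PlanarEnds

/-! ### Coordinates on the Riemann sphere -/

@[simp] lemma affine_coe (a : ℂ) : affine (a : OnePoint ℂ) = a := rfl

@[simp] lemma affineInv_coe (a : ℂ) : affineInv (a : OnePoint ℂ) = a⁻¹ := rfl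

@[simp] lemma affineInv_infty : affineInv OnePoint.infty = 0 := rfl

lemma coe_affine {x : OnePoint ℂ} (hx : x ≠ OnePoint.infty) : (affine x : OnePoint ℂ) = x := by
  obtain ⟨a, rfl⟩ := OnePoint.ne_infty_iff_exists.1 hx
  rfl

lemma affineInv_eq {x : OnePoint ℂ} (hx : x ≠ OnePoint.infty) : affineInv x = (affine x)⁻¹ := by
  obtain ⟨a, rfl⟩ := OnePoint.ne_infty_iff_exists.1 hx
  rfl

lemma affineInv_ne_zero {x : OnePoint ℂ} (hx : x ≠ OnePoint.infty) (hx0 : x ≠ ((0 : ℂ) : OnePoint ℂ)) :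
    affineInv x ≠ 0 := by
  obtain ⟨a, rfl⟩ := OnePoint.ne_infty_iff_exists.1 hx
  have : a ≠ 0 := fun h => hx0 (by rw [h])
  simpa using this

lemma affine_ne_zero {x : OnePoint ℂ} (hx : x ≠ OnePoint.infty) (hx0 : x ≠ ((0 : ℂ) : OnePoint ℂ)) :
    affine x ≠ 0 := by
  obtain ⟨a, rfl⟩ := OnePoint.ne_infty_iff_exists.1 hx
  exact fun h => hx0 (by rw [show a = 0 from h])

/-- The inverse of the coordinate `1 / z` at infinity of the Riemann sphere. -/
def ofInv (u : ℂ) : OnePoint ℂ := if u = 0 then OnePoint.infty else ((u⁻¹ : ℂ) : OnePoint ℂ)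

@[simp] lemma ofInv_zero : ofInv 0 = OnePoint.infty := by simp [ofInv]

lemma ofInv_of_ne {u : ℂ} (hu : u ≠ 0) : ofInv u = ((u⁻¹ : ℂ) : OnePoint ℂ) := by simp [ofInv, hu]

@[simp] lemma affineInv_ofInv (u : ℂ) : affineInv (ofInv u) = u := by
  by_cases hu : u = 0 <;> simp [ofInv, hu]

lemma ofInv_ne_zero (u : ℂ) : ofInv u ≠ ((0 : ℂ) : OnePoint ℂ) := by
  by_cases hu : u = 0
  · simp [hu]
  · rw [ofInv_of_ne hu, Ne, OnePoint.coe_eq_coe]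
    exact inv_ne_zero hu

lemma ofInv_affineInv {x : OnePoint ℂ} (hx : x ≠ ((0 : ℂ) : OnePoint ℂ)) : ofInv (affineInv x) = x := by
  induction x using OnePoint.rec with
  | infty => simp
  | coe a =>
    have : a ≠ 0 := fun h => hx (by rw [h])
    simp [ofInv, this]

lemma continuousAt_affine {x : OnePoint ℂ} (hx : x ≠ OnePoint.infty) : ContinuousAt affine x := by
  obtain ⟨a, rfl⟩ := OnePoint.ne_infty_iff_exists.1 hx
  rw [OnePoint.continuousAt_coe]
  exact continuousAt_id

lemma continuousAt_affineInv {x : OnePoint ℂ} (hx : x ≠ ((0 : ℂ) : OnePoint ℂ)) :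
    ContinuousAt affineInv x := by
  induction x using OnePoint.rec with
  | infty =>
    rw [OnePoint.continuousAt_infty']
    have h := Filter.tendsto_inv₀_cobounded (α := ℂ)
    simpa [Metric.cobounded_eq_cocompact, Function.comp_def] using h
  | coe a =>
    have : a ≠ 0 := fun h => hx (by rw [h])
    rw [OnePoint.continuousAt_coe]
    exact continuousAt_inv₀ this

lemma continuous_ofInv : Continuous ofInv := by
  rw [continuous_iff_continuousAt]
  intro u
  by_cases hu : u = 0
  · subst hu
    rw [continuousAt_iff_punctured_nhds, ofInv_zero]
    have h1 : Tendsto (fun u : ℂ => ((u⁻¹ : ℂ) : OnePoint ℂ)) (𝓝[≠] 0) (𝓝 OnePoint.infty) := by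
      have h := OnePoint.tendsto_coe_infty (X := ℂ)
      rw [coclosedCompact_eq_cocompact, ← Metric.cobounded_eq_cocompact] at h
      exact h.comp Filter.tendsto_inv₀_nhdsNE_zero
    refine h1.congr' ?_
    filter_upwards [self_mem_nhdsWithin] with u hu
    exact (ofInv_of_ne hu).symm
  · have h1 : ContinuousAt (fun u : ℂ => ((u⁻¹ : ℂ) : OnePoint ℂ)) u :=
      OnePoint.continuous_coe.continuousAt.comp (continuousAt_inv₀ hu)
    refine h1.congr ?_
    filter_upwards [isOpen_ne.mem_nhds hu] with v hv
    exact (ofInv_of_ne hv).symm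

lemma isOpen_ne_infty : IsOpen {x : OnePoint ℂ | x ≠ OnePoint.infty} := isOpen_ne

lemma isOpen_ne_zero : IsOpen {x : OnePoint ℂ | x ≠ ((0 : ℂ) : OnePoint ℂ)} := isOpen_ne

/-! ### Charts of a fibre product of two holomorphic functions -/

/-- The germ of the equation `F a = G b` with `G' ≠ 0` is solved by a holomorphic function. -/
lemma exists_implicit {F G : ℂ → ℂ} {a₀ b₀ : ℂ} (hF : AnalyticAt ℂ F a₀) (hG : AnalyticAt ℂ G b₀)
    (h0 : F a₀ = G b₀) (hG' : deriv G b₀ ≠ 0) {s t : Set ℂ} (hs : s ∈ 𝓝 a₀) (ht : t ∈ 𝓝 b₀) :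
    ∃ (ψ : ℂ → ℂ) (r δ : ℝ), 0 < r ∧ 0 < δ ∧ Metric.ball a₀ r ⊆ s ∧ Metric.ball b₀ δ ⊆ t ∧
      DifferentiableOn ℂ ψ (Metric.ball a₀ r) ∧ ∀ a ∈ Metric.ball a₀ r, ψ a ∈ Metric.ball b₀ δ ∧
        ∀ b ∈ Metric.ball b₀ δ, F a = G b ↔ b = ψ a := by
  have hsd : HasStrictDerivAt G (deriv G b₀) b₀ := hG.hasStrictDerivAt
  have hfd := hsd.hasStrictFDerivAt_equiv hG'
  set e := hfd.toOpenPartialHomeomorph G with he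
  have hb0 : b₀ ∈ e.source := hfd.mem_toOpenPartialHomeomorph_source
  have heG : ∀ b, e b = G b := fun b => rfl
  have hsym : AnalyticAt ℂ e.symm (G b₀) := by
    refine e.analyticAt_symm' (i := ContinuousLinearEquiv.unitsEquivAut ℂ (Units.mk0 _ hG')) hb0 hG ?_
    exact hfd.hasFDerivAt.fderiv
  obtain ⟨δ, hδ, hδs⟩ := Metric.mem_nhds_iff.1 (inter_mem ht (e.open_source.mem_nhds hb0))
  have hsymb : e.symm (G b₀) = b₀ := e.left_inv hb0
  have hψ : AnalyticAt ℂ (fun a => e.symm (F a)) a₀ := by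
    have : AnalyticAt ℂ e.symm (F a₀) := h0 ▸ hsym
    exact this.comp hF
  have h1 : ∀ᶠ a in 𝓝 a₀, F a ∈ e.target :=
    hF.continuousAt.eventually_mem (e.open_target.mem_nhds (by rw [h0]; exact e.map_source hb0))
  have h2 : ∀ᶠ a in 𝓝 a₀, e.symm (F a) ∈ Metric.ball b₀ δ :=
    hψ.continuousAt.eventually_mem (by
      simp only [h0, hsymb]; exact Metric.ball_mem_nhds _ hδ)
  obtain ⟨r, hr, hrs⟩ := Metric.mem_nhds_iff.1
    (inter_mem hs ((h1.and h2).and hψ.eventually_analyticAt))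
  refine ⟨fun a => e.symm (F a), r, δ, hr, hδ, fun a ha => (hrs ha).1, fun b hb => (hδs hb).1,
    fun a ha => (hrs ha).2.2.differentiableAt.differentiableWithinAt, fun a ha =>
      ⟨(hrs ha).2.1.2, fun b hb => ⟨fun hab => ?_, fun hab => ?_⟩⟩⟩
  · change b = e.symm (F a)
    rw [hab, ← heG, e.left_inv (hδs hb).2]
  · rw [hab, ← heG, e.right_inv (hrs ha).2.1.1]

/-- A chart of a space which is, near a point, identified by the functions `f` and `h` with the
graph `b = ψ a` in `ℂ²`; the chart is the function `f`. -/
lemma exists_chart_of_graph {T : Type*} [TopologicalSpace T] {f h : T → ℂ} {U : Set T}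
    (hU : IsOpen U) (hf : ContinuousOn f U) (hh : ContinuousOn h U) {k : ℂ → ℂ → T}
    {C : Set (ℂ × ℂ)} (hC : ∀ q ∈ U, (f q, h q) ∈ C) (hkU : ∀ a b, (a, b) ∈ C → k a b ∈ U)
    (hfk : ∀ a b, (a, b) ∈ C → f (k a b) = a) (hhk : ∀ a b, (a, b) ∈ C → h (k a b) = b)
    (hk : ∀ q ∈ U, k (f q) (h q) = q) (hkc : ContinuousOn (fun c : ℂ × ℂ => k c.1 c.2) C)
    {a₀ b₀ : ℂ} {ψ : ℂ → ℂ} {r δ : ℝ} (hψ : ContinuousOn ψ (Metric.ball a₀ r))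
    (hψC : ∀ a ∈ Metric.ball a₀ r, ψ a ∈ Metric.ball b₀ δ ∧
        ∀ b ∈ Metric.ball b₀ δ, (a, b) ∈ C ↔ b = ψ a) :
    ∃ e : OpenPartialHomeomorph T ℂ, e.source ⊆ U ∧ e.target = Metric.ball a₀ r ∧
      (∀ q, e q = f q) ∧ (∀ a ∈ Metric.ball a₀ r, h (e.symm a) = ψ a) ∧
      ∀ q ∈ U, f q ∈ Metric.ball a₀ r → h q ∈ Metric.ball b₀ δ → q ∈ e.source := by
  have hmem : ∀ a ∈ Metric.ball a₀ r, (a, ψ a) ∈ C := fun a ha =>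
    ((hψC a ha).2 _ (hψC a ha).1).2 rfl
  have hopen : IsOpen (U ∩ {q | f q ∈ Metric.ball a₀ r ∧ h q ∈ Metric.ball b₀ δ}) :=
    (hf.prodMk hh).isOpen_inter_preimage hU (Metric.isOpen_ball.prod Metric.isOpen_ball)
  refine ⟨{ toFun := f
            invFun := fun a => k a (ψ a)
            source := U ∩ {q | f q ∈ Metric.ball a₀ r ∧ h q ∈ Metric.ball b₀ δ}
            target := Metric.ball a₀ r
            map_source' := fun q hq => hq.2.1
            map_target' := fun a ha => ⟨hkU _ _ (hmem a ha), ?_, ?_⟩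
            left_inv' := fun q hq => ?_
            right_inv' := fun a ha => hfk _ _ (hmem a ha)
            open_source := hopen
            open_target := Metric.isOpen_ball
            continuousOn_toFun := hf.mono inter_subset_left
            continuousOn_invFun := ?_ }, inter_subset_left, rfl, fun _ => rfl,
            fun a ha => hhk _ _ (hmem a ha), fun q hq h1 h2 => ⟨hq, h1, h2⟩⟩
  · rw [hfk _ _ (hmem a ha)]; exact ha
  · rw [hhk _ _ (hmem a ha)]; exact (hψC a ha).1
  · have := ((hψC _ hq.2.1).2 _ hq.2.2).1 (hC q hq.1)
    simp only [← this]
    exact hk q hq.1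
  · exact hkc.comp (continuousOn_id.prodMk hψ) hmem

/-! ### Products of linear factors -/

section RootProd

variable {ι : Type*}

/-- The monic polynomial function with roots `lam j`, `j ∈ T`. -/
def rootProd (T : Finset ι) (lam : ι → ℂ) (z : ℂ) : ℂ := ∏ j ∈ T, (z - lam j)

/-- The reversed polynomial function `u ^ #T * rootProd T lam u⁻¹`. -/
def rootProdRev (T : Finset ι) (lam : ι → ℂ) (u : ℂ) : ℂ := ∏ j ∈ T, (1 - lam j * u)

variable {T : Finset ι} {lam : ι → ℂ}

lemma rootProd_eq_zero {z : ℂ} : rootProd T lam z = 0 ↔ ∃ j ∈ T, z = lam j := by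
  simp [rootProd, Finset.prod_eq_zero_iff, sub_eq_zero]

@[simp] lemma rootProdRev_zero : rootProdRev T lam 0 = 1 := by simp [rootProdRev]

lemma rootProdRev_eq {u : ℂ} (hu : u ≠ 0) :
    rootProdRev T lam u = u ^ T.card * rootProd T lam u⁻¹ := by
  rw [rootProdRev, rootProd, ← Finset.prod_const, ← Finset.prod_mul_distrib]
  refine Finset.prod_congr rfl fun j _ => ?_
  field_simp

lemma differentiable_rootProd : Differentiable ℂ (rootProd T lam) := by
  unfold rootProd
  fun_prop

lemma differentiable_rootProdRev : Differentiable ℂ (rootProdRev T lam) := by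
  unfold rootProdRev
  fun_prop

/-- The derivative of a product of linear factors, in terms of its logarithmic derivative. -/
lemma hasDerivAt_rootProd {z : ℂ} (hz : rootProd T lam z ≠ 0) :
    HasDerivAt (rootProd T lam) (rootProd T lam z * ∑ j ∈ T, (z - lam j)⁻¹) z := by
  have h := logDeriv_prod (s := T) (f := fun j (z : ℂ) => z - lam j) (x := z)
    (fun j hj h0 => hz (Finset.prod_eq_zero hj h0)) (fun j _ => by fun_prop)
  have h2 := differentiable_rootProd (T := T) (lam := lam) z |>.hasDerivAt
  have h3 : deriv (rootProd T lam) z = rootProd T lam z * ∑ j ∈ T, (z - lam j)⁻¹ := by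
    rw [logDeriv_apply] at h
    change deriv (rootProd T lam) z / rootProd T lam z = _ at h
    simp only [logDeriv_apply] at h
    rw [div_eq_iff hz] at h
    rw [h, mul_comm]
    congr 1
    refine Finset.sum_congr rfl fun j _ => ?_
    rw [deriv_sub_const_fun, deriv_id'', one_div]
  rwa [h3] at h2

lemma hasDerivAt_rootProdRev_zero :
    HasDerivAt (rootProdRev T lam) (-∑ j ∈ T, lam j) 0 := by
  classical
  have h : ∀ j ∈ T, HasDerivAt (fun u : ℂ => 1 - lam j * u) (-lam j) 0 := fun j _ => by
    simpa using ((hasDerivAt_id (0 : ℂ)).const_mul (lam j)).const_sub 1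
  have := HasDerivAt.fun_finsetProd h
  simp only [mul_zero, sub_zero, Finset.prod_const_one, one_smul, Finset.sum_neg_distrib] at this
  exact this

lemma deriv_rootProd_root [DecidableEq ι] {k : ι} (hk : k ∈ T) :
    deriv (rootProd T lam) (lam k) = rootProd (T.erase k) lam (lam k) := by
  have h : rootProd T lam = fun z => (z - lam k) * rootProd (T.erase k) lam z := by
    ext z; exact (Finset.mul_prod_erase T (fun j => z - lam j) hk).symm
  have h1 : HasDerivAt (fun z => (z - lam k) * rootProd (T.erase k) lam z)
      (1 * rootProd (T.erase k) lam (lam k) +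
        (lam k - lam k) * deriv (rootProd (T.erase k) lam) (lam k)) (lam k) :=
    ((hasDerivAt_id _).sub_const _).mul (differentiable_rootProd _).hasDerivAt
  rw [h, h1.deriv]
  simp

lemma deriv_rootProd_root_ne_zero (hlam : Function.Injective lam) {k : ι} (hk : k ∈ T) :
    deriv (rootProd T lam) (lam k) ≠ 0 := by
  classical
  rw [deriv_rootProd_root hk, Ne, rootProd_eq_zero]
  rintro ⟨j, hj, h⟩
  exact (Finset.ne_of_mem_erase hj) (hlam h).symm

lemma rootProd_ne_zero_of_disjoint {T' : Finset ι} (hlam : Function.Injective lam)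
    (h : Disjoint T T') {z : ℂ} (hz : rootProd T lam z = 0) : rootProd T' lam z ≠ 0 := by
  intro h'
  obtain ⟨i, hi, rfl⟩ := rootProd_eq_zero.1 hz
  obtain ⟨j, hj, hij⟩ := rootProd_eq_zero.1 h'
  exact Finset.disjoint_left.1 h hi (hlam hij ▸ hj)

end RootProd

/-! ### The hyperelliptic curve as a curve in a product of two spheres -/

/-- Branch values `lam j` of a hyperelliptic curve of genus `g`, together with a choice `I` of half
of them. -/
structure BranchData (g : ℕ) where
  /-- the branch values -/
  lam : Fin (2 * g + 2) → ℂ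
  inj : Function.Injective lam
  /-- the indices of the branch points at which `w` has a pole -/
  I : Finset (Fin (2 * g + 2))
  card_I : I.card = g + 1

/-- Homogeneous coordinates of a point of the Riemann sphere. -/
def homog (x : OnePoint ℂ) : ℂ × ℂ := x.elim (1, 0) (fun a => (a, 1))

@[simp] lemma homog_coe (a : ℂ) : homog (a : OnePoint ℂ) = (a, 1) := rfl

@[simp] lemma homog_infty : homog OnePoint.infty = (1, 0) := rfl

namespace BranchData

variable {g : ℕ} (D : BranchData g)

lemma card_compl : (D.I)ᶜ.card = g + 1 := by
  rw [Finset.card_compl, D.card_I, Fintype.card_fin]; omega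

/-- The polynomial with the branch values of index in `I` as roots. -/
abbrev den : ℂ → ℂ := rootProd D.I D.lam

/-- The polynomial with the branch values of index not in `I` as roots. -/
abbrev num : ℂ → ℂ := rootProd D.Iᶜ D.lam

/-- `den` in the coordinate at infinity. -/
abbrev denRev : ℂ → ℂ := rootProdRev D.I D.lam

/-- `num` in the coordinate at infinity. -/
abbrev numRev : ℂ → ℂ := rootProdRev D.Iᶜ D.lam

variable {D} in
lemma denRev_eq {u : ℂ} (hu : u ≠ 0) : D.denRev u = u ^ (g + 1) * D.den u⁻¹ := by
  rw [← D.card_I]; exact rootProdRev_eq hu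

variable {D} in
lemma numRev_eq {u : ℂ} (hu : u ≠ 0) : D.numRev u = u ^ (g + 1) * D.num u⁻¹ := by
  rw [← D.card_compl]; exact rootProdRev_eq hu

/-- The closed curve `den x * w² = num x` in the product of two Riemann spheres, written in
homogeneous coordinates. -/
def OnCurve (p : OnePoint ℂ × OnePoint ℂ) : Prop :=
  (∏ i ∈ D.I, ((homog p.1).1 - D.lam i * (homog p.1).2)) * (homog p.2).1 ^ 2 =
    (∏ j ∈ D.Iᶜ, ((homog p.1).1 - D.lam j * (homog p.1).2)) * (homog p.2).2 ^ 2

lemma onCurve_coe_coe (a b : ℂ) :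
    D.OnCurve ((a : OnePoint ℂ), (b : OnePoint ℂ)) ↔ D.den a * b ^ 2 = D.num a := by
  simp [OnCurve, rootProd]

lemma onCurve_coe_infty (a : ℂ) :
    D.OnCurve ((a : OnePoint ℂ), OnePoint.infty) ↔ D.den a = 0 := by
  simp [OnCurve, rootProd]

lemma onCurve_infty_coe (b : ℂ) :
    D.OnCurve (OnePoint.infty, (b : OnePoint ℂ)) ↔ b ^ 2 = 1 := by
  simp [OnCurve]

lemma not_onCurve_infty_infty : ¬ D.OnCurve (OnePoint.infty, OnePoint.infty) := by
  simp [OnCurve]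

lemma onCurve_coe_ofInv (a v : ℂ) :
    D.OnCurve ((a : OnePoint ℂ), ofInv v) ↔ D.den a = D.num a * v ^ 2 := by
  by_cases hv : v = 0
  · simp [hv, onCurve_coe_infty]
  · rw [ofInv_of_ne hv, onCurve_coe_coe]
    field_simp

lemma onCurve_ofInv_coe (u b : ℂ) :
    D.OnCurve (ofInv u, (b : OnePoint ℂ)) ↔ D.denRev u * b ^ 2 = D.numRev u := by
  by_cases hu : u = 0
  · simp [hu, onCurve_infty_coe]
  · rw [ofInv_of_ne hu, onCurve_coe_coe, denRev_eq hu, numRev_eq hu, mul_assoc, mul_right_inj' (pow_ne_zero _ hu)]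

lemma onCurve_ofInv_ofInv (u v : ℂ) :
    D.OnCurve (ofInv u, ofInv v) ↔ D.denRev u = D.numRev u * v ^ 2 := by
  by_cases hv : v = 0
  · by_cases hu : u = 0
    · simp [hv, hu, not_onCurve_infty_infty]
    · simp [hv, ofInv_of_ne hu, onCurve_coe_infty, denRev_eq hu, hu]
  · rw [ofInv_of_ne hv, onCurve_ofInv_coe]
    field_simp

/-- The curve is closed: its equation is an equality of continuous functions in each of the four pairs
of coordinates of the product of two spheres. -/
lemma isClosed_onCurve : IsClosed {p | D.OnCurve p} := by
  have key : ∀ (c k : OnePoint ℂ → ℂ) (q r : ℂ → OnePoint ℂ) (E E' : ℂ → ℂ → ℂ)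
      (p : OnePoint ℂ × OnePoint ℂ), ContinuousAt c p.1 → ContinuousAt k p.2 →
      (∀ᶠ x in 𝓝 p.1, q (c x) = x) → (∀ᶠ w in 𝓝 p.2, r (k w) = w) →
      Continuous (fun z : ℂ × ℂ => E z.1 z.2) → Continuous (fun z : ℂ × ℂ => E' z.1 z.2) →
      (∀ a b, D.OnCurve (q a, r b) ↔ E a b = E' a b) → ¬ D.OnCurve p →
      ∀ᶠ p' in 𝓝 p, ¬ D.OnCurve p' := by
    intro c k q r E E' p hc hk hq hr hE hE' hiff hp
    have h1 : ContinuousAt (fun p : OnePoint ℂ × OnePoint ℂ => (c p.1, k p.2)) p :=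
      (hc.comp continuousAt_fst).prodMk (hk.comp continuousAt_snd)
    have h2 := (hE.continuousAt.comp h1)
    have h3 := (hE'.continuousAt.comp h1)
    have hx : ∀ᶠ p' in 𝓝 p, q (c p'.1) = p'.1 := continuousAt_fst.eventually hq
    have hw : ∀ᶠ p' in 𝓝 p, r (k p'.2) = p'.2 := continuousAt_snd.eventually hr
    have hne : E (c p.1) (k p.2) ≠ E' (c p.1) (k p.2) := by
      intro h
      apply hp
      have := (hiff _ _).2 h
      rwa [hx.self_of_nhds, hw.self_of_nhds] at this
    filter_upwards [hx, hw, (h2.ne_iff_eventually_ne h3).1 hne]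
      with p' h4 h5 h6 h7
    apply h6
    refine (hiff _ _).1 ?_
    rw [h4, h5]
    exact h7
  have ev0 : ∀ a : ℂ, ∀ᶠ x in 𝓝 (a : OnePoint ℂ), ((affine x : ℂ) : OnePoint ℂ) = x := fun a => by
    filter_upwards [isOpen_ne_infty.mem_nhds (OnePoint.coe_ne_infty a)] with x hx
    exact coe_affine hx
  have ev1 : ∀ᶠ x in 𝓝 (OnePoint.infty : OnePoint ℂ), ofInv (affineInv x) = x := by
    filter_upwards [isOpen_ne_zero.mem_nhds (OnePoint.infty_ne_coe (0 : ℂ))] with x hx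
    exact ofInv_affineInv hx
  have c0 : ∀ a : ℂ, ContinuousAt affine (a : OnePoint ℂ) := fun a =>
    continuousAt_affine (OnePoint.coe_ne_infty a)
  have c1 : ContinuousAt affineInv OnePoint.infty :=
    continuousAt_affineInv (OnePoint.infty_ne_coe (0 : ℂ))
  have e1 := (differentiable_rootProd (T := D.I) (lam := D.lam)).continuous
  have e2 := (differentiable_rootProd (T := D.Iᶜ) (lam := D.lam)).continuous
  have e3 := (differentiable_rootProdRev (T := D.I) (lam := D.lam)).continuous
  have e4 := (differentiable_rootProdRev (T := D.Iᶜ) (lam := D.lam)).continuous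
  rw [← isOpen_compl_iff, isOpen_iff_mem_nhds]
  rintro ⟨x, w⟩ hp
  induction x using OnePoint.rec with
  | infty =>
    induction w using OnePoint.rec with
    | infty => exact key _ _ _ _ _ _ _ c1 c1 ev1 ev1 (by fun_prop) (by fun_prop)
                D.onCurve_ofInv_ofInv hp
    | coe b => exact key _ _ _ _ _ _ _ c1 (c0 b) ev1 (ev0 b) (by fun_prop) (by fun_prop)
                D.onCurve_ofInv_coe hp
  | coe a =>
    induction w using OnePoint.rec with
    | infty => exact key _ _ _ _ _ _ _ (c0 a) c1 (ev0 a) ev1 (by fun_prop) (by fun_prop)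
                D.onCurve_coe_ofInv hp
    | coe b => exact key _ _ _ _ _ _ _ (c0 a) (c0 b) (ev0 a) (ev0 b) (by fun_prop) (by fun_prop)
                D.onCurve_coe_coe hp

/-- The hyperelliptic surface of the branch data. -/
def Surface : Type := {p : OnePoint ℂ × OnePoint ℂ // D.OnCurve p}

instance : TopologicalSpace D.Surface := inferInstanceAs (TopologicalSpace {p // D.OnCurve p})

instance : T2Space D.Surface := inferInstanceAs (T2Space {p // D.OnCurve p})

instance : CompactSpace D.Surface :=
  isCompact_iff_compactSpace.1 D.isClosed_onCurve.isCompact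

variable {D}

/-- The function `x` on the surface. -/
def xc (p : D.Surface) : OnePoint ℂ := p.1.1

/-- The function `w` on the surface, with `den x * w² = num x`. -/
def wc (p : D.Surface) : OnePoint ℂ := p.1.2

lemma continuous_xc : Continuous (xc (D := D)) := continuous_fst.comp continuous_subtype_val

lemma continuous_wc : Continuous (wc (D := D)) := continuous_snd.comp continuous_subtype_val

lemma ext_xw {p q : D.Surface} (hx : xc p = xc q) (hw : wc p = wc q) : p = q :=
  Subtype.ext (Prod.ext hx hw)

lemma onCurve (p : D.Surface) : D.OnCurve (xc p, wc p) := p.2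

lemma num_ne_zero {z : ℂ} (h : D.den z = 0) : D.num z ≠ 0 :=
  rootProd_ne_zero_of_disjoint D.inj disjoint_compl_right h

lemma wc_ne_infty {p : D.Surface} (h : xc p = OnePoint.infty) : wc p ≠ OnePoint.infty := by
  intro h'
  have := onCurve p
  rw [h, h'] at this
  exact D.not_onCurve_infty_infty this

lemma wc_sq_of_infty {p : D.Surface} (h : xc p = OnePoint.infty) : affine (wc p) ^ 2 = 1 := by
  have := onCurve p
  rw [h, ← coe_affine (wc_ne_infty h)] at this
  exact (D.onCurve_infty_coe _).1 this

lemma wc_ne_zero_of_infty {p : D.Surface} (h : xc p = OnePoint.infty) :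
    wc p ≠ ((0 : ℂ) : OnePoint ℂ) := by
  intro h'
  have := wc_sq_of_infty h
  simp [h'] at this

lemma den_mul_sq {p : D.Surface} (hx : xc p ≠ OnePoint.infty) (hw : wc p ≠ OnePoint.infty) :
    D.den (affine (xc p)) * affine (wc p) ^ 2 = D.num (affine (xc p)) := by
  have := onCurve p
  rwa [← coe_affine hx, ← coe_affine hw, onCurve_coe_coe] at this

lemma den_eq {p : D.Surface} (hx : xc p ≠ OnePoint.infty) (hw : wc p ≠ ((0 : ℂ) : OnePoint ℂ)) :
    D.den (affine (xc p)) = D.num (affine (xc p)) * affineInv (wc p) ^ 2 := by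
  have := onCurve p
  rwa [← coe_affine hx, ← ofInv_affineInv hw, onCurve_coe_ofInv] at this

lemma denRev_mul_sq {p : D.Surface} (hx : xc p ≠ ((0 : ℂ) : OnePoint ℂ))
    (hw : wc p ≠ OnePoint.infty) :
    D.denRev (affineInv (xc p)) * affine (wc p) ^ 2 = D.numRev (affineInv (xc p)) := by
  have := onCurve p
  rwa [← coe_affine hw, ← ofInv_affineInv hx, onCurve_ofInv_coe] at this

lemma den_ne_zero_of_wc {p : D.Surface} (hx : xc p ≠ OnePoint.infty) (hw : wc p ≠ OnePoint.infty) :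
    D.den (affine (xc p)) ≠ 0 := by
  intro h
  have h1 := den_mul_sq hx hw
  rw [h, zero_mul] at h1
  exact num_ne_zero h h1.symm

lemma num_ne_zero_of_wc {p : D.Surface} (hx : xc p ≠ OnePoint.infty)
    (hw : wc p ≠ ((0 : ℂ) : OnePoint ℂ)) : D.num (affine (xc p)) ≠ 0 := by
  intro h
  have h1 := den_eq hx hw
  rw [h, zero_mul] at h1
  exact num_ne_zero h1 h

lemma den_eq_zero_iff {p : D.Surface} (hx : xc p ≠ OnePoint.infty) :
    D.den (affine (xc p)) = 0 ↔ wc p = OnePoint.infty := by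
  refine ⟨fun h => by_contra fun hw => den_ne_zero_of_wc hx hw h, fun h => ?_⟩
  have := den_eq hx (by rw [h]; exact OnePoint.infty_ne_coe 0)
  rw [this, h]; simp

lemma num_eq_zero_iff {p : D.Surface} (hx : xc p ≠ OnePoint.infty) :
    D.num (affine (xc p)) = 0 ↔ wc p = ((0 : ℂ) : OnePoint ℂ) := by
  refine ⟨fun h => by_contra fun hw => num_ne_zero_of_wc hx hw h, fun h => ?_⟩
  have := den_mul_sq hx (by rw [h]; exact OnePoint.coe_ne_infty 0)
  rw [← this, h]; simp

end BranchData

/-! ### Coordinate charts of the hyperelliptic surface -/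

/-- A function of one complex variable with values in the Riemann sphere is holomorphic on `V`, in
the coordinates `z` and `1 / z` of the sphere. -/
structure HolSphereOn (φ : ℂ → OnePoint ℂ) (V : Set ℂ) : Prop where
  finite : DifferentiableOn ℂ (fun z => affine (φ z)) (V ∩ {z | φ z ≠ OnePoint.infty})
  inv : DifferentiableOn ℂ (fun z => affineInv (φ z)) (V ∩ {z | φ z ≠ ((0 : ℂ) : OnePoint ℂ)})

/-- One of the two standard coordinates of the Riemann sphere. -/
structure SphereCoord where
  /-- the coordinate function -/
  c : OnePoint ℂ → ℂ
  /-- its inverse -/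
  κ : ℂ → OnePoint ℂ
  /-- the set on which it is a coordinate -/
  dom : Set (OnePoint ℂ)
  isOpen_dom : IsOpen dom
  continuousAt : ∀ x ∈ dom, ContinuousAt c x
  continuous_κ : Continuous κ
  c_κ : ∀ a, c (κ a) = a
  κ_c : ∀ x ∈ dom, κ (c x) = x
  mem : ∀ a, κ a ∈ dom
  hol : ∀ (φ : ℂ → OnePoint ℂ) (V : Set ℂ), (∀ z ∈ V, φ z ∈ dom) →
    DifferentiableOn ℂ (fun z => c (φ z)) V → HolSphereOn φ V

/-- The coordinate `z`. -/
def SphereCoord.std : SphereCoord where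
  c := affine
  κ := fun a => a
  dom := {x | x ≠ OnePoint.infty}
  isOpen_dom := isOpen_ne_infty
  continuousAt := fun _ hx => continuousAt_affine hx
  continuous_κ := OnePoint.continuous_coe
  c_κ := affine_coe
  κ_c := fun _ hx => coe_affine hx
  mem := OnePoint.coe_ne_infty
  hol := fun φ V hV hφ => by
    refine ⟨hφ.mono inter_subset_left, ?_⟩
    have h : DifferentiableOn ℂ (fun z => (affine (φ z))⁻¹)
        (V ∩ {z | φ z ≠ ((0 : ℂ) : OnePoint ℂ)}) :=
      (hφ.mono inter_subset_left).inv fun z hz => affine_ne_zero (hV z hz.1) hz.2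
    exact h.congr fun z hz => affineInv_eq (hV z hz.1)

/-- The coordinate `1 / z`. -/
def SphereCoord.recip : SphereCoord where
  c := affineInv
  κ := ofInv
  dom := {x | x ≠ ((0 : ℂ) : OnePoint ℂ)}
  isOpen_dom := isOpen_ne_zero
  continuousAt := fun _ hx => continuousAt_affineInv hx
  continuous_κ := continuous_ofInv
  c_κ := affineInv_ofInv
  κ_c := fun _ hx => ofInv_affineInv hx
  mem := ofInv_ne_zero
  hol := fun φ V hV hφ => by
    refine ⟨?_, hφ.mono inter_subset_left⟩
    have h : DifferentiableOn ℂ (fun z => (affineInv (φ z))⁻¹)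
        (V ∩ {z | φ z ≠ OnePoint.infty}) :=
      (hφ.mono inter_subset_left).inv fun z hz => affineInv_ne_zero hz.2 (hV z hz.1)
    exact h.congr fun z hz => by rw [affineInv_eq hz.2, inv_inv]

namespace BranchData

variable {g : ℕ} {D : BranchData g}

lemma onCurve_one : D.OnCurve (OnePoint.infty, ((1 : ℂ) : OnePoint ℂ)) :=
  (D.onCurve_infty_coe 1).2 (one_pow 2)

open Classical in
variable (D) in
/-- The point of the surface with coordinates `x`, `w` (a junk point if they are not on the
curve). -/
def ofCoords (x w : OnePoint ℂ) : D.Surface :=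
  if h : D.OnCurve (x, w) then ⟨(x, w), h⟩ else ⟨_, onCurve_one⟩

lemma xc_ofCoords {x w : OnePoint ℂ} (h : D.OnCurve (x, w)) : xc (D.ofCoords x w) = x := by
  simp [ofCoords, h, xc]

lemma wc_ofCoords {x w : OnePoint ℂ} (h : D.OnCurve (x, w)) : wc (D.ofCoords x w) = w := by
  simp [ofCoords, h, wc]

lemma ofCoords_xc_wc (p : D.Surface) : D.ofCoords (xc p) (wc p) = p :=
  ext_xw (xc_ofCoords (onCurve p)) (wc_ofCoords (onCurve p))

lemma isInducing_xw : Topology.IsInducing (fun p : D.Surface => (xc p, wc p)) :=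
  Topology.IsInducing.subtypeVal

lemma continuousOn_ofCoords : ContinuousOn (fun c : OnePoint ℂ × OnePoint ℂ => D.ofCoords c.1 c.2)
    {c | D.OnCurve c} := by
  refine isInducing_xw.continuousOn_iff.2 (continuousOn_id.congr fun c hc => ?_)
  exact Prod.ext (xc_ofCoords hc) (wc_ofCoords hc)

/-- If the curve is given near a point by `F a = G b` in coordinates `a` of `x` and `b` of `w`, and
`G' ≠ 0`, then `a` is a coordinate on the surface. -/
lemma exists_chart_fst (X W : SphereCoord) {p : D.Surface} (hx : xc p ∈ X.dom) (hw : wc p ∈ W.dom)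
    {F G : ℂ → ℂ} (hF : AnalyticAt ℂ F (X.c (xc p))) (hG : AnalyticAt ℂ G (W.c (wc p)))
    (hG' : deriv G (W.c (wc p)) ≠ 0) {s t : Set ℂ} (hs : s ∈ 𝓝 (X.c (xc p)))
    (ht : t ∈ 𝓝 (W.c (wc p)))
    (hst : ∀ a ∈ s, ∀ b ∈ t, D.OnCurve (X.κ a, W.κ b) ↔ F a = G b) :
    ∃ (e : OpenPartialHomeomorph D.Surface ℂ) (r : ℝ), 0 < r ∧ p ∈ e.source ∧
      e.target = Metric.ball (X.c (xc p)) r ∧ (∀ q ∈ e.source, xc q ∈ X.dom) ∧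
      (∀ q, e q = X.c (xc q)) ∧ HolSphereOn (fun z => xc (e.symm z)) e.target ∧
      HolSphereOn (fun z => wc (e.symm z)) e.target := by
  have h0 : F (X.c (xc p)) = G (W.c (wc p)) := by
    refine (hst _ (mem_of_mem_nhds hs) _ (mem_of_mem_nhds ht)).1 ?_
    rw [X.κ_c _ hx, W.κ_c _ hw]
    exact onCurve p
  obtain ⟨ψ, r, δ, hr, hδ, hrs, hδt, hψ, hψF⟩ := exists_implicit hF hG h0 hG' hs ht
  have hU : IsOpen {q : D.Surface | xc q ∈ X.dom ∧ wc q ∈ W.dom} :=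
    (X.isOpen_dom.preimage continuous_xc).inter (W.isOpen_dom.preimage continuous_wc)
  have hcx : ContinuousOn (fun q : D.Surface => X.c (xc q)) {q | xc q ∈ X.dom ∧ wc q ∈ W.dom} :=
    fun q hq => ((X.continuousAt _ hq.1).comp continuous_xc.continuousAt).continuousWithinAt
  have hcw : ContinuousOn (fun q : D.Surface => W.c (wc q)) {q | xc q ∈ X.dom ∧ wc q ∈ W.dom} :=
    fun q hq => ((W.continuousAt _ hq.2).comp continuous_wc.continuousAt).continuousWithinAt
  have hk : ContinuousOn (fun c : ℂ × ℂ => D.ofCoords (X.κ c.1) (W.κ c.2))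
      {c | D.OnCurve (X.κ c.1, W.κ c.2)} :=
    ContinuousOn.comp (t := {c | D.OnCurve c}) continuousOn_ofCoords
      (f := fun c : ℂ × ℂ => (X.κ c.1, W.κ c.2))
      ((X.continuous_κ.comp continuous_fst).prodMk (W.continuous_κ.comp continuous_snd)).continuousOn
      fun c hc => hc
  obtain ⟨e, he1, he2, he3, he4, he5⟩ := exists_chart_of_graph hU hcx hcw
    (C := {c | D.OnCurve (X.κ c.1, W.κ c.2)}) (k := fun a b => D.ofCoords (X.κ a) (W.κ b))
    (a₀ := X.c (xc p)) (b₀ := W.c (wc p)) (ψ := ψ) (r := r) (δ := δ)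
    (fun q hq => by
      change D.OnCurve (X.κ (X.c (xc q)), W.κ (W.c (wc q)))
      rw [X.κ_c _ hq.1, W.κ_c _ hq.2]; exact onCurve q)
    (fun a b hab => by
      change xc (D.ofCoords (X.κ a) (W.κ b)) ∈ _ ∧ wc (D.ofCoords (X.κ a) (W.κ b)) ∈ _
      rw [xc_ofCoords hab, wc_ofCoords hab]; exact ⟨X.mem a, W.mem b⟩)
    (fun a b hab => by rw [xc_ofCoords hab, X.c_κ])
    (fun a b hab => by rw [wc_ofCoords hab, W.c_κ])
    (fun q hq => by rw [X.κ_c _ hq.1, W.κ_c _ hq.2, ofCoords_xc_wc]) hk hψ.continuousOn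
    (fun a ha => ⟨(hψF a ha).1, fun b hb =>
      (hst a (hrs ha) b (hδt hb)).trans ((hψF a ha).2 b hb)⟩)
  have hsrc : ∀ z ∈ e.target, e.symm z ∈ e.source := fun z hz => e.map_target hz
  refine ⟨e, r, hr, he5 p ⟨hx, hw⟩ (Metric.mem_ball_self hr) (Metric.mem_ball_self hδ), he2,
    fun q hq => (he1 hq).1, he3, X.hol _ _ (fun z hz => (he1 (hsrc z hz)).1) ?_,
    W.hol _ _ (fun z hz => (he1 (hsrc z hz)).2) ?_⟩
  · refine differentiableOn_id.congr fun z hz => ?_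
    rw [← he3, e.right_inv hz]; rfl
  · rw [he2]
    exact hψ.congr fun z hz => he4 z hz

/-- The counterpart of `exists_chart_fst` with the roles of `x` and `w` exchanged. -/
lemma exists_chart_snd (X W : SphereCoord) {p : D.Surface} (hx : xc p ∈ X.dom) (hw : wc p ∈ W.dom)
    {F G : ℂ → ℂ} (hF : AnalyticAt ℂ F (X.c (xc p))) (hG : AnalyticAt ℂ G (W.c (wc p)))
    (hF' : deriv F (X.c (xc p)) ≠ 0) {s t : Set ℂ} (hs : s ∈ 𝓝 (X.c (xc p)))
    (ht : t ∈ 𝓝 (W.c (wc p)))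
    (hst : ∀ a ∈ s, ∀ b ∈ t, D.OnCurve (X.κ a, W.κ b) ↔ F a = G b) :
    ∃ (e : OpenPartialHomeomorph D.Surface ℂ) (r : ℝ), 0 < r ∧ p ∈ e.source ∧
      e.target = Metric.ball (W.c (wc p)) r ∧ (∀ q ∈ e.source, wc q ∈ W.dom) ∧
      (∀ q, e q = W.c (wc q)) ∧ HolSphereOn (fun z => xc (e.symm z)) e.target ∧
      HolSphereOn (fun z => wc (e.symm z)) e.target := by
  have h0 : F (X.c (xc p)) = G (W.c (wc p)) := by
    refine (hst _ (mem_of_mem_nhds hs) _ (mem_of_mem_nhds ht)).1 ?_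
    rw [X.κ_c _ hx, W.κ_c _ hw]
    exact onCurve p
  obtain ⟨ψ, r, δ, hr, hδ, hrt, hδs, hψ, hψF⟩ := exists_implicit hG hF h0.symm hF' ht hs
  have hU : IsOpen {q : D.Surface | xc q ∈ X.dom ∧ wc q ∈ W.dom} :=
    (X.isOpen_dom.preimage continuous_xc).inter (W.isOpen_dom.preimage continuous_wc)
  have hcx : ContinuousOn (fun q : D.Surface => X.c (xc q)) {q | xc q ∈ X.dom ∧ wc q ∈ W.dom} :=
    fun q hq => ((X.continuousAt _ hq.1).comp continuous_xc.continuousAt).continuousWithinAt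
  have hcw : ContinuousOn (fun q : D.Surface => W.c (wc q)) {q | xc q ∈ X.dom ∧ wc q ∈ W.dom} :=
    fun q hq => ((W.continuousAt _ hq.2).comp continuous_wc.continuousAt).continuousWithinAt
  have hk : ContinuousOn (fun c : ℂ × ℂ => D.ofCoords (X.κ c.2) (W.κ c.1))
      {c | D.OnCurve (X.κ c.2, W.κ c.1)} :=
    ContinuousOn.comp (t := {c | D.OnCurve c}) continuousOn_ofCoords
      (f := fun c : ℂ × ℂ => (X.κ c.2, W.κ c.1))
      ((X.continuous_κ.comp continuous_snd).prodMk (W.continuous_κ.comp continuous_fst)).continuousOn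
      fun c hc => hc
  obtain ⟨e, he1, he2, he3, he4, he5⟩ := exists_chart_of_graph hU hcw hcx
    (C := {c | D.OnCurve (X.κ c.2, W.κ c.1)}) (k := fun b a => D.ofCoords (X.κ a) (W.κ b))
    (a₀ := W.c (wc p)) (b₀ := X.c (xc p)) (ψ := ψ) (r := r) (δ := δ)
    (fun q hq => by
      change D.OnCurve (X.κ (X.c (xc q)), W.κ (W.c (wc q)))
      rw [X.κ_c _ hq.1, W.κ_c _ hq.2]; exact onCurve q)
    (fun b a hab => by
      change xc (D.ofCoords (X.κ a) (W.κ b)) ∈ _ ∧ wc (D.ofCoords (X.κ a) (W.κ b)) ∈ _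
      rw [xc_ofCoords hab, wc_ofCoords hab]; exact ⟨X.mem a, W.mem b⟩)
    (fun b a hab => by rw [wc_ofCoords hab, W.c_κ])
    (fun b a hab => by rw [xc_ofCoords hab, X.c_κ])
    (fun q hq => by rw [X.κ_c _ hq.1, W.κ_c _ hq.2, ofCoords_xc_wc]) hk hψ.continuousOn
    (fun b hb => ⟨(hψF b hb).1, fun a ha =>
      (hst a (hδs ha) b (hrt hb)).trans (eq_comm.trans ((hψF b hb).2 a ha))⟩)
  have hsrc : ∀ z ∈ e.target, e.symm z ∈ e.source := fun z hz => e.map_target hz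
  refine ⟨e, r, hr, he5 p ⟨hx, hw⟩ (Metric.mem_ball_self hr) (Metric.mem_ball_self hδ), he2,
    fun q hq => (he1 hq).2, he3, X.hol _ _ (fun z hz => (he1 (hsrc z hz)).1) ?_,
    W.hol _ _ (fun z hz => (he1 (hsrc z hz)).2) ?_⟩
  · rw [he2]
    exact hψ.congr fun z hz => he4 z hz
  · refine differentiableOn_id.congr fun z hz => ?_
    rw [← he3, e.right_inv hz]; rfl

/-- A chart of the surface whose coordinate is one of `x`, `1 / x`, `w`, `1 / w`, and in which `x`
and `w` are holomorphic. -/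
structure IsCoordChart (e : OpenPartialHomeomorph D.Surface ℂ) : Prop where
  hol_x : HolSphereOn (fun z => xc (e.symm z)) e.target
  hol_w : HolSphereOn (fun z => wc (e.symm z)) e.target
  coord : ((∀ q ∈ e.source, xc q ≠ OnePoint.infty ∧ e q = affine (xc q)) ∨
      (∀ q ∈ e.source, xc q ≠ ((0 : ℂ) : OnePoint ℂ) ∧ e q = affineInv (xc q))) ∨
    ((∀ q ∈ e.source, wc q ≠ OnePoint.infty ∧ e q = affine (wc q)) ∨
      (∀ q ∈ e.source, wc q ≠ ((0 : ℂ) : OnePoint ℂ) ∧ e q = affineInv (wc q)))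

lemma IsCoordChart.differentiableOn_trans {e e' : OpenPartialHomeomorph D.Surface ℂ}
    (he : IsCoordChart e) (he' : IsCoordChart e') :
    DifferentiableOn ℂ (e' ∘ e.symm) (e.target ∩ e.symm ⁻¹' e'.source) := by
  rcases he'.coord with (h | h) | (h | h)
  · exact (he.hol_x.finite.mono fun z hz => ⟨hz.1, (h _ hz.2).1⟩).congr fun z hz => (h _ hz.2).2
  · exact (he.hol_x.inv.mono fun z hz => ⟨hz.1, (h _ hz.2).1⟩).congr fun z hz => (h _ hz.2).2
  · exact (he.hol_w.finite.mono fun z hz => ⟨hz.1, (h _ hz.2).1⟩).congr fun z hz => (h _ hz.2).2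
  · exact (he.hol_w.inv.mono fun z hz => ⟨hz.1, (h _ hz.2).1⟩).congr fun z hz => (h _ hz.2).2

lemma analyticAt_div_rootProd {ι : Type*} {T T' : Finset ι} {lam : ι → ℂ} {a : ℂ}
    (h : rootProd T' lam a ≠ 0) : AnalyticAt ℂ (fun z => rootProd T lam z / rootProd T' lam z) a :=
  (differentiable_rootProd.analyticAt a).div (differentiable_rootProd.analyticAt a) h

/-- At an unramified point over a finite value, `x` is a coordinate. -/
lemma exists_chart_x {p : D.Surface} (hx : xc p ≠ OnePoint.infty) (hw : wc p ≠ OnePoint.infty)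
    (hw0 : wc p ≠ ((0 : ℂ) : OnePoint ℂ)) :
    ∃ (e : OpenPartialHomeomorph D.Surface ℂ) (r : ℝ), 0 < r ∧ p ∈ e.source ∧
      e.target = Metric.ball (e p) r ∧ (∀ q ∈ e.source, xc q ≠ OnePoint.infty) ∧
      (∀ q, e q = affine (xc q)) ∧ IsCoordChart e := by
  have hB := den_ne_zero_of_wc hx hw
  obtain ⟨e, r, hr, hp, het, hes, hef, h1, h2⟩ := exists_chart_fst (p := p) .std .std hx hw
    (F := fun a => D.num a / D.den a) (G := fun b => b ^ 2) (analyticAt_div_rootProd hB)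
    (by fun_prop) (by simpa [SphereCoord.std] using affine_ne_zero hw hw0)
    (s := {a | D.den a ≠ 0}) (t := univ)
    (differentiable_rootProd.continuous.continuousAt.eventually_ne hB) univ_mem
    (fun a ha b _ => by
      change D.OnCurve ((a : OnePoint ℂ), (b : OnePoint ℂ)) ↔ _
      rw [onCurve_coe_coe, div_eq_iff ha, eq_comm, mul_comm])
  exact ⟨e, r, hr, hp, by rw [het, hef], hes, hef, h1, h2, Or.inl (Or.inl fun q hq => ⟨hes q hq, hef q⟩)⟩

/-- At a branch point where `w = 0`, the function `w` is a coordinate. -/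
lemma exists_chart_w {p : D.Surface} (hw0 : wc p = ((0 : ℂ) : OnePoint ℂ)) :
    ∃ (e : OpenPartialHomeomorph D.Surface ℂ) (r : ℝ), 0 < r ∧ p ∈ e.source ∧
      e.target = Metric.ball (e p) r ∧ (∀ q ∈ e.source, wc q ≠ OnePoint.infty) ∧
      (∀ q, e q = affine (wc q)) ∧ IsCoordChart e := by
  have hx : xc p ≠ OnePoint.infty := fun h => wc_ne_zero_of_infty h hw0
  have hw : wc p ≠ OnePoint.infty := by rw [hw0]; exact OnePoint.coe_ne_infty 0
  have hB := den_ne_zero_of_wc hx hw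
  have hA : rootProd D.Iᶜ D.lam (affine (xc p)) = 0 := (num_eq_zero_iff hx).2 hw0
  obtain ⟨k, hk, hkx⟩ := rootProd_eq_zero.1 hA
  have hd : deriv (fun a => D.num a / D.den a) (affine (xc p)) ≠ 0 := by
    rw [deriv_fun_div (differentiable_rootProd _) (differentiable_rootProd _) hB, hA, zero_mul,
      sub_zero]
    refine div_ne_zero (mul_ne_zero ?_ hB) (pow_ne_zero _ hB)
    rw [hkx]
    exact deriv_rootProd_root_ne_zero D.inj hk
  obtain ⟨e, r, hr, hp, het, hes, hef, h1, h2⟩ := exists_chart_snd (p := p) .std .std hx hw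
    (F := fun a => D.num a / D.den a) (G := fun b => b ^ 2) (analyticAt_div_rootProd hB)
    (by fun_prop) hd
    (s := {a | D.den a ≠ 0}) (t := univ)
    (differentiable_rootProd.continuous.continuousAt.eventually_ne hB) univ_mem
    (fun a ha b _ => by
      change D.OnCurve ((a : OnePoint ℂ), (b : OnePoint ℂ)) ↔ _
      rw [onCurve_coe_coe, div_eq_iff ha, eq_comm, mul_comm])
  exact ⟨e, r, hr, hp, by rw [het, hef], hes, hef, h1, h2, Or.inr (Or.inl fun q hq => ⟨hes q hq, hef q⟩)⟩

/-- At a branch point where `w = ∞`, the function `1 / w` is a coordinate. -/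
lemma exists_chart_wInv {p : D.Surface} (hw : wc p = OnePoint.infty) :
    ∃ (e : OpenPartialHomeomorph D.Surface ℂ) (r : ℝ), 0 < r ∧ p ∈ e.source ∧
      e.target = Metric.ball (e p) r ∧ (∀ q ∈ e.source, wc q ≠ ((0 : ℂ) : OnePoint ℂ)) ∧
      (∀ q, e q = affineInv (wc q)) ∧ IsCoordChart e := by
  have hx : xc p ≠ OnePoint.infty := fun h => wc_ne_infty h hw
  have hw0 : wc p ≠ ((0 : ℂ) : OnePoint ℂ) := by rw [hw]; exact OnePoint.infty_ne_coe 0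
  have hA := num_ne_zero_of_wc hx hw0
  have hB : rootProd D.I D.lam (affine (xc p)) = 0 := (den_eq_zero_iff hx).2 hw
  obtain ⟨k, hk, hkx⟩ := rootProd_eq_zero.1 hB
  have hd : deriv (fun a => D.den a / D.num a) (affine (xc p)) ≠ 0 := by
    rw [deriv_fun_div (differentiable_rootProd _) (differentiable_rootProd _) hA, hB, zero_mul,
      sub_zero]
    refine div_ne_zero (mul_ne_zero ?_ hA) (pow_ne_zero _ hA)
    rw [hkx]
    exact deriv_rootProd_root_ne_zero D.inj hk
  obtain ⟨e, r, hr, hp, het, hes, hef, h1, h2⟩ := exists_chart_snd (p := p) .std .recip hx hw0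
    (F := fun a => D.den a / D.num a) (G := fun b => b ^ 2) (analyticAt_div_rootProd hA)
    (by fun_prop) hd
    (s := {a | D.num a ≠ 0}) (t := univ)
    (differentiable_rootProd.continuous.continuousAt.eventually_ne hA) univ_mem
    (fun a ha b _ => by
      change D.OnCurve ((a : OnePoint ℂ), ofInv b) ↔ _
      rw [onCurve_coe_ofInv, div_eq_iff ha, mul_comm])
  exact ⟨e, r, hr, hp, by rw [het, hef], hes, hef, h1, h2, Or.inr (Or.inr fun q hq => ⟨hes q hq, hef q⟩)⟩

/-- At the points over `x = ∞`, the function `1 / x` is a coordinate. -/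
lemma exists_chart_xInv {p : D.Surface} (hx : xc p = OnePoint.infty) :
    ∃ (e : OpenPartialHomeomorph D.Surface ℂ) (r : ℝ), 0 < r ∧ p ∈ e.source ∧
      e.target = Metric.ball (e p) r ∧ (∀ q ∈ e.source, xc q ≠ ((0 : ℂ) : OnePoint ℂ)) ∧
      (∀ q, e q = affineInv (xc q)) ∧ IsCoordChart e := by
  have hx0 : xc p ≠ ((0 : ℂ) : OnePoint ℂ) := by rw [hx]; exact OnePoint.infty_ne_coe 0
  have hw := wc_ne_infty hx
  have hw0 := wc_ne_zero_of_infty hx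
  have hB : D.denRev (affineInv (xc p)) ≠ 0 := by rw [hx]; simp
  obtain ⟨e, r, hr, hp, het, hes, hef, h1, h2⟩ := exists_chart_fst (p := p) .recip .std hx0 hw
    (F := fun a => D.numRev a / D.denRev a) (G := fun b => b ^ 2)
    ((differentiable_rootProdRev.analyticAt _).div (differentiable_rootProdRev.analyticAt _) hB)
    (by fun_prop) (by simpa [SphereCoord.std] using affine_ne_zero hw hw0)
    (s := {a | D.denRev a ≠ 0}) (t := univ)
    (differentiable_rootProdRev.continuous.continuousAt.eventually_ne hB) univ_mem
    (fun a ha b _ => by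
      change D.OnCurve (ofInv a, (b : OnePoint ℂ)) ↔ _
      rw [onCurve_ofInv_coe, div_eq_iff ha, eq_comm, mul_comm])
  exact ⟨e, r, hr, hp, by rw [het, hef], hes, hef, h1, h2, Or.inl (Or.inr fun q hq => ⟨hes q hq, hef q⟩)⟩

lemma exists_coordChart (p : D.Surface) : ∃ (e : OpenPartialHomeomorph D.Surface ℂ) (r : ℝ), 0 < r ∧
    p ∈ e.source ∧ e.target = Metric.ball (e p) r ∧ IsCoordChart e := by
  by_cases hx : xc p = OnePoint.infty
  · obtain ⟨e, r, h1, h2, h3, -, -, h4⟩ := exists_chart_xInv hx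
    exact ⟨e, r, h1, h2, h3, h4⟩
  by_cases hw : wc p = OnePoint.infty
  · obtain ⟨e, r, h1, h2, h3, -, -, h4⟩ := exists_chart_wInv hw
    exact ⟨e, r, h1, h2, h3, h4⟩
  by_cases hw0 : wc p = ((0 : ℂ) : OnePoint ℂ)
  · obtain ⟨e, r, h1, h2, h3, -, -, h4⟩ := exists_chart_w hw0
    exact ⟨e, r, h1, h2, h3, h4⟩
  · obtain ⟨e, r, h1, h2, h3, -, -, h4⟩ := exists_chart_x hx hw hw0
    exact ⟨e, r, h1, h2, h3, h4⟩

/-- A coordinate chart which is the restriction of a coordinate chart to a set whose image has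
compact closure in the larger domain. -/
structure IsSmallChart (e : OpenPartialHomeomorph D.Surface ℂ) : Prop where
  isCoordChart : IsCoordChart e
  exists_large : ∃ (E : OpenPartialHomeomorph D.Surface ℂ) (K : Set ℂ), IsCoordChart E ∧ IsCompact K ∧
    e.target ⊆ K ∧ K ⊆ E.target ∧ ⇑e.symm = E.symm

lemma exists_smallChart (p : D.Surface) : ∃ e : OpenPartialHomeomorph D.Surface ℂ,
    p ∈ e.source ∧ IsSmallChart e := by
  obtain ⟨E, r, hr, hp, hE, hEc⟩ := exists_coordChart p
  set e := (E.symm.restr (Metric.ball (E p) (r / 2))).symm with he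
  have hes : e.target = E.target ∩ Metric.ball (E p) (r / 2) := by
    simp [he, Metric.isOpen_ball.interior_eq]
  have hsub : e.source ⊆ E.source := by
    intro q hq
    have : q ∈ E.source ∩ _ := hq
    exact this.1
  have hps : p ∈ e.source := by
    have h1 : E p ∈ e.target := by
      rw [hes]
      exact ⟨E.map_source hp, Metric.mem_ball_self (by positivity)⟩
    have h2 := e.map_target h1
    have h3 : e.symm (E p) = p := E.left_inv hp
    rwa [h3] at h2
  refine ⟨e, hps, ⟨⟨⟨?_, ?_⟩, ⟨?_, ?_⟩, ?_⟩, E, Metric.closedBall (E p) (r / 2), hEc,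
    isCompact_closedBall _ _, ?_, ?_, rfl⟩⟩
  · exact hEc.hol_x.finite.mono (inter_subset_inter_left _ (hes ▸ inter_subset_left))
  · exact hEc.hol_x.inv.mono (inter_subset_inter_left _ (hes ▸ inter_subset_left))
  · exact hEc.hol_w.finite.mono (inter_subset_inter_left _ (hes ▸ inter_subset_left))
  · exact hEc.hol_w.inv.mono (inter_subset_inter_left _ (hes ▸ inter_subset_left))
  · exact hEc.coord.imp
      (Or.imp (fun h q hq => h q (hsub hq)) (fun h q hq => h q (hsub hq)))
      (Or.imp (fun h q hq => h q (hsub hq)) (fun h q hq => h q (hsub hq)))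
  · rw [hes]
    exact inter_subset_right.trans Metric.ball_subset_closedBall
  · rw [hE]
    exact Metric.closedBall_subset_ball (by linarith)

variable (D) in
lemma exists_finite_atlas : ∃ 𝒜 : Set (OpenPartialHomeomorph D.Surface ℂ), 𝒜.Finite ∧
    (∀ e ∈ 𝒜, IsSmallChart e) ∧ ∀ p, ∃ e ∈ 𝒜, p ∈ e.source := by
  choose e hp he using exists_smallChart (D := D)
  obtain ⟨t, ht⟩ := isCompact_univ.elim_finite_subcover (fun p => (e p).source)
    (fun p => (e p).open_source) (fun p _ => mem_iUnion.2 ⟨p, hp p⟩)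
  refine ⟨e '' t, t.finite_toSet.image _, by rintro _ ⟨p, _, rfl⟩; exact he p, fun p => ?_⟩
  obtain ⟨q, hq, hpq⟩ := mem_iUnion₂.1 (ht (mem_univ p))
  exact ⟨e q, ⟨q, hq, rfl⟩, hpq⟩

/-- A finite atlas of coordinate charts. Finiteness makes every atlas-indexed family of estimates
uniform. -/
instance : ChartedSpace ℂ D.Surface where
  atlas := D.exists_finite_atlas.choose
  chartAt p := (D.exists_finite_atlas.choose_spec.2.2 p).choose
  mem_chart_source p := (D.exists_finite_atlas.choose_spec.2.2 p).choose_spec.2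
  chart_mem_atlas p := (D.exists_finite_atlas.choose_spec.2.2 p).choose_spec.1

lemma finite_atlas : (atlas ℂ D.Surface).Finite := D.exists_finite_atlas.choose_spec.1

lemma isSmallChart_of_mem_atlas {e : OpenPartialHomeomorph D.Surface ℂ}
    (he : e ∈ atlas ℂ D.Surface) : IsSmallChart e := D.exists_finite_atlas.choose_spec.2.1 e he

lemma IsCoordChart.contDiffOn_trans {e e' : OpenPartialHomeomorph D.Surface ℂ}
    (he : IsCoordChart e) (he' : IsCoordChart e') :
    ContDiffOn ℂ ω (e.symm ≫ₕ e') (e.symm ≫ₕ e').source := by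
  have h : (e.symm ≫ₕ e').source = e.target ∩ e.symm ⁻¹' e'.source := by
    simp
  have ho : IsOpen (e.target ∩ e.symm ⁻¹' e'.source) := h ▸ (e.symm ≫ₕ e').open_source
  rw [h]
  exact (he.differentiableOn_trans he').contDiffOn ho

instance : IsManifold 𝓘(ℂ) ω D.Surface := by
  refine isManifold_of_contDiffOn _ _ _ fun e e' he he' => ?_
  have := (isSmallChart_of_mem_atlas he).isCoordChart.contDiffOn_trans
    (isSmallChart_of_mem_atlas he').isCoordChart
  simpa using this

lemma IsCoordChart.mem_maximalAtlas {e : OpenPartialHomeomorph D.Surface ℂ} (he : IsCoordChart e) :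
    e ∈ IsManifold.maximalAtlas 𝓘(ℂ) ω D.Surface := by
  rw [IsManifold.maximalAtlas, mem_maximalAtlas_iff]
  intro e' he'
  have he'' := (isSmallChart_of_mem_atlas he').isCoordChart
  rw [contDiffGroupoid, mem_groupoid_of_pregroupoid, mem_groupoid_of_pregroupoid]
  constructor
  · refine ⟨?_, ?_⟩
    · simpa [contDiffPregroupoid] using he.contDiffOn_trans he''
    · simpa [contDiffPregroupoid] using he''.contDiffOn_trans he
  · refine ⟨?_, ?_⟩
    · simpa [contDiffPregroupoid] using he''.contDiffOn_trans he
    · simpa [contDiffPregroupoid] using he.contDiffOn_trans he''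

end BranchData

/-! ### Holomorphic functions and 1-forms in charts -/

section Charts

variable {S : Type*} [TopologicalSpace S] [ChartedSpace ℂ S]
  {e e' : OpenPartialHomeomorph S ℂ} {f : S → ℂ} {z : ℂ}

lemma mem_maximalAtlas_one (he : e ∈ IsManifold.maximalAtlas 𝓘(ℂ) ω S) :
    e ∈ IsManifold.maximalAtlas 𝓘(ℂ) 1 S :=
  IsManifold.maximalAtlas_subset_of_le le_top he

lemma mdifferentiableAt_symm (he : e ∈ IsManifold.maximalAtlas 𝓘(ℂ) ω S) (hz : z ∈ e.target) :
    MDifferentiableAt 𝓘(ℂ) 𝓘(ℂ) e.symm z :=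
  mdifferentiableAt_symm_of_mem_maximalAtlas (mem_maximalAtlas_one he) hz

/-- A function is holomorphic at a point if and only if it is so in a chart. -/
lemma mdifferentiableAt_iff_chart (he : e ∈ IsManifold.maximalAtlas 𝓘(ℂ) ω S)
    (hz : z ∈ e.target) :
    MDifferentiableAt 𝓘(ℂ) 𝓘(ℂ) f (e.symm z) ↔ DifferentiableAt ℂ (fun ζ => f (e.symm ζ)) z := by
  constructor
  · intro h
    exact (h.comp z (mdifferentiableAt_symm he hz)).differentiableAt
  · intro h
    have h1 : MDifferentiableAt 𝓘(ℂ) 𝓘(ℂ) e (e.symm z) :=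
      mdifferentiableAt_of_mem_maximalAtlas (mem_maximalAtlas_one he) (e.map_target hz)
    have h2 : MDifferentiableAt 𝓘(ℂ) 𝓘(ℂ) (fun ζ => f (e.symm ζ)) (e (e.symm z)) := by
      rw [e.right_inv hz]; exact h.mdifferentiableAt
    refine (h2.comp (e.symm z) h1).congr_of_eventuallyEq ?_
    filter_upwards [e.open_source.mem_nhds (e.map_target hz)] with q hq
    exact congrArg f (e.left_inv hq).symm

lemma mdifferentiableAt_iff_chart' (he : e ∈ IsManifold.maximalAtlas 𝓘(ℂ) ω S) {p : S}
    (hp : p ∈ e.source) :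
    MDifferentiableAt 𝓘(ℂ) 𝓘(ℂ) f p ↔ DifferentiableAt ℂ (fun ζ => f (e.symm ζ)) (e p) := by
  rw [← mdifferentiableAt_iff_chart he (e.map_source hp), e.left_inv hp]

lemma clm_apply_eq_mul (L : ℂ →L[ℂ] ℂ) (v : ℂ) : L v = v * L 1 := by
  simpa using L.map_smul v 1

/-- The tangent vector `∂/∂z` of a chart. -/
def chartVec (e : OpenPartialHomeomorph S ℂ) (z : ℂ) : ℂ :=
  (mfderiv 𝓘(ℂ) 𝓘(ℂ) e.symm z : ℂ →L[ℂ] ℂ) (1 : ℂ)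

/-- The derivative of a function at `p`, in the trivialization of the tangent space at `p`. -/
def mderiv (f : S → ℂ) (p : S) : ℂ := (mfderiv 𝓘(ℂ) 𝓘(ℂ) f p : ℂ →L[ℂ] ℂ) (1 : ℂ)

lemma deriv_chart (he : e ∈ IsManifold.maximalAtlas 𝓘(ℂ) ω S) (hz : z ∈ e.target)
    (hf : MDifferentiableAt 𝓘(ℂ) 𝓘(ℂ) f (e.symm z)) :
    deriv (fun ζ => f (e.symm ζ)) z = chartVec e z * mderiv f (e.symm z) := by
  have h1 := mfderiv_comp z hf (mdifferentiableAt_symm he hz)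
  rw [← fderiv_apply_one_eq_deriv, ← mfderiv_eq_fderiv]
  have h2 : (mfderiv 𝓘(ℂ) 𝓘(ℂ) (fun ζ => f (e.symm ζ)) z : ℂ →L[ℂ] ℂ) (1 : ℂ) =
      (mfderiv 𝓘(ℂ) 𝓘(ℂ) f (e.symm z) : ℂ →L[ℂ] ℂ) (chartVec e z) := by
    have := DFunLike.congr_fun h1 (1 : ℂ)
    exact this
  refine h2.trans ?_
  exact clm_apply_eq_mul (mfderiv 𝓘(ℂ) 𝓘(ℂ) f (e.symm z) : ℂ →L[ℂ] ℂ) (chartVec e z)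

lemma chartVec_ne_zero (he : e ∈ IsManifold.maximalAtlas 𝓘(ℂ) ω S) (hz : z ∈ e.target) :
    chartVec e z ≠ 0 := by
  have h1 : MDifferentiableAt 𝓘(ℂ) 𝓘(ℂ) e (e.symm z) :=
    mdifferentiableAt_of_mem_maximalAtlas (mem_maximalAtlas_one he) (e.map_target hz)
  have h := deriv_chart he hz h1
  have h2 : deriv (fun ζ => e (e.symm ζ)) z = 1 := by
    have : (fun ζ => e (e.symm ζ)) =ᶠ[𝓝 z] id := by
      filter_upwards [e.open_target.mem_nhds hz] with ζ hζ
      exact e.right_inv hζ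
    rw [this.deriv_eq, deriv_id]
  intro h0
  rw [h2, h0, zero_mul] at h
  exact one_ne_zero h

lemma coeffIn_eq (α : ∀ p : S, TangentSpace 𝓘(ℂ) p →L[ℂ] ℂ) (e : OpenPartialHomeomorph S ℂ) (z : ℂ) :
    coeffIn α e z = chartVec e z * (α (e.symm z) : ℂ →L[ℂ] ℂ) (1 : ℂ) := by
  exact clm_apply_eq_mul (α (e.symm z) : ℂ →L[ℂ] ℂ) (chartVec e z)

/-- The derivative of one chart in another does not vanish. -/
lemma deriv_chart_chart_ne_zero (he : e ∈ IsManifold.maximalAtlas 𝓘(ℂ) ω S)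
    (he' : e' ∈ IsManifold.maximalAtlas 𝓘(ℂ) ω S) (hz : z ∈ e.target) (hz' : e.symm z ∈ e'.source) :
    deriv (fun ζ => e' (e.symm ζ)) z ≠ 0 := by
  have h1 : MDifferentiableAt 𝓘(ℂ) 𝓘(ℂ) e' (e.symm z) :=
    mdifferentiableAt_of_mem_maximalAtlas (mem_maximalAtlas_one he') hz'
  rw [deriv_chart he hz h1]
  refine mul_ne_zero (chartVec_ne_zero he hz) ?_
  have h2 : MDifferentiableAt 𝓘(ℂ) 𝓘(ℂ) e' (e'.symm (e' (e.symm z))) := by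
    rwa [e'.left_inv hz']
  have h3 := deriv_chart he' (e'.map_source hz') h2
  have h4 : deriv (fun ζ => e' (e'.symm ζ)) (e' (e.symm z)) = 1 := by
    have : (fun ζ => e' (e'.symm ζ)) =ᶠ[𝓝 (e' (e.symm z))] id := by
      filter_upwards [e'.open_target.mem_nhds (e'.map_source hz')] with ζ hζ
      exact e'.right_inv hζ
    rw [this.deriv_eq, deriv_id]
  rw [e'.left_inv hz', h4] at h3
  intro h0
  rw [h0, mul_zero] at h3
  exact one_ne_zero h3

end Charts

namespace BranchData

variable {g : ℕ} {D : BranchData g} {e : OpenPartialHomeomorph D.Surface ℂ} {p : D.Surface} {z : ℂ}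

lemma mdifferentiableAt_x (hx : xc p ≠ OnePoint.infty) :
    MDifferentiableAt 𝓘(ℂ) 𝓘(ℂ) (fun q => affine (xc q)) p := by
  obtain ⟨e, r, -, hp, -, he⟩ := exists_coordChart p
  rw [mdifferentiableAt_iff_chart' he.mem_maximalAtlas hp]
  refine he.hol_x.finite.differentiableAt (inter_mem (e.open_target.mem_nhds (e.map_source hp)) ?_)
  have hc : ContinuousAt (fun ζ => xc (e.symm ζ)) (e p) :=
    continuous_xc.continuousAt.comp (e.continuousAt_symm (e.map_source hp))
  exact hc.eventually_mem (isOpen_ne_infty.mem_nhds (by rwa [e.left_inv hp]))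

lemma mdifferentiableAt_xInv (hx : xc p ≠ ((0 : ℂ) : OnePoint ℂ)) :
    MDifferentiableAt 𝓘(ℂ) 𝓘(ℂ) (fun q => affineInv (xc q)) p := by
  obtain ⟨e, r, -, hp, -, he⟩ := exists_coordChart p
  rw [mdifferentiableAt_iff_chart' he.mem_maximalAtlas hp]
  refine he.hol_x.inv.differentiableAt (inter_mem (e.open_target.mem_nhds (e.map_source hp)) ?_)
  have hc : ContinuousAt (fun ζ => xc (e.symm ζ)) (e p) :=
    continuous_xc.continuousAt.comp (e.continuousAt_symm (e.map_source hp))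
  exact hc.eventually_mem (isOpen_ne_zero.mem_nhds (by rwa [e.left_inv hp]))

lemma mdifferentiableAt_w (hw : wc p ≠ OnePoint.infty) :
    MDifferentiableAt 𝓘(ℂ) 𝓘(ℂ) (fun q => affine (wc q)) p := by
  obtain ⟨e, r, -, hp, -, he⟩ := exists_coordChart p
  rw [mdifferentiableAt_iff_chart' he.mem_maximalAtlas hp]
  refine he.hol_w.finite.differentiableAt (inter_mem (e.open_target.mem_nhds (e.map_source hp)) ?_)
  have hc : ContinuousAt (fun ζ => wc (e.symm ζ)) (e p) :=
    continuous_wc.continuousAt.comp (e.continuousAt_symm (e.map_source hp))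
  exact hc.eventually_mem (isOpen_ne_infty.mem_nhds (by rwa [e.left_inv hp]))

lemma mdifferentiableAt_wInv (hw : wc p ≠ ((0 : ℂ) : OnePoint ℂ)) :
    MDifferentiableAt 𝓘(ℂ) 𝓘(ℂ) (fun q => affineInv (wc q)) p := by
  obtain ⟨e, r, -, hp, -, he⟩ := exists_coordChart p
  rw [mdifferentiableAt_iff_chart' he.mem_maximalAtlas hp]
  refine he.hol_w.inv.differentiableAt (inter_mem (e.open_target.mem_nhds (e.map_source hp)) ?_)
  have hc : ContinuousAt (fun ζ => wc (e.symm ζ)) (e p) :=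
    continuous_wc.continuousAt.comp (e.continuousAt_symm (e.map_source hp))
  exact hc.eventually_mem (isOpen_ne_zero.mem_nhds (by rwa [e.left_inv hp]))

lemma deriv_ne_zero_of_coord (he : e ∈ IsManifold.maximalAtlas 𝓘(ℂ) ω D.Surface)
    (hz : z ∈ e.target) {E : OpenPartialHomeomorph D.Surface ℂ} (hE : IsCoordChart E)
    (hzE : e.symm z ∈ E.source) {f : D.Surface → ℂ} (hf : ∀ q, E q = f q) :
    deriv (fun ζ => f (e.symm ζ)) z ≠ 0 := by
  have := deriv_chart_chart_ne_zero he hE.mem_maximalAtlas hz hzE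
  simpa only [hf] using this

lemma deriv_x_ne_zero (he : e ∈ IsManifold.maximalAtlas 𝓘(ℂ) ω D.Surface) (hz : z ∈ e.target)
    (hx : xc (e.symm z) ≠ OnePoint.infty) (hw : wc (e.symm z) ≠ OnePoint.infty)
    (hw0 : wc (e.symm z) ≠ ((0 : ℂ) : OnePoint ℂ)) :
    deriv (fun ζ => affine (xc (e.symm ζ))) z ≠ 0 := by
  obtain ⟨E, r, -, hp, -, -, hE, hEc⟩ := exists_chart_x hx hw hw0
  exact deriv_ne_zero_of_coord he hz hEc hp hE

lemma deriv_w_ne_zero (he : e ∈ IsManifold.maximalAtlas 𝓘(ℂ) ω D.Surface) (hz : z ∈ e.target)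
    (hw0 : wc (e.symm z) = ((0 : ℂ) : OnePoint ℂ)) :
    deriv (fun ζ => affine (wc (e.symm ζ))) z ≠ 0 := by
  obtain ⟨E, r, -, hp, -, -, hE, hEc⟩ := exists_chart_w hw0
  exact deriv_ne_zero_of_coord he hz hEc hp hE

lemma deriv_wInv_ne_zero (he : e ∈ IsManifold.maximalAtlas 𝓘(ℂ) ω D.Surface) (hz : z ∈ e.target)
    (hw : wc (e.symm z) = OnePoint.infty) :
    deriv (fun ζ => affineInv (wc (e.symm ζ))) z ≠ 0 := by
  obtain ⟨E, r, -, hp, -, -, hE, hEc⟩ := exists_chart_wInv hw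
  exact deriv_ne_zero_of_coord he hz hEc hp hE

lemma deriv_xInv_ne_zero (he : e ∈ IsManifold.maximalAtlas 𝓘(ℂ) ω D.Surface) (hz : z ∈ e.target)
    (hx : xc (e.symm z) = OnePoint.infty) :
    deriv (fun ζ => affineInv (xc (e.symm ζ))) z ≠ 0 := by
  obtain ⟨E, r, -, hp, -, -, hE, hEc⟩ := exists_chart_xInv hx
  exact deriv_ne_zero_of_coord he hz hEc hp hE

/-! ### The hyperelliptic involution -/

lemma affine_map_neg (x : OnePoint ℂ) : affine (x.map (fun a => -a)) = -affine x := by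
  induction x using OnePoint.rec <;> simp [affine]

lemma affineInv_map_neg (x : OnePoint ℂ) : affineInv (x.map (fun a => -a)) = -affineInv x := by
  induction x using OnePoint.rec <;> simp [affineInv, inv_neg]

lemma onCurve_neg {x w : OnePoint ℂ} (h : D.OnCurve (x, w)) :
    D.OnCurve (x, w.map (fun a => -a)) := by
  induction w using OnePoint.rec with
  | infty => exact h
  | coe b => simpa [OnCurve] using h

/-- The hyperelliptic involution `(x, w) ↦ (x, -w)`. -/
def invol (p : D.Surface) : D.Surface := ⟨(xc p, (wc p).map (fun a => -a)), onCurve_neg p.2⟩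

@[simp] lemma xc_invol (p : D.Surface) : xc (invol p) = xc p := rfl

lemma wc_invol (p : D.Surface) : wc (invol p) = (wc p).map (fun a => -a) := rfl

@[simp] lemma affine_wc_invol (p : D.Surface) : affine (wc (invol p)) = -affine (wc p) :=
  affine_map_neg _

@[simp] lemma affineInv_wc_invol (p : D.Surface) : affineInv (wc (invol p)) = -affineInv (wc p) :=
  affineInv_map_neg _

lemma wc_invol_eq_infty {p : D.Surface} : wc (invol p) = OnePoint.infty ↔ wc p = OnePoint.infty := by
  rw [wc_invol]
  induction wc p using OnePoint.rec <;> simp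

lemma wc_invol_eq_zero {p : D.Surface} :
    wc (invol p) = ((0 : ℂ) : OnePoint ℂ) ↔ wc p = ((0 : ℂ) : OnePoint ℂ) := by
  rw [wc_invol]
  induction wc p using OnePoint.rec <;> simp

lemma involutive_invol : Function.Involutive (invol (D := D)) := fun p => by
  refine ext_xw rfl ?_
  rw [wc_invol, wc_invol]
  induction wc p using OnePoint.rec <;> simp

lemma continuous_map_neg : Continuous (OnePoint.map (fun a : ℂ => -a)) :=
  OnePoint.continuous_map continuous_neg (by
    rw [coclosedCompact_eq_cocompact]
    exact (Homeomorph.neg ℂ).isClosedEmbedding.tendsto_cocompact)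

lemma continuous_invol : Continuous (invol (D := D)) :=
  isInducing_xw.continuous_iff.2
    (continuous_xc.prodMk (continuous_map_neg.comp continuous_wc))

lemma mdifferentiable_invol : MDifferentiable 𝓘(ℂ) 𝓘(ℂ) (invol (D := D)) := by
  intro p
  rw [mdifferentiableAt_iff_target]
  refine ⟨continuous_invol.continuousAt, ?_⟩
  set E := chartAt ℂ (invol p) with hE
  have hEc := (isSmallChart_of_mem_atlas (chart_mem_atlas ℂ (invol p))).isCoordChart
  have hp : invol p ∈ E.source := mem_chart_source ℂ (invol p)
  have hev : ∀ᶠ q in 𝓝 p, invol q ∈ E.source :=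
    continuous_invol.continuousAt.eventually_mem (E.open_source.mem_nhds hp)
  have key : ∀ f : D.Surface → ℂ, MDifferentiableAt 𝓘(ℂ) 𝓘(ℂ) f p →
      (∀ q, invol q ∈ E.source → E (invol q) = f q) →
      MDifferentiableAt 𝓘(ℂ) 𝓘(ℂ) (extChartAt 𝓘(ℂ) (invol p) ∘ invol) p := by
    intro f hf h
    refine hf.congr_of_eventuallyEq ?_
    filter_upwards [hev] with q hq
    have : extChartAt 𝓘(ℂ) (invol p) (invol q) = E (invol q) := by simp [hE]
    rw [Function.comp_apply, this, h q hq]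
  rcases hEc.coord with (h | h) | (h | h)
  · exact key _ (mdifferentiableAt_x (h _ hp).1) fun q hq => (h _ hq).2
  · exact key _ (mdifferentiableAt_xInv (h _ hp).1) fun q hq => (h _ hq).2
  · refine key _ (mdifferentiableAt_w (p := p) ?_).neg fun q hq => ((h _ hq).2).trans (by simp)
    exact fun h' => (h _ hp).1 (wc_invol_eq_infty.2 h')
  · refine key _ (mdifferentiableAt_wInv (p := p) ?_).neg fun q hq => ((h _ hq).2).trans (by simp)
    exact fun h' => (h _ hp).1 (wc_invol_eq_zero.2 h')

/-! ### Fibres of the double cover, connectedness -/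

lemma analyticAt_chart {f : D.Surface → ℂ} (he : e ∈ IsManifold.maximalAtlas 𝓘(ℂ) ω D.Surface)
    (hz : z ∈ e.target) (hf : ∀ᶠ q in 𝓝 (e.symm z), MDifferentiableAt 𝓘(ℂ) 𝓘(ℂ) f q) :
    AnalyticAt ℂ (fun ζ => f (e.symm ζ)) z := by
  rw [Complex.analyticAt_iff_eventually_differentiableAt]
  filter_upwards [(e.continuousAt_symm hz).eventually hf, e.open_target.mem_nhds hz] with ζ h1 h2
  exact (mdifferentiableAt_iff_chart he h2).1 h1

lemma eventually_x_ne_infty (hx : xc p ≠ OnePoint.infty) : ∀ᶠ q in 𝓝 p, xc q ≠ OnePoint.infty :=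
  continuous_xc.continuousAt.eventually_mem (isOpen_ne_infty.mem_nhds hx)

lemma eventually_x_ne_zero (hx : xc p ≠ ((0 : ℂ) : OnePoint ℂ)) :
    ∀ᶠ q in 𝓝 p, xc q ≠ ((0 : ℂ) : OnePoint ℂ) :=
  continuous_xc.continuousAt.eventually_mem (isOpen_ne_zero.mem_nhds hx)

lemma eventually_w_ne_infty (hx : wc p ≠ OnePoint.infty) : ∀ᶠ q in 𝓝 p, wc q ≠ OnePoint.infty :=
  continuous_wc.continuousAt.eventually_mem (isOpen_ne_infty.mem_nhds hx)

lemma eventually_w_ne_zero (hx : wc p ≠ ((0 : ℂ) : OnePoint ℂ)) :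
    ∀ᶠ q in 𝓝 p, wc q ≠ ((0 : ℂ) : OnePoint ℂ) :=
  continuous_wc.continuousAt.eventually_mem (isOpen_ne_zero.mem_nhds hx)

lemma analyticAt_x (he : e ∈ IsManifold.maximalAtlas 𝓘(ℂ) ω D.Surface) (hz : z ∈ e.target)
    (hx : xc (e.symm z) ≠ OnePoint.infty) : AnalyticAt ℂ (fun ζ => affine (xc (e.symm ζ))) z :=
  analyticAt_chart he hz ((eventually_x_ne_infty hx).mono fun _ => mdifferentiableAt_x)

lemma analyticAt_xInv (he : e ∈ IsManifold.maximalAtlas 𝓘(ℂ) ω D.Surface) (hz : z ∈ e.target)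
    (hx : xc (e.symm z) ≠ ((0 : ℂ) : OnePoint ℂ)) :
    AnalyticAt ℂ (fun ζ => affineInv (xc (e.symm ζ))) z :=
  analyticAt_chart he hz ((eventually_x_ne_zero hx).mono fun _ => mdifferentiableAt_xInv)

lemma analyticAt_w (he : e ∈ IsManifold.maximalAtlas 𝓘(ℂ) ω D.Surface) (hz : z ∈ e.target)
    (hx : wc (e.symm z) ≠ OnePoint.infty) : AnalyticAt ℂ (fun ζ => affine (wc (e.symm ζ))) z :=
  analyticAt_chart he hz ((eventually_w_ne_infty hx).mono fun _ => mdifferentiableAt_w)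

lemma analyticAt_wInv (he : e ∈ IsManifold.maximalAtlas 𝓘(ℂ) ω D.Surface) (hz : z ∈ e.target)
    (hx : wc (e.symm z) ≠ ((0 : ℂ) : OnePoint ℂ)) :
    AnalyticAt ℂ (fun ζ => affineInv (wc (e.symm ζ))) z :=
  analyticAt_chart he hz ((eventually_w_ne_zero hx).mono fun _ => mdifferentiableAt_wInv)

lemma xc_ne_infty_of_wc (hw : wc p = ((0 : ℂ) : OnePoint ℂ) ∨ wc p = OnePoint.infty) :
    xc p ≠ OnePoint.infty := fun h =>
  hw.elim (wc_ne_zero_of_infty h) (wc_ne_infty h)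

/-- The fibres of `x` are the orbits of the involution. -/
lemma eq_or_eq_invol {p q : D.Surface} (h : xc p = xc q) : q = p ∨ q = invol p := by
  suffices h' : wc q = wc p ∨ wc q = (wc p).map (fun a => -a) from
    h'.imp (fun h' => ext_xw h.symm h') (fun h' => ext_xw h.symm h')
  have aux : ∀ a b : ℂ, a ^ 2 = b ^ 2 → (a : OnePoint ℂ) = (b : OnePoint ℂ) ∨
      (a : OnePoint ℂ) = (b : OnePoint ℂ).map (fun a => -a) := fun a b hab => by
    rcases sq_eq_sq_iff_eq_or_eq_neg.1 hab with h | h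
    · exact Or.inl (by rw [h])
    · exact Or.inr (by rw [h]; rfl)
  by_cases hx : xc p = OnePoint.infty
  · rw [← coe_affine (wc_ne_infty hx), ← coe_affine (wc_ne_infty (h ▸ hx))]
    exact aux _ _ ((wc_sq_of_infty (h ▸ hx)).trans (wc_sq_of_infty hx).symm)
  have hx' : xc q ≠ OnePoint.infty := h ▸ hx
  by_cases hw : wc p = OnePoint.infty
  · left
    rw [hw, ← den_eq_zero_iff hx', ← h, den_eq_zero_iff hx, hw]
  · have hw' : wc q ≠ OnePoint.infty := by
      rwa [Ne, ← den_eq_zero_iff hx', ← h, den_eq_zero_iff hx]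
    rw [← coe_affine hw, ← coe_affine hw']
    refine aux _ _ (mul_left_cancel₀ (den_ne_zero_of_wc hx hw) ?_)
    rw [den_mul_sq hx hw, h, den_mul_sq hx' hw']

lemma invol_eq_self (hw : wc p = ((0 : ℂ) : OnePoint ℂ) ∨ wc p = OnePoint.infty) : invol p = p := by
  refine ext_xw rfl ?_
  rw [wc_invol]
  rcases hw with h | h <;> simp [h]

/-- The product of all linear factors is the product of numerator and denominator. -/
lemma prod_eq (a : ℂ) : ∏ j, (a - D.lam j) = D.den a * D.num a :=
  (Finset.prod_mul_prod_compl D.I _).symm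

/-- A point over a branch value is a branch point. -/
lemma wc_of_xc_eq_lam {k : Fin (2 * g + 2)} (h : xc p = (D.lam k : OnePoint ℂ)) :
    wc p = ((0 : ℂ) : OnePoint ℂ) ∨ wc p = OnePoint.infty := by
  have hx : xc p ≠ OnePoint.infty := by rw [h]; exact OnePoint.coe_ne_infty _
  have ha : affine (xc p) = D.lam k := by rw [h]; rfl
  by_cases hk : k ∈ D.I
  · exact Or.inr ((den_eq_zero_iff hx).1 (rootProd_eq_zero.2 ⟨k, hk, ha⟩))
  · exact Or.inl ((num_eq_zero_iff hx).1 (rootProd_eq_zero.2 ⟨k, Finset.mem_compl.2 hk, ha⟩))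

lemma exists_lam_of_wc (h : wc p = ((0 : ℂ) : OnePoint ℂ) ∨ wc p = OnePoint.infty) :
    ∃ k, xc p = (D.lam k : OnePoint ℂ) := by
  have hx := xc_ne_infty_of_wc h
  rcases h with h | h
  · obtain ⟨k, -, hk⟩ := rootProd_eq_zero.1 ((num_eq_zero_iff hx).2 h)
    exact ⟨k, by rw [← hk, coe_affine hx]⟩
  · obtain ⟨k, -, hk⟩ := rootProd_eq_zero.1 ((den_eq_zero_iff hx).2 h)
    exact ⟨k, by rw [← hk, coe_affine hx]⟩

lemma eq_of_xc_eq_lam {p q : D.Surface} {k : Fin (2 * g + 2)} (hp : xc p = (D.lam k : OnePoint ℂ))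
    (hq : xc q = (D.lam k : OnePoint ℂ)) : p = q := by
  rcases eq_or_eq_invol (hp.trans hq.symm) with h | h
  · exact h.symm
  · rw [h, invol_eq_self (wc_of_xc_eq_lam hp)]

lemma exists_xc_eq (D : BranchData g) (x : OnePoint ℂ) : ∃ p : D.Surface, xc p = x := by
  suffices h : ∃ w, D.OnCurve (x, w) by
    obtain ⟨w, hw⟩ := h
    exact ⟨D.ofCoords x w, xc_ofCoords hw⟩
  induction x using OnePoint.rec with
  | infty => exact ⟨_, onCurve_one⟩
  | coe a =>
    by_cases ha : D.den a = 0
    · exact ⟨_, (D.onCurve_coe_infty a).2 ha⟩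
    · obtain ⟨b, hb⟩ := IsAlgClosed.exists_pow_nat_eq (D.num a / D.den a) two_pos
      refine ⟨(b : OnePoint ℂ), (D.onCurve_coe_coe a b).2 ?_⟩
      rw [hb]; field_simp

lemma isClosedMap_xc : IsClosedMap (xc (D := D)) := continuous_xc.isClosedMap

/-- The open mapping theorem for the coordinate `x`. -/
lemma nhds_le_map_xc (X : SphereCoord)
    (hz : z ∈ e.target) (hx : xc (e.symm z) ∈ X.dom)
    (ha : AnalyticAt ℂ (fun ζ => X.c (xc (e.symm ζ))) z)
    (hnc : ¬ ∀ᶠ ζ in 𝓝 z, X.c (xc (e.symm ζ)) = X.c (xc (e.symm z))) :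
    𝓝 (xc (e.symm z)) ≤ map xc (𝓝 (e.symm z)) := by
  have h1 := ha.eventually_constant_or_nhds_le_map_nhds.resolve_left hnc
  have hc : ContinuousAt (fun ζ => xc (e.symm ζ)) z :=
    continuous_xc.continuousAt.comp (e.continuousAt_symm hz)
  calc 𝓝 (xc (e.symm z)) = map X.κ (map X.c (𝓝 (xc (e.symm z)))) := by
        rw [map_map]
        conv_lhs => rw [← map_id (f := 𝓝 (xc (e.symm z)))]
        refine Filter.map_congr ?_
        filter_upwards [X.isOpen_dom.mem_nhds hx] with x hx
        exact (X.κ_c x hx).symm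
    _ ≤ map X.κ (𝓝 (X.c (xc (e.symm z)))) := map_mono (X.continuousAt _ hx)
    _ ≤ map X.κ (map (fun ζ => X.c (xc (e.symm ζ))) (𝓝 z)) := map_mono h1
    _ = map (fun ζ => xc (e.symm ζ)) (𝓝 z) := by
        rw [map_map]
        refine Filter.map_congr ?_
        filter_upwards [hc.eventually_mem (X.isOpen_dom.mem_nhds hx)] with ζ hζ
        exact X.κ_c _ hζ
    _ = map xc (map e.symm (𝓝 z)) := by rw [map_map]; rfl
    _ = map xc (𝓝 (e.symm z)) := by rw [e.symm.map_nhds_eq hz]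

lemma isOpenMap_xc : IsOpenMap (xc (D := D)) := by
  refine IsOpenMap.of_nhds_le fun p => ?_
  obtain ⟨e, r, -, hp, -, hec⟩ := exists_coordChart p
  have he := hec.mem_maximalAtlas
  obtain ⟨z, hz, rfl⟩ : ∃ z ∈ e.target, e.symm z = p := ⟨e p, e.map_source hp, e.left_inv hp⟩
  by_cases hx : xc (e.symm z) = OnePoint.infty
  · have hx0 : xc (e.symm z) ≠ ((0 : ℂ) : OnePoint ℂ) := by rw [hx]; exact OnePoint.infty_ne_coe 0
    refine nhds_le_map_xc .recip hz hx0 (analyticAt_xInv he hz hx0) fun h => ?_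
    refine deriv_xInv_ne_zero he hz hx ?_
    exact (EventuallyEq.deriv_eq (f := fun _ => _) h).trans (deriv_const _ _)
  refine nhds_le_map_xc .std hz hx (analyticAt_x he hz hx) fun h => ?_
  have hcont := e.continuousAt_symm hz
  have hne := hcont.eventually (eventually_x_ne_infty hx)
  change ∀ᶠ ζ in 𝓝 z, affine (xc (e.symm ζ)) = affine (xc (e.symm z)) at h
  by_cases hw : wc (e.symm z) = OnePoint.infty
  · refine deriv_wInv_ne_zero he hz hw ?_
    have : (fun ζ => affineInv (wc (e.symm ζ))) =ᶠ[𝓝 z] fun _ => 0 := by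
      filter_upwards [h, hne] with ζ h1 h2
      rw [(den_eq_zero_iff h2).1 (by rw [h1, (den_eq_zero_iff hx).2 hw])]; rfl
    exact this.deriv_eq.trans (deriv_const _ _)
  by_cases hw0 : wc (e.symm z) = ((0 : ℂ) : OnePoint ℂ)
  · refine deriv_w_ne_zero he hz hw0 ?_
    have : (fun ζ => affine (wc (e.symm ζ))) =ᶠ[𝓝 z] fun _ => 0 := by
      filter_upwards [h, hne] with ζ h1 h2
      rw [(num_eq_zero_iff h2).1 (by rw [h1, (num_eq_zero_iff hx).2 hw0])]; rfl
    exact this.deriv_eq.trans (deriv_const _ _)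
  refine deriv_x_ne_zero he hz hx hw hw0 ?_
  exact (EventuallyEq.deriv_eq (f := fun _ => _) h).trans (deriv_const _ _)

/-- The surface is connected: a non-trivial clopen set and its complement would both map onto the
sphere, but there is only one point over a branch value. -/
lemma isClosedRiemannSurface : IsClosedRiemannSurface D.Surface where
  isManifold := inferInstance
  t2 := inferInstance
  compact := inferInstance
  connected := by
    have hpre : PreconnectedSpace D.Surface := by
      rw [preconnectedSpace_iff_clopen]
      intro s hs
      by_contra! hcon
      have key : ∀ t : Set D.Surface, IsClopen t → t.Nonempty → xc '' t = univ := fun t ht hne =>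
        IsClopen.eq_univ ⟨isClosedMap_xc t ht.1, isOpenMap_xc t ht.2⟩ (hne.image _)
      obtain ⟨p, hp, hp'⟩ : ((D.lam 0 : ℂ) : OnePoint ℂ) ∈ xc '' s := by
        rw [key s hs hcon.1]; trivial
      obtain ⟨q, hq, hq'⟩ : ((D.lam 0 : ℂ) : OnePoint ℂ) ∈ xc '' sᶜ := by
        rw [key sᶜ hs.compl (nonempty_compl.2 hcon.2)]; trivial
      exact hq (eq_of_xc_eq_lam hp' hq' ▸ hp)
    exact { toPreconnectedSpace := hpre, toNonempty := ⟨(exists_xc_eq D (0 : ℂ)).choose⟩ }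

/-! ### The function `y` -/

open Classical in
/-- The function `y = w * den x` at the points with finite `x`; it vanishes at the branch points. -/
def yFin (p : D.Surface) : ℂ := if wc p = OnePoint.infty then 0 else affine (wc p) * D.den (affine (xc p))

open Classical in
/-- The meromorphic function `y` with `y² = ∏ j, (x - lam j)`. -/
def yc (p : D.Surface) : OnePoint ℂ := if xc p = OnePoint.infty then OnePoint.infty else yFin p

lemma yFin_eq_w (hw : wc p ≠ OnePoint.infty) : yFin p = affine (wc p) * D.den (affine (xc p)) := by
  simp [yFin, hw]

lemma yFin_eq_wInv (hx : xc p ≠ OnePoint.infty) (hw : wc p ≠ ((0 : ℂ) : OnePoint ℂ)) :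
    yFin p = affineInv (wc p) * D.num (affine (xc p)) := by
  by_cases hw' : wc p = OnePoint.infty
  · simp [yFin, hw']
  · rw [yFin_eq_w hw', den_eq hx hw, affineInv_eq hw']
    have := affine_ne_zero hw' hw
    field_simp

lemma yFin_sq (hx : xc p ≠ OnePoint.infty) :
    yFin p ^ 2 = D.den (affine (xc p)) * D.num (affine (xc p)) := by
  by_cases hw : wc p = OnePoint.infty
  · rw [(den_eq_zero_iff hx).2 hw, zero_mul]; simp [yFin, hw]
  · rw [yFin_eq_w hw, ← den_mul_sq hx hw]; ring

lemma yFin_eq_zero_iff (hx : xc p ≠ OnePoint.infty) :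
    yFin p = 0 ↔ wc p = ((0 : ℂ) : OnePoint ℂ) ∨ wc p = OnePoint.infty := by
  rw [← sq_eq_zero_iff, yFin_sq hx, mul_eq_zero, num_eq_zero_iff hx, den_eq_zero_iff hx, or_comm]

@[simp] lemma yFin_invol : yFin (invol p) = -yFin p := by
  by_cases hw : wc p = OnePoint.infty
  · simp [yFin, wc_invol_eq_infty, hw]
  · simp [yFin, wc_invol_eq_infty, hw]

lemma mdifferentiableAt_yFin (hx : xc p ≠ OnePoint.infty) :
    MDifferentiableAt 𝓘(ℂ) 𝓘(ℂ) (yFin (D := D)) p := by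
  have hA : MDifferentiableAt 𝓘(ℂ) 𝓘(ℂ) (fun q => D.num (affine (xc q))) p :=
    (differentiable_rootProd _).mdifferentiableAt.comp p (mdifferentiableAt_x hx)
  have hB : MDifferentiableAt 𝓘(ℂ) 𝓘(ℂ) (fun q => D.den (affine (xc q))) p :=
    (differentiable_rootProd _).mdifferentiableAt.comp p (mdifferentiableAt_x hx)
  by_cases hw : wc p = OnePoint.infty
  · have hw0 : wc p ≠ ((0 : ℂ) : OnePoint ℂ) := by rw [hw]; exact OnePoint.infty_ne_coe 0
    refine ((mdifferentiableAt_wInv hw0).mul hA).congr_of_eventuallyEq ?_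
    filter_upwards [eventually_x_ne_infty hx, eventually_w_ne_zero hw0] with q h1 h2
    exact yFin_eq_wInv h1 h2
  · refine ((mdifferentiableAt_w hw).mul hB).congr_of_eventuallyEq ?_
    filter_upwards [eventually_w_ne_infty hw] with q h1
    exact yFin_eq_w h1

lemma affineInv_x_ne_zero (hx : xc p ≠ OnePoint.infty) (hx0 : xc p ≠ ((0 : ℂ) : OnePoint ℂ)) :
    affineInv (xc p) ≠ 0 := affineInv_ne_zero hx hx0

/-- Near `x = ∞`, the function `y` is `u ^ (-(g+1))` times a non-vanishing holomorphic function of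
`u = 1 / x` and `w`. -/
lemma yFin_mul_pow (hx : xc p ≠ OnePoint.infty) (hx0 : xc p ≠ ((0 : ℂ) : OnePoint ℂ))
    (hw : wc p ≠ OnePoint.infty) :
    yFin p * affineInv (xc p) ^ (g + 1) = affine (wc p) * D.denRev (affineInv (xc p)) := by
  have hu := affineInv_x_ne_zero hx hx0
  rw [yFin_eq_w hw, denRev_eq hu, affineInv_eq hx, inv_inv]
  ring

lemma denRev_ne_zero (hx : xc p ≠ ((0 : ℂ) : OnePoint ℂ)) (hw : wc p ≠ OnePoint.infty) :
    D.denRev (affineInv (xc p)) ≠ 0 := by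
  by_cases h : xc p = OnePoint.infty
  · simp [h]
  · have hu := affineInv_x_ne_zero h hx
    rw [denRev_eq hu]
    refine mul_ne_zero (pow_ne_zero _ hu) ?_
    rw [affineInv_eq h, inv_inv]
    exact den_ne_zero_of_wc h hw

lemma affineInv_yc (hx0 : xc p ≠ ((0 : ℂ) : OnePoint ℂ)) (hw : wc p ≠ OnePoint.infty)
    (hw0 : wc p ≠ ((0 : ℂ) : OnePoint ℂ)) :
    yc p = ofInv (affineInv (xc p) ^ (g + 1) / (affine (wc p) * D.denRev (affineInv (xc p)))) := by
  by_cases hx : xc p = OnePoint.infty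
  · simp [yc, hx]
  · have hu := affineInv_x_ne_zero hx hx0
    have h1 := affine_ne_zero hw hw0
    have h2 := denRev_ne_zero hx0 hw
    rw [ofInv_of_ne (by positivity)]
    simp only [yc, hx, if_false, inv_div]
    rw [← yFin_mul_pow hx hx0 hw]
    field_simp

/-- `1 / y` is holomorphic near the points at infinity. -/
lemma isHolomorphicToSphere_yc : IsHolomorphicToSphere (yc (D := D)) := by
  have hfin : ∀ p : D.Surface, xc p ≠ OnePoint.infty → yc =ᶠ[𝓝 p] fun q => (yFin q : OnePoint ℂ) := by
    intro p hx
    filter_upwards [eventually_x_ne_infty hx] with q hq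
    simp [yc, hq]
  have hinf : ∀ p : D.Surface, xc p = OnePoint.infty →
      yc =ᶠ[𝓝 p] (fun q => ofInv (affineInv (xc q) ^ (g + 1) /
          (affine (wc q) * D.denRev (affineInv (xc q))))) ∧
      MDifferentiableAt 𝓘(ℂ) 𝓘(ℂ) (fun q => affineInv (xc q) ^ (g + 1) /
          (affine (wc q) * D.denRev (affineInv (xc q)))) p := by
    intro p hx
    have hx0 : xc p ≠ ((0 : ℂ) : OnePoint ℂ) := by rw [hx]; exact OnePoint.infty_ne_coe 0
    have hw := wc_ne_infty hx
    have hw0 := wc_ne_zero_of_infty hx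
    constructor
    · filter_upwards [eventually_x_ne_zero hx0, eventually_w_ne_infty hw, eventually_w_ne_zero hw0]
        with q h1 h2 h3
      exact affineInv_yc h1 h2 h3
    · obtain ⟨e, r, -, hp, -, hec⟩ := exists_coordChart p
      have he := hec.mem_maximalAtlas
      have h1 := (mdifferentiableAt_iff_chart' he hp).1 (mdifferentiableAt_xInv hx0)
      have h2 := (mdifferentiableAt_iff_chart' he hp).1 (mdifferentiableAt_w hw)
      rw [mdifferentiableAt_iff_chart' he hp]
      refine (h1.pow _).div (h2.mul ((differentiable_rootProdRev _).comp _ h1)) ?_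
      simp only [e.left_inv hp]
      exact mul_ne_zero (affine_ne_zero hw hw0) (denRev_ne_zero hx0 hw)
  refine ⟨continuous_iff_continuousAt.2 fun p => ?_, fun p hp => ?_, fun p hp => ?_⟩
  · by_cases hx : xc p = OnePoint.infty
    · obtain ⟨h1, h2⟩ := hinf p hx
      exact (continuous_ofInv.continuousAt.comp h2.continuousAt).congr h1.symm
    · exact (OnePoint.continuous_coe.continuousAt.comp
        (mdifferentiableAt_yFin hx).continuousAt).congr (hfin p hx).symm
  · have hx : xc p ≠ OnePoint.infty := fun h => hp (by simp [yc, h])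
    refine (mdifferentiableAt_yFin hx).congr_of_eventuallyEq ?_
    filter_upwards [hfin p hx] with q hq
    rw [hq]; rfl
  · have hx : xc p = OnePoint.infty := by
      by_contra h
      simp [yc, h] at hp
    refine (hinf p hx).2.congr_of_eventuallyEq ?_
    filter_upwards [(hinf p hx).1] with q hq
    rw [hq, affineInv_ofInv]

lemma isHolomorphicToSphere_xc : IsHolomorphicToSphere (xc (D := D)) :=
  ⟨continuous_xc, fun _ hp => mdifferentiableAt_x hp, fun p hp =>
    mdifferentiableAt_xInv (by rw [hp]; exact OnePoint.infty_ne_coe 0)⟩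

lemma affine_yc (hx : xc p ≠ OnePoint.infty) : affine (yc p) = yFin p := by
  simp [yc, hx]

lemma ncard_fibre_infty : (xc (D := D) ⁻¹' {OnePoint.infty}).ncard = 2 := by
  have h1 : D.OnCurve (OnePoint.infty, ((-1 : ℂ) : OnePoint ℂ)) :=
    (D.onCurve_infty_coe _).2 (by norm_num)
  rw [ncard_eq_two]
  refine ⟨D.ofCoords OnePoint.infty ((1 : ℂ) : OnePoint ℂ),
    D.ofCoords OnePoint.infty ((-1 : ℂ) : OnePoint ℂ), ?_, ?_⟩
  · intro h
    have := congrArg wc h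
    rw [wc_ofCoords onCurve_one, wc_ofCoords h1, OnePoint.coe_eq_coe] at this
    norm_num at this
  · ext p
    simp only [mem_preimage, mem_singleton_iff, mem_insert_iff]
    constructor
    · intro hp
      rcases sq_eq_one_iff.1 (wc_sq_of_infty hp) with h | h
      · left
        refine ext_xw (by rw [hp, xc_ofCoords onCurve_one]) ?_
        rw [wc_ofCoords onCurve_one, ← h, coe_affine (wc_ne_infty hp)]
      · right
        refine ext_xw (by rw [hp, xc_ofCoords h1]) ?_
        rw [wc_ofCoords h1, ← h, coe_affine (wc_ne_infty hp)]
    · rintro (rfl | rfl)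
      · exact xc_ofCoords onCurve_one
      · exact xc_ofCoords h1

lemma isHyperellipticCurve : IsHyperellipticCurve g D.lam (xc (D := D)) yc where
  distinct := D.inj
  holomorphic_x := isHolomorphicToSphere_xc
  holomorphic_y := isHolomorphicToSphere_yc
  infinite_iff p := by by_cases h : xc p = OnePoint.infty <;> simp [yc, h]
  bijOn := by
    refine ⟨fun p hp => ?_, fun p hp q hq hpq => ?_, fun c hc => ?_⟩
    · change affine (yc p) ^ 2 = ∏ j, (affine (xc p) - D.lam j)
      rw [affine_yc hp, yFin_sq hp, prod_eq]
    · simp only [Prod.mk.injEq, affine_yc hp, affine_yc hq] at hpq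
      have hx : xc p = xc q := by rw [← coe_affine hp, ← coe_affine hq, hpq.1]
      rcases eq_or_eq_invol hx with h | h
      · exact h.symm
      · have h2 := hpq.2
        rw [h, yFin_invol, eq_neg_iff_add_eq_zero, ← two_mul, mul_eq_zero] at h2
        rw [h, invol_eq_self ((yFin_eq_zero_iff hp).1 (h2.resolve_left two_ne_zero))]
    · obtain ⟨a, b⟩ := c
      change b ^ 2 = ∏ j, (a - D.lam j) at hc
      obtain ⟨p, hp⟩ := exists_xc_eq D a
      have hx : xc p ≠ OnePoint.infty := by rw [hp]; exact OnePoint.coe_ne_infty a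
      have ha : affine (xc p) = a := by rw [hp]; rfl
      have h2 : b ^ 2 = yFin p ^ 2 := by rw [yFin_sq hx, hc, prod_eq, ha]
      rcases sq_eq_sq_iff_eq_or_eq_neg.1 h2 with h | h
      · exact ⟨p, hx, by simp [affine_yc hx, ha, h]⟩
      · exact ⟨invol p, hx, by simp [affine_yc (p := invol p) hx, ha, h]⟩
  two_infinite := ncard_fibre_infty

lemma encard_pair_le {α : Type*} (a b : α) : ({a, b} : Set α).encard ≤ 2 := by
  refine (encard_insert_le _ _).trans ?_
  rw [encard_singleton]; rfl

lemma encard_fibre_le (c : OnePoint ℂ) : (xc (D := D) ⁻¹' {c}).encard ≤ 2 := by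
  obtain ⟨p, hp⟩ := exists_xc_eq D c
  have : xc ⁻¹' {c} ⊆ {p, invol p} := fun q hq => eq_or_eq_invol (hp.trans (Eq.symm hq))
  exact (encard_le_encard this).trans (encard_pair_le p (invol p))

lemma isHyperelliptic (h : 2 ≤ genus D.Surface) : IsHyperelliptic D.Surface :=
  ⟨h, xc, isHolomorphicToSphere_xc, encard_fibre_le, OnePoint.infty, by
    rw [← (finite_of_ncard_ne_zero (by rw [ncard_fibre_infty]; norm_num)).cast_ncard_eq,
      ncard_fibre_infty]; rfl⟩

end BranchData

/-! ### Entire functions of polynomial growth -/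

open Asymptotics in
/-- An entire function of growth at most `|z| ^ n` is a polynomial of degree at most `n`. -/
lemma exists_polynomial_of_isBigO (n : ℕ) : ∀ {f : ℂ → ℂ}, Differentiable ℂ f →
    f =O[Bornology.cobounded ℂ] (fun z => z ^ n) →
    ∃ P ∈ Polynomial.degreeLT ℂ (n + 1), ∀ z, f z = P.eval z := by
  induction n with
  | zero =>
    intro f hf hO
    have hb : Bornology.IsBounded (range f) := by
      simp only [pow_zero] at hO
      obtain ⟨C, hC⟩ := hO.bound
      obtain ⟨R, -, hR⟩ := (Metric.hasBasis_cobounded_compl_closedBall (0 : ℂ)).eventually_iff.1 hC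
      have hK := ((isCompact_closedBall (0 : ℂ) R).image hf.continuous).isBounded
      refine (hK.union (Metric.isBounded_closedBall (x := (0 : ℂ)) (r := C))).subset ?_
      rintro _ ⟨z, rfl⟩
      by_cases hz : z ∈ Metric.closedBall (0 : ℂ) R
      · exact Or.inl ⟨z, hz, rfl⟩
      · right
        simpa using hR hz
    refine ⟨Polynomial.C (f 0), ?_, fun z => ?_⟩
    · rw [Polynomial.mem_degreeLT]
      exact lt_of_le_of_lt Polynomial.degree_C_le (by norm_num)
    · rw [Polynomial.eval_C]
      exact hf.apply_eq_apply_of_bounded hb z 0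
  | succ n ih =>
    intro f hf hO
    have hd : Differentiable ℂ (dslope f 0) := by
      rw [← differentiableOn_univ]
      exact (Complex.differentiableOn_dslope univ_mem).2 hf.differentiableOn
    have hne : ∀ᶠ z in Bornology.cobounded ℂ, z ≠ 0 := Bornology.eventually_ne_cobounded 0
    have hO' : dslope f 0 =O[Bornology.cobounded ℂ] (fun z => z ^ n) := by
      have h1 : (fun _ : ℂ => f 0) =O[Bornology.cobounded ℂ] (fun z : ℂ => z ^ (n + 1)) := by
        refine IsBigO.of_bound ‖f 0‖ ?_
        have : ∀ᶠ z in Bornology.cobounded ℂ, 1 ≤ ‖z‖ :=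
          tendsto_norm_cobounded_atTop.eventually_ge_atTop 1
        filter_upwards [this] with z hz
        rw [norm_pow]
        exact le_mul_of_one_le_right (norm_nonneg _) (one_le_pow₀ hz)
      have h2 := (hO.sub h1).mul (isBigO_refl (fun z : ℂ => z⁻¹) _)
      refine h2.congr' ?_ ?_
      · filter_upwards [hne] with z hz
        rw [dslope_of_ne _ hz, slope_def_field, sub_zero, div_eq_mul_inv]
      · filter_upwards [hne] with z hz
        rw [pow_succ, mul_assoc, mul_inv_cancel₀ hz, mul_one]
    obtain ⟨P, hP, hPe⟩ := ih hd hO'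
    refine ⟨Polynomial.C (f 0) + Polynomial.X * P, ?_, fun z => ?_⟩
    · rw [Polynomial.mem_degreeLT] at hP ⊢
      refine lt_of_le_of_lt (Polynomial.degree_add_le _ _) (max_lt ?_ ?_)
      · exact lt_of_le_of_lt Polynomial.degree_C_le (by exact_mod_cast Nat.succ_pos _)
      · by_cases h0 : P = 0
        · simp [h0]
        rw [Polynomial.degree_mul, Polynomial.degree_X, Polynomial.degree_eq_natDegree h0] at *
        norm_cast at *
        omega
    · have := sub_smul_dslope f 0 z
      simp only [sub_zero, smul_eq_mul] at this
      simp only [Polynomial.eval_add, Polynomial.eval_C, Polynomial.eval_mul, Polynomial.eval_X,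
        ← hPe, this]
      ring

namespace BranchData

variable {g : ℕ} {D : BranchData g} {e : OpenPartialHomeomorph D.Surface ℂ} {p : D.Surface} {z : ℂ}

/-! ### Functions on the surface which are invariant under the involution -/

/-- A generic point: over a finite value which is not a branch value. -/
structure IsGeneric (p : D.Surface) : Prop where
  x_ne : xc p ≠ OnePoint.infty
  w_ne : wc p ≠ OnePoint.infty
  w_ne_zero : wc p ≠ ((0 : ℂ) : OnePoint ℂ)

lemma IsGeneric.yFin_ne_zero (h : IsGeneric p) : yFin p ≠ 0 := by
  rw [Ne, yFin_eq_zero_iff h.x_ne, not_or]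
  exact ⟨h.w_ne_zero, h.w_ne⟩

lemma IsGeneric.invol (h : IsGeneric p) : IsGeneric (invol p) :=
  ⟨h.x_ne, fun h' => h.w_ne (wc_invol_eq_infty.1 h'), fun h' => h.w_ne_zero (wc_invol_eq_zero.1 h')⟩

lemma isGeneric_iff : IsGeneric p ↔ xc p ≠ OnePoint.infty ∧ ∀ k, xc p ≠ (D.lam k : OnePoint ℂ) := by
  constructor
  · exact fun h => ⟨h.x_ne, fun k hk => (wc_of_xc_eq_lam hk).elim h.w_ne_zero h.w_ne⟩
  · rintro ⟨h1, h2⟩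
    refine ⟨h1, fun h => ?_, fun h => ?_⟩
    · obtain ⟨k, hk⟩ := exists_lam_of_wc (Or.inr h)
      exact h2 k hk
    · obtain ⟨k, hk⟩ := exists_lam_of_wc (Or.inl h)
      exact h2 k hk

lemma isGeneric_of_coe {a : ℂ} (hp : xc p = (a : OnePoint ℂ)) (ha : ∀ k, a ≠ D.lam k) :
    IsGeneric p :=
  isGeneric_iff.2 ⟨by rw [hp]; exact OnePoint.coe_ne_infty a, fun k hk =>
    ha k (OnePoint.coe_injective (hp.symm.trans hk))⟩

lemma finite_fibre (c : OnePoint ℂ) : (xc (D := D) ⁻¹' {c}).Finite :=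
  finite_of_encard_le_coe (k := 2) (encard_fibre_le c)

variable (D) in
lemma finite_not_isGeneric : {p : D.Surface | ¬ IsGeneric p}.Finite := by
  refine ((finite_fibre OnePoint.infty).union
    (finite_iUnion fun k => finite_fibre (D.lam k : OnePoint ℂ))).subset fun p hp => ?_
  by_contra h
  simp only [mem_union, mem_iUnion, mem_preimage, mem_singleton_iff, not_or, not_exists] at h
  exact hp (isGeneric_iff.2 h)

lemma eventually_isGeneric (p : D.Surface) : ∀ᶠ q in 𝓝[≠] p, IsGeneric q := by
  have h := ((finite_not_isGeneric D).subset (sdiff_subset (t := {p}))).isClosed.isOpen_compl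
  filter_upwards [self_mem_nhdsWithin,
    mem_nhdsWithin_of_mem_nhds (h.mem_nhds (by simp : p ∈ ({p | ¬ IsGeneric p} \ {p})ᶜ))] with q h1 h2
  by_contra h3
  exact h2 ⟨h3, h1⟩

lemma map_symm_nhdsNE (hz : z ∈ e.target) : map e.symm (𝓝[≠] z) = 𝓝[≠] (e.symm z) := by
  have h := e.symm.map_nhdsWithin_eq hz {z}ᶜ
  rw [h]
  have h2 : e.symm '' (e.symm.source ∩ {z}ᶜ) = e.source ∩ {e.symm z}ᶜ := by
    ext q
    constructor
    · rintro ⟨ζ, ⟨h1, h2⟩, rfl⟩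
      exact ⟨e.map_target h1, fun h3 => h2 (e.symm.injOn h1 hz h3)⟩
    · rintro ⟨h1, h2⟩
      refine ⟨e q, ⟨e.map_source h1, fun h3 => h2 ?_⟩, e.left_inv h1⟩
      rw [mem_singleton_iff] at h3 ⊢
      rw [← h3, e.left_inv h1]
  rw [h2, inter_comm, nhdsWithin_inter_of_mem']
  exact mem_nhdsWithin_of_mem_nhds (e.open_source.mem_nhds (e.map_target hz))

variable (D) in
/-- A section of `x` over the finite values (neither continuous nor canonical). -/
def sect (a : ℂ) : D.Surface := (exists_xc_eq D a).choose

@[simp] lemma xc_sect (a : ℂ) : xc (D.sect a) = a := (exists_xc_eq D a).choose_spec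

lemma tendsto_sect_branch {k : Fin (2 * g + 2)} :
    Tendsto D.sect (𝓝[≠] (D.lam k)) (𝓝[≠] (D.sect (D.lam k))) := by
  refine tendsto_nhdsWithin_iff.2 ⟨?_, ?_⟩
  · have h1 := isClosedMap_xc (D := D) |>.comap_nhds_eq continuous_xc (D.lam k : OnePoint ℂ)
    have h2 : xc ⁻¹' {(D.lam k : OnePoint ℂ)} = {D.sect (D.lam k)} := by
      ext q
      exact ⟨fun hq => eq_of_xc_eq_lam hq (xc_sect _), fun hq => by rw [mem_singleton_iff.1 hq]; simp⟩
    rw [h2, nhdsSet_singleton] at h1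
    rw [← h1, tendsto_comap_iff]
    have : xc ∘ D.sect = fun a : ℂ => (a : OnePoint ℂ) := by ext a; simp
    rw [this]
    exact OnePoint.continuous_coe.continuousAt.mono_left nhdsWithin_le_nhds
  · filter_upwards [self_mem_nhdsWithin] with a ha h
    have := congrArg xc (mem_singleton_iff.1 h)
    rw [xc_sect, xc_sect] at this
    exact ha (OnePoint.coe_injective this)

lemma tendsto_sect_infty :
    Tendsto D.sect (Bornology.cobounded ℂ) (𝓝ˢ (xc ⁻¹' {OnePoint.infty})) := by
  rw [← (isClosedMap_xc (D := D)).comap_nhds_eq continuous_xc, tendsto_comap_iff]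
  have : xc ∘ D.sect = fun a : ℂ => (a : OnePoint ℂ) := by ext a; simp
  rw [this]
  have h := OnePoint.tendsto_coe_infty (X := ℂ)
  rwa [coclosedCompact_eq_cocompact, ← Metric.cobounded_eq_cocompact] at h

open Asymptotics in
/-- A function on the surface which is invariant under the involution, holomorphic at the generic
points, with limits at the branch points and growth at most `|x| ^ n` at infinity, is a polynomial
in `x` of degree at most `n`. -/
lemma exists_polynomial_of_invariant (n : ℕ) {k : D.Surface → ℂ}
    (hk : ∀ p, IsGeneric p → MDifferentiableAt 𝓘(ℂ) 𝓘(ℂ) k p)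
    (hinv : ∀ p, IsGeneric p → k (invol p) = k p)
    (hbr : ∀ p i, xc p = (D.lam i : OnePoint ℂ) → ∃ c, Tendsto k (𝓝[≠] p) (𝓝 c))
    (hinf : ∀ p, xc p = OnePoint.infty →
      ∃ C, ∀ᶠ q in 𝓝[≠] p, ‖k q * affineInv (xc q) ^ n‖ ≤ C) :
    ∃ P ∈ Polynomial.degreeLT ℂ (n + 1), ∀ p, IsGeneric p → k p = P.eval (affine (xc p)) := by
  classical
  have hinv' : ∀ p q, IsGeneric p → xc p = xc q → k q = k p := fun p q hp h => by
    rcases eq_or_eq_invol h with rfl | rfl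
    · rfl
    · exact hinv p hp
  choose c hc using fun i => hbr (D.sect (D.lam i)) i (xc_sect _)
  set q : ℂ → ℂ := fun a => if h : ∃ i, a = D.lam i then c h.choose else k (D.sect a) with hq
  have hqb : ∀ i, q (D.lam i) = c i := fun i => by
    have h : ∃ j, D.lam i = D.lam j := ⟨i, rfl⟩
    have h2 : h.choose = i := (D.inj h.choose_spec).symm
    simp only [hq, dif_pos h, h2]
  have hqg : ∀ a, (∀ i, a ≠ D.lam i) → q a = k (D.sect a) := fun a ha => by
    simp only [hq]
    rw [dif_neg (by push Not; exact ha)]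
  have hfin : ∀ a : ℂ, ∀ᶠ b in 𝓝[≠] a, ∀ i, b ≠ D.lam i := fun a => by
    refine eventually_all.2 fun i => ?_
    by_cases h : a = D.lam i
    · subst h; exact self_mem_nhdsWithin
    · exact mem_nhdsWithin_of_mem_nhds (isOpen_ne.mem_nhds h)
  have hdiff : ∀ a, (∀ i, a ≠ D.lam i) → DifferentiableAt ℂ q a := by
    intro a ha
    have hgen : IsGeneric (D.sect a) := isGeneric_of_coe (xc_sect a) ha
    obtain ⟨e, r, -, hp, -, hes, hef, hec⟩ := exists_chart_x hgen.x_ne hgen.w_ne hgen.w_ne_zero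
    have h1 := (mdifferentiableAt_iff_chart' hec.mem_maximalAtlas hp).1 (hk _ hgen)
    have h2 : e (D.sect a) = a := by rw [hef, xc_sect]; rfl
    have h3 := e.map_source hp
    rw [h2] at h1 h3
    refine h1.congr_of_eventuallyEq ?_
    have h4 : ∀ᶠ b in 𝓝 a, ∀ i, b ≠ D.lam i := eventually_all.2 fun i => isOpen_ne.mem_nhds (ha i)
    filter_upwards [h4, e.open_target.mem_nhds h3] with b hb hbt
    rw [hqg b hb]
    have h5 : xc (e.symm b) = b := by
      rw [← coe_affine (hes _ (e.map_target hbt)), ← hef, e.right_inv hbt]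
    exact hinv' _ _ (isGeneric_of_coe h5 hb) (by rw [h5, xc_sect])
  have hent : Differentiable ℂ q := by
    intro a
    by_cases ha : ∀ i, a ≠ D.lam i
    · exact hdiff a ha
    push Not at ha
    obtain ⟨i, rfl⟩ := ha
    refine (Complex.analyticAt_of_differentiable_on_punctured_nhds_of_continuousAt ?_
      ?_).differentiableAt
    · filter_upwards [hfin (D.lam i)] with b hb using hdiff b hb
    · rw [continuousAt_iff_punctured_nhds, hqb]
      refine ((hc i).comp tendsto_sect_branch).congr' ?_
      filter_upwards [hfin (D.lam i)] with b hb using (hqg b hb).symm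
  have hgrow : q =O[Bornology.cobounded ℂ] (fun z => z ^ n) := by
    obtain ⟨p, hp⟩ := exists_xc_eq D OnePoint.infty
    obtain ⟨C1, hC1⟩ := hinf p hp
    obtain ⟨C2, hC2⟩ := hinf (invol p) hp
    have hset : ∀ᶠ s in 𝓝ˢ (xc (D := D) ⁻¹' {OnePoint.infty}),
        xc s ≠ OnePoint.infty → ‖k s * affineInv (xc s) ^ n‖ ≤ max C1 C2 := by
      rw [Filter.Eventually, mem_nhdsSet_iff_forall]
      intro s hs
      rcases eq_or_eq_invol (hp.trans (Eq.symm hs)) with rfl | rfl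
      · filter_upwards [eventually_nhdsWithin_iff.1 hC1] with t ht htx
        exact (ht fun h => htx (by rw [mem_singleton_iff.1 h]; exact hp)).trans (le_max_left _ _)
      · filter_upwards [eventually_nhdsWithin_iff.1 hC2] with t ht htx
        exact (ht fun h => htx (by rw [mem_singleton_iff.1 h]; exact hp)).trans (le_max_right _ _)
    have hne : ∀ i, ∀ᶠ a in Bornology.cobounded ℂ, a ≠ D.lam i := fun i =>
      Bornology.eventually_ne_cobounded _
    refine IsBigO.of_bound (max C1 C2) ?_
    filter_upwards [tendsto_sect_infty.eventually hset, eventually_all.2 hne,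
      Bornology.eventually_ne_cobounded (0 : ℂ)] with a h1 h2 h3
    have h4 := h1 (by rw [xc_sect]; exact OnePoint.coe_ne_infty a)
    rw [hqg a h2]
    rw [xc_sect, affineInv_coe, norm_mul, norm_pow, norm_inv, inv_pow, ← div_eq_mul_inv,
      div_le_iff₀ (by positivity)] at h4
    rwa [norm_pow]
  obtain ⟨P, hP, hPe⟩ := exists_polynomial_of_isBigO n hent hgrow
  refine ⟨P, hP, fun p hp => ?_⟩
  have hpx : xc p = ((affine (xc p) : ℂ) : OnePoint ℂ) := (coe_affine hp.x_ne).symm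
  rw [← hPe, hqg]
  · exact (hinv' _ _ hp (by rw [xc_sect, ← hpx])).symm
  · intro i hi
    exact (isGeneric_iff.1 hp).2 i (by rw [hpx, hi])

/-! ### Holomorphic 1-forms -/

variable (D) in
/-- The right-hand side of the equation `y² = ∏ j, (x - lam j)`. -/
abbrev full : ℂ → ℂ := rootProd Finset.univ D.lam

lemma yFin_sq_eq_full (hx : xc p ≠ OnePoint.infty) : yFin p ^ 2 = D.full (affine (xc p)) := by
  rw [yFin_sq hx, ← prod_eq]; rfl

lemma analyticAt_yFin (he : e ∈ IsManifold.maximalAtlas 𝓘(ℂ) ω D.Surface) (hz : z ∈ e.target)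
    (hx : xc (e.symm z) ≠ OnePoint.infty) : AnalyticAt ℂ (fun ζ => yFin (e.symm ζ)) z :=
  analyticAt_chart he hz ((eventually_x_ne_infty hx).mono fun _ => mdifferentiableAt_yFin)

lemma two_mul_yFin_mul_deriv (he : e ∈ IsManifold.maximalAtlas 𝓘(ℂ) ω D.Surface)
    (hz : z ∈ e.target) (hx : xc (e.symm z) ≠ OnePoint.infty) :
    2 * yFin (e.symm z) * deriv (fun ζ => yFin (e.symm ζ)) z =
      deriv D.full (affine (xc (e.symm z))) * deriv (fun ζ => affine (xc (e.symm ζ))) z := by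
  have h1 := (analyticAt_yFin he hz hx).differentiableAt.hasDerivAt
  have h2 := (analyticAt_x he hz hx).differentiableAt.hasDerivAt
  have h3 := (h1.pow 2)
  have h4 := (differentiable_rootProd (T := Finset.univ) (lam := D.lam)
    (affine (xc (e.symm z)))).hasDerivAt.comp z h2
  have h5 : (fun ζ => yFin (e.symm ζ)) ^ 2 =ᶠ[𝓝 z]
      rootProd Finset.univ D.lam ∘ fun ζ => affine (xc (e.symm ζ)) := by
    filter_upwards [(e.continuousAt_symm hz).eventually (eventually_x_ne_infty hx)] with ζ hζ
    exact yFin_sq_eq_full hζ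
  have h6 := h3.unique (h4.congr_of_eventuallyEq h5)
  simpa using h6

lemma deriv_full_ne_zero (hw : wc p = ((0 : ℂ) : OnePoint ℂ) ∨ wc p = OnePoint.infty) :
    deriv D.full (affine (xc p)) ≠ 0 := by
  obtain ⟨k, hk⟩ := exists_lam_of_wc hw
  rw [hk, affine_coe]
  exact deriv_rootProd_root_ne_zero D.inj (Finset.mem_univ k)

/-- At the branch points, `y` is a local coordinate. -/
lemma deriv_yFin_ne_zero (he : e ∈ IsManifold.maximalAtlas 𝓘(ℂ) ω D.Surface) (hz : z ∈ e.target)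
    (hw : wc (e.symm z) = ((0 : ℂ) : OnePoint ℂ) ∨ wc (e.symm z) = OnePoint.infty) :
    deriv (fun ζ => yFin (e.symm ζ)) z ≠ 0 := by
  have hx := xc_ne_infty_of_wc hw
  have hxa := (analyticAt_x he hz hx).differentiableAt
  rcases hw with hw | hw
  · have hw' : wc (e.symm z) ≠ OnePoint.infty := by rw [hw]; exact OnePoint.coe_ne_infty 0
    have h1 := (analyticAt_w he hz hw').differentiableAt.hasDerivAt
    have h2 := ((differentiable_rootProd (T := D.I) (lam := D.lam) _).comp z hxa).hasDerivAt
    have h3 := h1.mul h2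
    have h4 : (fun ζ => yFin (e.symm ζ)) =ᶠ[𝓝 z]
        (fun ζ => affine (wc (e.symm ζ))) * (rootProd D.I D.lam ∘ fun ζ => affine (xc (e.symm ζ))) := by
      filter_upwards [(e.continuousAt_symm hz).eventually (eventually_w_ne_infty hw')] with ζ hζ
      exact yFin_eq_w hζ
    rw [(h3.congr_of_eventuallyEq h4).deriv]
    simp only [hw, affine_coe, zero_mul, add_zero]
    exact mul_ne_zero (deriv_w_ne_zero he hz hw) (den_ne_zero_of_wc hx hw')
  · have hw' : wc (e.symm z) ≠ ((0 : ℂ) : OnePoint ℂ) := by rw [hw]; exact OnePoint.infty_ne_coe 0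
    have h1 := (analyticAt_wInv he hz hw').differentiableAt.hasDerivAt
    have h2 := ((differentiable_rootProd (T := D.Iᶜ) (lam := D.lam) _).comp z hxa).hasDerivAt
    have h3 := h1.mul h2
    have h4 : (fun ζ => yFin (e.symm ζ)) =ᶠ[𝓝 z] (fun ζ => affineInv (wc (e.symm ζ))) *
        (rootProd D.Iᶜ D.lam ∘ fun ζ => affine (xc (e.symm ζ))) := by
      filter_upwards [(e.continuousAt_symm hz).eventually (eventually_w_ne_zero hw'),
        (e.continuousAt_symm hz).eventually (eventually_x_ne_infty hx)] with ζ hζ h'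
      exact yFin_eq_wInv h' hζ
    rw [(h3.congr_of_eventuallyEq h4).deriv]
    simp only [hw, affineInv_infty, zero_mul, add_zero]
    exact mul_ne_zero (deriv_wInv_ne_zero he hz hw) (num_ne_zero_of_wc hx hw')

/-- The coordinates `x` and `u = 1 / x` are related by `x' = - u' / u²`. -/
lemma deriv_x_eq (he : e ∈ IsManifold.maximalAtlas 𝓘(ℂ) ω D.Surface) (hz : z ∈ e.target)
    (hx : xc (e.symm z) ≠ OnePoint.infty) (hx0 : xc (e.symm z) ≠ ((0 : ℂ) : OnePoint ℂ)) :
    deriv (fun ζ => affine (xc (e.symm ζ))) z =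
      -deriv (fun ζ => affineInv (xc (e.symm ζ))) z / affineInv (xc (e.symm z)) ^ 2 := by
  have h1 := (analyticAt_xInv he hz hx0).differentiableAt.hasDerivAt
  refine ((h1.inv (affineInv_x_ne_zero hx hx0)).congr_of_eventuallyEq ?_).deriv
  filter_upwards [(e.continuousAt_symm hz).eventually (eventually_x_ne_infty hx)] with ζ hζ
  simp only [Pi.inv_apply]
  rw [affineInv_eq hζ, inv_inv]

/-- Forms as functions: the coefficient with respect to the trivialization of the tangent space. -/
abbrev formVal (α : ∀ p : D.Surface, TangentSpace 𝓘(ℂ) p →L[ℂ] ℂ) (p : D.Surface) : ℂ :=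
  (α p : ℂ →L[ℂ] ℂ) (1 : ℂ)

/-- The quotient `α / (dx / y)` of a 1-form by the basic holomorphic form, at generic points. -/
def quot (α : ∀ p : D.Surface, TangentSpace 𝓘(ℂ) p →L[ℂ] ℂ) (p : D.Surface) : ℂ :=
  yFin p * formVal α p / mderiv (fun q => affine (xc q)) p

lemma quot_eq (α : ∀ p : D.Surface, TangentSpace 𝓘(ℂ) p →L[ℂ] ℂ)
    (he : e ∈ IsManifold.maximalAtlas 𝓘(ℂ) ω D.Surface) (hz : z ∈ e.target)
    (hx : xc (e.symm z) ≠ OnePoint.infty) :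
    quot α (e.symm z) =
      yFin (e.symm z) * coeffIn α e z / deriv (fun ζ => affine (xc (e.symm ζ))) z := by
  rw [quot, coeffIn_eq, deriv_chart he hz (mdifferentiableAt_x hx), mul_left_comm,
    mul_div_mul_left _ _ (chartVec_ne_zero he hz)]

lemma mem_atlas_maximal (he : e ∈ atlas ℂ D.Surface) :
    e ∈ IsManifold.maximalAtlas 𝓘(ℂ) ω D.Surface :=
  (isSmallChart_of_mem_atlas he).isCoordChart.mem_maximalAtlas

lemma exists_atlas_point (p : D.Surface) : ∃ e ∈ atlas ℂ D.Surface, ∃ z ∈ e.target, e.symm z = p :=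
  ⟨chartAt ℂ p, chart_mem_atlas ℂ p, chartAt ℂ p p, mem_chart_target ℂ p,
    (chartAt ℂ p).left_inv (mem_chart_source ℂ p)⟩

lemma eventually_chart_generic (hz : z ∈ e.target) :
    ∀ᶠ ζ in 𝓝[≠] z, ζ ∈ e.target ∧ IsGeneric (e.symm ζ) := by
  have h := eventually_isGeneric (e.symm z)
  rw [← map_symm_nhdsNE hz, eventually_map] at h
  exact (eventually_nhdsWithin_of_eventually_nhds (e.open_target.mem_nhds hz)).and h

section Upper

variable {α : ∀ p : D.Surface, TangentSpace 𝓘(ℂ) p →L[ℂ] ℂ}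

lemma mdifferentiableAt_quot (hα : α ∈ holomorphicOneForms D.Surface) (hp : IsGeneric p) :
    MDifferentiableAt 𝓘(ℂ) 𝓘(ℂ) (quot α) p := by
  obtain ⟨e, hea, z, hz, rfl⟩ := exists_atlas_point p
  have he := mem_atlas_maximal hea
  rw [mdifferentiableAt_iff_chart he hz]
  have h1 := (analyticAt_yFin he hz hp.x_ne).differentiableAt
  have h2 := (analyticAt_x he hz hp.x_ne).deriv.differentiableAt
  have h3 := (hα e hea).differentiableAt (e.open_target.mem_nhds hz)
  refine ((h1.mul h3).div h2 (deriv_x_ne_zero he hz hp.x_ne hp.w_ne hp.w_ne_zero)).congr_of_eventuallyEq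
    ?_
  filter_upwards [e.open_target.mem_nhds hz,
    (e.continuousAt_symm hz).eventually (eventually_x_ne_infty hp.x_ne)] with ζ h4 h5
  exact quot_eq α he h4 h5

/-- At a branch point, where `2 y dy = f'(x) dx`, the quotient of a holomorphic form by `dx / y` has
a limit. -/
lemma tendsto_quot_branch (hα : α ∈ holomorphicOneForms D.Surface)
    (hw : wc p = ((0 : ℂ) : OnePoint ℂ) ∨ wc p = OnePoint.infty) :
    ∃ c, Tendsto (quot α) (𝓝[≠] p) (𝓝 c) := by
  obtain ⟨e, hea, z, hz, rfl⟩ := exists_atlas_point p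
  have he := mem_atlas_maximal hea
  have hx := xc_ne_infty_of_wc hw
  rw [← map_symm_nhdsNE hz]
  have h1 := (analyticAt_yFin he hz hx).deriv.continuousAt
  have h3 := ((hα e hea).differentiableAt (e.open_target.mem_nhds hz)).continuousAt
  have h4 : ContinuousAt (fun ζ => deriv D.full (affine (xc (e.symm ζ)))) z := by
    have : Continuous (deriv D.full) :=
      (differentiable_rootProd (T := Finset.univ) (lam := D.lam)).contDiff.continuous_deriv le_top
    exact this.continuousAt.comp (analyticAt_x he hz hx).continuousAt
  have hy := deriv_yFin_ne_zero he hz hw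
  have h5 := (h3.mul h4).div (h1.const_mul 2) (mul_ne_zero two_ne_zero hy)
  refine ⟨_, tendsto_map'_iff.2 ((h5.tendsto.mono_left nhdsWithin_le_nhds).congr' ?_)⟩
  filter_upwards [eventually_chart_generic hz,
    eventually_nhdsWithin_of_eventually_nhds (h1.eventually_ne hy)] with ζ ⟨h6, h7⟩ h8
  rw [Function.comp_apply, quot_eq α he h6 h7.x_ne]
  have h9 := two_mul_yFin_mul_deriv he h6 h7.x_ne
  have h10 := deriv_x_ne_zero he h6 h7.x_ne h7.w_ne h7.w_ne_zero
  change coeffIn α e ζ * deriv D.full (affine (xc (e.symm ζ))) /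
    (2 * deriv (fun ζ => yFin (e.symm ζ)) ζ) = _
  rw [div_eq_div_iff (mul_ne_zero two_ne_zero h8) h10]
  linear_combination (-coeffIn α e ζ) * h9

/-- At infinity, in terms of `u = 1 / x`, one has `dx = -du / u²` and `y = u ^ (-(g + 1))` times a unit,
so that the quotient of a holomorphic form by `dx / y` is `O(u ^ (1 - g))`. -/
lemma quot_growth (hg : 1 ≤ g) (hα : α ∈ holomorphicOneForms D.Surface)
    (hx : xc p = OnePoint.infty) :
    ∃ C, ∀ᶠ q in 𝓝[≠] p, ‖quot α q * affineInv (xc q) ^ (g - 1)‖ ≤ C := by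
  obtain ⟨e, hea, z, hz, rfl⟩ := exists_atlas_point p
  have he := mem_atlas_maximal hea
  have hx0 : xc (e.symm z) ≠ ((0 : ℂ) : OnePoint ℂ) := by rw [hx]; exact OnePoint.infty_ne_coe 0
  have hw := wc_ne_infty hx
  have h1 := analyticAt_xInv he hz hx0
  have h2 := analyticAt_w he hz hw
  have h3 := ((hα e hea).differentiableAt (e.open_target.mem_nhds hz)).continuousAt
  have h4 : ContinuousAt (fun ζ => D.denRev (affineInv (xc (e.symm ζ)))) z :=
    differentiable_rootProdRev.continuous.continuousAt.comp h1.continuousAt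
  have hu := deriv_xInv_ne_zero he hz hx
  have h5 := ((h3.neg.mul (h2.continuousAt.mul h4)).div h1.deriv.continuousAt hu)
  rw [← map_symm_nhdsNE hz]
  obtain ⟨C, hC⟩ : ∃ C, ∀ᶠ ζ in 𝓝 z, ‖(-coeffIn α e ζ * (affine (wc (e.symm ζ)) *
      D.denRev (affineInv (xc (e.symm ζ))))) / deriv (fun ζ => affineInv (xc (e.symm ζ))) ζ‖ ≤ C :=
    ⟨_, h5.norm.eventually_le_const (lt_add_one _)⟩
  refine ⟨C, eventually_map.2 ?_⟩
  filter_upwards [eventually_chart_generic hz,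
    eventually_nhdsWithin_of_eventually_nhds (h1.deriv.continuousAt.eventually_ne hu),
    eventually_nhdsWithin_of_eventually_nhds
      ((e.continuousAt_symm hz).eventually (eventually_x_ne_zero hx0)),
    eventually_nhdsWithin_of_eventually_nhds hC] with ζ ⟨h6, h7⟩ h8 h9 h10
  refine le_of_eq_of_le (congrArg norm ?_) h10
  have hune := affineInv_x_ne_zero h7.x_ne h9
  rw [quot_eq α he h6 h7.x_ne, deriv_x_eq he h6 h7.x_ne h9]
  have h11 := yFin_mul_pow h7.x_ne h9 h7.w_ne
  rw [← h11]
  obtain ⟨m, rfl⟩ : ∃ m, g = m + 1 := ⟨g - 1, by omega⟩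
  simp only [Nat.add_sub_cancel]
  field_simp
  ring

/-- A holomorphic 1-form is `q(x) dx / y` for a polynomial `q` of degree less than `g`: its quotient
by `dx / y` is an even function, because the square of its odd part is a polynomial in `x` of degree
at most `2 g - 2` with `2 g + 2` roots. -/
lemma exists_quot_eq (hg : 1 ≤ g) (hα : α ∈ holomorphicOneForms D.Surface) :
    ∃ P ∈ Polynomial.degreeLT ℂ g, ∀ p, IsGeneric p → quot α p = P.eval (affine (xc p)) := by
  have hinvNE : ∀ p : D.Surface, Tendsto invol (𝓝[≠] p) (𝓝[≠] (invol p)) := fun p =>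
    tendsto_nhdsWithin_iff.2 ⟨continuous_invol.continuousAt.mono_left nhdsWithin_le_nhds, by
      filter_upwards [self_mem_nhdsWithin] with q hq h
      exact hq (involutive_invol.injective h)⟩
  have hbr : ∀ (p : D.Surface) i, xc p = (D.lam i : OnePoint ℂ) →
      ∃ c, Tendsto (quot α) (𝓝[≠] p) (𝓝 c) ∧
        Tendsto (fun q => quot α (invol q)) (𝓝[≠] p) (𝓝 c) := by
    intro p i hp
    have hw := wc_of_xc_eq_lam hp
    obtain ⟨c, hc⟩ := tendsto_quot_branch hα hw
    refine ⟨c, hc, ?_⟩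
    have := hinvNE p
    rw [invol_eq_self hw] at this
    exact hc.comp this
  have hmd : ∀ p : D.Surface, IsGeneric p →
      MDifferentiableAt 𝓘(ℂ) 𝓘(ℂ) (fun q => quot α (invol q)) p := fun p hp =>
    (mdifferentiableAt_quot hα hp.invol).comp p (mdifferentiable_invol p)
  have hgr : ∀ p : D.Surface, xc p = OnePoint.infty →
      ∃ C, ∀ᶠ q in 𝓝[≠] p, ‖quot α q * affineInv (xc q) ^ (g - 1)‖ ≤ C ∧
        ‖quot α (invol q) * affineInv (xc q) ^ (g - 1)‖ ≤ C := by
    intro p hp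
    obtain ⟨C1, hC1⟩ := quot_growth hg hα hp
    obtain ⟨C2, hC2⟩ := quot_growth hg hα (p := invol p) hp
    refine ⟨max C1 C2, ?_⟩
    filter_upwards [hC1, (hinvNE p).eventually hC2] with q h1 h2
    exact ⟨h1.trans (le_max_left _ _), h2.trans (le_max_right _ _)⟩
  -- the odd part vanishes, because its square is a polynomial with too many roots
  have hodd : ∀ p : D.Surface, IsGeneric p → quot α (invol p) = quot α p := by
    obtain ⟨Q, hQ, hQe⟩ := exists_polynomial_of_invariant (D := D) (2 * (g - 1))
      (k := fun p => (quot α p - quot α (invol p)) ^ 2)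
      (fun p hp => ((mdifferentiableAt_quot hα hp).sub (hmd p hp)).pow 2)
      (fun p _ => by rw [involutive_invol p]; ring)
      (fun p i hp => by
        obtain ⟨c, h1, h2⟩ := hbr p i hp
        exact ⟨_, (h1.sub h2).pow 2⟩)
      (fun p hp => by
        obtain ⟨C, hC⟩ := hgr p hp
        refine ⟨(2 * C) ^ 2, hC.mono fun q hq => ?_⟩
        rw [pow_mul', ← mul_pow, norm_pow, sub_mul]
        refine pow_le_pow_left₀ (norm_nonneg _) ?_ 2
        refine (norm_sub_le _ _).trans ?_
        linarith [hq.1, hq.2])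
    have hroot : ∀ i, Q.eval (D.lam i) = 0 := by
      intro i
      obtain ⟨c, h1, h2⟩ := hbr (D.sect (D.lam i)) i (xc_sect _)
      have h3 := (h1.sub h2).pow 2
      rw [sub_self, zero_pow two_ne_zero] at h3
      have hx : xc (D.sect (D.lam i)) ≠ OnePoint.infty := by
        rw [xc_sect]; exact OnePoint.coe_ne_infty _
      have h4 : Tendsto (fun p : D.Surface => Q.eval (affine (xc p))) (𝓝[≠] (D.sect (D.lam i)))
          (𝓝 (Q.eval (D.lam i))) := by
        have : ContinuousAt (fun p : D.Surface => Q.eval (affine (xc p))) (D.sect (D.lam i)) :=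
          Q.continuous.continuousAt.comp
            ((continuousAt_affine hx).comp continuous_xc.continuousAt)
        have h5 := this.tendsto
        simp only [xc_sect, affine_coe] at h5
        exact h5.mono_left nhdsWithin_le_nhds
      have : (𝓝[≠] (D.sect (D.lam i))).NeBot := by
        obtain ⟨e, -, z, hz, hze⟩ := exists_atlas_point (D.sect (D.lam i))
        rw [← hze, ← map_symm_nhdsNE hz]
        infer_instance
      refine tendsto_nhds_unique (h4.congr' ?_) h3
      filter_upwards [eventually_isGeneric _] with q hq using (hQe q hq).symm
    have hQ0 : Q = 0 := by
      refine Polynomial.eq_zero_of_degree_lt_of_eval_index_eq_zero (s := Finset.univ) (v := D.lam)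
        (D.inj.injOn) ?_ fun i _ => hroot i
      rw [Polynomial.mem_degreeLT] at hQ
      refine hQ.trans_le ?_
      rw [Finset.card_univ, Fintype.card_fin]
      exact_mod_cast by omega
    intro p hp
    have := hQe p hp
    rw [hQ0, Polynomial.eval_zero] at this
    exact (sub_eq_zero.1 (pow_eq_zero_iff two_ne_zero |>.1 this)).symm
  have := exists_polynomial_of_invariant (D := D) (g - 1) (k := quot α)
    (fun p hp => mdifferentiableAt_quot hα hp) hodd
    (fun p i hp => (hbr p i hp).imp fun c hc => hc.1) (fun p hp => quot_growth hg hα hp)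
  rwa [Nat.sub_add_cancel hg] at this

end Upper

/-! ### The forms `q(x) dx / y` -/

open Classical in
/-- The coefficient of the form `q(x) dx / y` at `p`: at the branch points it is written as
`2 q(x) dy / f'(x)`, and at infinity as `- u ^ (g - 1) q(1 / u) du / (y u ^ (g + 1))`,
where `u = 1 / x`. -/
def formCoeff (q : Polynomial ℂ) (p : D.Surface) : ℂ :=
  if xc p = OnePoint.infty then
    -q.coeff (g - 1) / affine (wc p) * mderiv (fun q => affineInv (xc q)) p
  else if yFin p = 0 then
    2 * q.eval (affine (xc p)) / deriv D.full (affine (xc p)) * mderiv yFin p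
  else q.eval (affine (xc p)) / yFin p * mderiv (fun q => affine (xc q)) p

/-- The field of covectors `q(x) dx / y`. -/
def formOf (q : Polynomial ℂ) (p : D.Surface) : TangentSpace 𝓘(ℂ) p →L[ℂ] ℂ :=
  (formCoeff q p • ContinuousLinearMap.id ℂ ℂ : ℂ →L[ℂ] ℂ)

lemma formVal_formOf (q : Polynomial ℂ) (p : D.Surface) : formVal (formOf q) p = formCoeff q p := by
  change formCoeff q p • (1 : ℂ) = _
  simp

lemma coeffIn_generic (q : Polynomial ℂ) (he : e ∈ IsManifold.maximalAtlas 𝓘(ℂ) ω D.Surface)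
    (hz : z ∈ e.target) (hp : IsGeneric (e.symm z)) :
    coeffIn (formOf q) e z = q.eval (affine (xc (e.symm z))) / yFin (e.symm z) *
      deriv (fun ζ => affine (xc (e.symm ζ))) z := by
  rw [coeffIn_eq]
  change _ * formVal (formOf q) _ = _
  rw [formVal_formOf, formCoeff, if_neg hp.x_ne, if_neg hp.yFin_ne_zero,
    deriv_chart he hz (mdifferentiableAt_x hp.x_ne)]
  ring

/-- The reversed polynomial `u ^ (g - 1) q(1 / u)`. -/
lemma eval_reflect {q : Polynomial ℂ} (hq : q ∈ Polynomial.degreeLT ℂ g) {u : ℂ} (hu : u ≠ 0) :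
    (q.reflect (g - 1)).eval u = u ^ (g - 1) * q.eval u⁻¹ := by
  have hdeg : q.natDegree ≤ g - 1 := by
    by_cases h0 : q = 0
    · simp [h0]
    rw [Polynomial.mem_degreeLT, Polynomial.degree_eq_natDegree h0] at hq
    norm_cast at hq
    omega
  let := invertibleOfNonzero (inv_ne_zero hu)
  have h := Polynomial.eval₂_reflect_mul_pow (RingHom.id ℂ) u⁻¹ (g - 1) q hdeg
  simp only [invOf_eq_inv, inv_inv] at h
  change (q.reflect (g - 1)).eval u * (u⁻¹) ^ (g - 1) = q.eval u⁻¹ at h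
  rw [← h, inv_pow]
  field_simp

lemma formOf_mem {q : Polynomial ℂ} (hg : 1 ≤ g) (hq : q ∈ Polynomial.degreeLT ℂ g) :
    formOf q ∈ holomorphicOneForms D.Surface := by
  intro e hea z hz
  have he := mem_atlas_maximal hea
  refine DifferentiableAt.differentiableWithinAt ?_
  have hgen := eventually_chart_generic hz
  have hqd : Differentiable ℂ (fun a => q.eval a) := q.differentiable
  -- reduction to an equality on a punctured neighbourhood and at the point
  have key : ∀ F : ℂ → ℂ, DifferentiableAt ℂ F z → coeffIn (formOf q) e z = F z →
      (∀ᶠ ζ in 𝓝[≠] z, coeffIn (formOf q) e ζ = F ζ) →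
      DifferentiableAt ℂ (coeffIn (formOf q) e) z := fun F hF h0 h1 =>
    hF.congr_of_eventuallyEq (eventuallyEq_nhds_of_eventuallyEq_nhdsNE h1 h0)
  by_cases hx : xc (e.symm z) = OnePoint.infty
  · have hx0 : xc (e.symm z) ≠ ((0 : ℂ) : OnePoint ℂ) := by rw [hx]; exact OnePoint.infty_ne_coe 0
    have hw := wc_ne_infty hx
    have h1 := analyticAt_xInv he hz hx0
    have h2 := analyticAt_w he hz hw
    have h4 : DifferentiableAt ℂ (fun ζ => D.denRev (affineInv (xc (e.symm ζ)))) z :=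
      (differentiable_rootProdRev _).comp z h1.differentiableAt
    have h5 : DifferentiableAt ℂ (fun ζ => (q.reflect (g - 1)).eval (affineInv (xc (e.symm ζ)))) z :=
      ((q.reflect (g - 1)).differentiable _).comp z h1.differentiableAt
    refine key (fun ζ => -((q.reflect (g - 1)).eval (affineInv (xc (e.symm ζ)))) /
      (affine (wc (e.symm ζ)) * D.denRev (affineInv (xc (e.symm ζ)))) *
        deriv (fun ζ => affineInv (xc (e.symm ζ))) ζ)
      ((h5.neg.div (h2.differentiableAt.mul h4) ?_).mul h1.deriv.differentiableAt) ?_ ?_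
    · exact mul_ne_zero (affine_ne_zero hw (wc_ne_zero_of_infty hx)) (denRev_ne_zero hx0 hw)
    · rw [coeffIn_eq]
      change _ * formVal (formOf q) _ = _
      rw [formVal_formOf, formCoeff, if_pos hx, deriv_chart he hz (mdifferentiableAt_xInv hx0)]
      simp only [hx, affineInv_infty, rootProdRev_zero, mul_one]
      rw [← Polynomial.coeff_zero_eq_eval_zero, Polynomial.coeff_reflect,
        Polynomial.revAt_le (Nat.zero_le _), Nat.sub_zero]
      ring
    · filter_upwards [hgen, eventually_nhdsWithin_of_eventually_nhds
        ((e.continuousAt_symm hz).eventually (eventually_x_ne_zero hx0))] with ζ ⟨h6, h7⟩ h8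
      have hu := affineInv_x_ne_zero h7.x_ne h8
      have h9 := yFin_mul_pow h7.x_ne h8 h7.w_ne
      have hy := h7.yFin_ne_zero
      rw [coeffIn_generic q he h6 h7, deriv_x_eq he h6 h7.x_ne h8, eval_reflect hq hu, ← h9]
      have : affine (xc (e.symm ζ)) = (affineInv (xc (e.symm ζ)))⁻¹ := by
        rw [affineInv_eq h7.x_ne, inv_inv]
      rw [this]
      obtain ⟨m, rfl⟩ : ∃ m, g = m + 1 := ⟨g - 1, by omega⟩
      simp only [Nat.add_sub_cancel]
      field_simp
      ring
  have hxd := (analyticAt_x he hz hx)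
  have hyd := (analyticAt_yFin he hz hx)
  have hqx : DifferentiableAt ℂ (fun ζ => q.eval (affine (xc (e.symm ζ)))) z :=
    (hqd _).comp z hxd.differentiableAt
  by_cases hy : yFin (e.symm z) = 0
  · have hw := (yFin_eq_zero_iff hx).1 hy
    have hfd : DifferentiableAt ℂ (fun ζ => deriv D.full (affine (xc (e.symm ζ)))) z :=
      DifferentiableAt.comp z ((differentiable_rootProd.analyticAt _).deriv.differentiableAt)
        hxd.differentiableAt
    have hf0 := deriv_full_ne_zero hw
    refine key (fun ζ => 2 * q.eval (affine (xc (e.symm ζ))) /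
      deriv D.full (affine (xc (e.symm ζ))) * deriv (fun ζ => yFin (e.symm ζ)) ζ)
      (((hqx.const_mul 2).div hfd hf0).mul hyd.deriv.differentiableAt) ?_ ?_
    · rw [coeffIn_eq]
      change _ * formVal (formOf q) _ = _
      rw [formVal_formOf, formCoeff, if_neg hx, if_pos hy,
        deriv_chart he hz (mdifferentiableAt_yFin hx)]
      ring
    · filter_upwards [hgen, eventually_nhdsWithin_of_eventually_nhds
        (hfd.continuousAt.eventually_ne hf0)] with ζ ⟨h6, h7⟩ h8
      rw [coeffIn_generic q he h6 h7]
      have hy' := h7.yFin_ne_zero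
      have h9 := two_mul_yFin_mul_deriv he h6 h7.x_ne
      rw [div_mul_eq_mul_div, div_mul_eq_mul_div, div_eq_div_iff hy' h8]
      linear_combination (-q.eval (affine (xc (e.symm ζ)))) * h9
  · have hp : IsGeneric (e.symm z) := by
      rw [yFin_eq_zero_iff hx, not_or] at hy
      exact ⟨hx, hy.2, hy.1⟩
    refine key (fun ζ => q.eval (affine (xc (e.symm ζ))) / yFin (e.symm ζ) *
      deriv (fun ζ => affine (xc (e.symm ζ))) ζ)
      ((hqx.div hyd.differentiableAt hy).mul hxd.deriv.differentiableAt)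
      (coeffIn_generic q he hz hp) ?_
    filter_upwards [hgen] with ζ ⟨h6, h7⟩
    exact coeffIn_generic q he h6 h7

lemma mderiv_x_ne_zero (hp : IsGeneric p) : mderiv (fun q => affine (xc q)) p ≠ 0 := by
  obtain ⟨e, hea, z, hz, rfl⟩ := exists_atlas_point p
  have he := mem_atlas_maximal hea
  have := deriv_x_ne_zero he hz hp.x_ne hp.w_ne hp.w_ne_zero
  rw [deriv_chart he hz (mdifferentiableAt_x hp.x_ne)] at this
  exact right_ne_zero_of_mul this

lemma quot_formOf (q : Polynomial ℂ) (hp : IsGeneric p) :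
    quot (formOf q) p = q.eval (affine (xc p)) := by
  rw [quot, formVal_formOf, formCoeff, if_neg hp.x_ne, if_neg hp.yFin_ne_zero]
  have := hp.yFin_ne_zero
  have := mderiv_x_ne_zero hp
  field_simp

/-- A holomorphic form is determined by its values at the generic points. -/
lemma eq_zero_of_generic {α : ∀ p : D.Surface, TangentSpace 𝓘(ℂ) p →L[ℂ] ℂ}
    (hα : α ∈ holomorphicOneForms D.Surface) (h : ∀ p, IsGeneric p → quot α p = 0) : α = 0 := by
  have hval : ∀ p : D.Surface, formVal α p = 0 := by
    intro p
    obtain ⟨e, hea, z, hz, rfl⟩ := exists_atlas_point p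
    have he := mem_atlas_maximal hea
    have h1 := ((hα e hea).differentiableAt (e.open_target.mem_nhds hz)).continuousAt
    have h2 : ∀ᶠ ζ in 𝓝[≠] z, coeffIn α e ζ = 0 := by
      filter_upwards [eventually_chart_generic hz] with ζ ⟨h3, h4⟩
      have h5 := h _ h4
      rw [quot_eq α he h3 h4.x_ne, div_eq_zero_iff, mul_eq_zero] at h5
      have h6 := deriv_x_ne_zero he h3 h4.x_ne h4.w_ne h4.w_ne_zero
      exact (h5.resolve_right h6).resolve_left h4.yFin_ne_zero
    have h3 : coeffIn α e z = 0 :=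
      tendsto_nhds_unique (h1.tendsto.mono_left nhdsWithin_le_nhds)
        (tendsto_const_nhds.congr' (h2.mono fun _ h => h.symm))
    rw [coeffIn_eq, mul_eq_zero] at h3
    exact h3.resolve_left (chartVec_ne_zero he hz)
  funext p
  refine ContinuousLinearMap.ext fun v => ?_
  have h0 : (α p : ℂ →L[ℂ] ℂ) (1 : ℂ) = 0 := hval p
  exact (clm_apply_eq_mul (α p : ℂ →L[ℂ] ℂ) (v : ℂ)).trans
    ((congrArg (HMul.hMul (α := ℂ) (β := ℂ) v) h0).trans (mul_zero _))

lemma quot_sub (α β : ∀ p : D.Surface, TangentSpace 𝓘(ℂ) p →L[ℂ] ℂ) (p : D.Surface) :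
    quot (α - β) p = quot α p - quot β p := by
  have : formVal (α - β) p = formVal α p - formVal β p := rfl
  rw [quot, quot, quot, this]
  ring

/-- The linear map `q ↦ q(x) dx / y`. -/
def formMap (D : BranchData g) (hg : 1 ≤ g) :
    Polynomial.degreeLT ℂ g →ₗ[ℂ] holomorphicOneForms D.Surface where
  toFun q := ⟨formOf q.1, formOf_mem hg q.2⟩
  map_add' q r := by
    refine Subtype.ext (sub_eq_zero.1 (eq_zero_of_generic ?_ fun p hp => ?_))
    · exact Submodule.sub_mem _ (formOf_mem hg (q + r).2)
        (Submodule.add_mem _ (formOf_mem hg q.2) (formOf_mem hg r.2))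
    · have : quot (formOf q.1 + formOf r.1) p = quot (formOf q.1) p + quot (formOf r.1) p := by
        have : formVal (formOf q.1 + formOf r.1) p = formVal (formOf q.1) p + formVal (formOf r.1) p :=
          rfl
        rw [quot, quot, quot, this]; ring
      change quot (formOf (q + r).1 - (formOf q.1 + formOf r.1)) p = 0
      rw [quot_sub, this, quot_formOf _ hp, quot_formOf _ hp, quot_formOf _ hp]
      simp
  map_smul' c q := by
    refine Subtype.ext (sub_eq_zero.1 (eq_zero_of_generic ?_ fun p hp => ?_))
    · exact Submodule.sub_mem _ (formOf_mem hg (c • q).2)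
        (Submodule.smul_mem _ c (formOf_mem hg q.2))
    · have : quot (c • formOf q.1) p = c * quot (formOf q.1) p := by
        have : formVal (c • formOf q.1) p = c * formVal (formOf q.1) p := rfl
        rw [quot, quot, this]; ring
      change quot (formOf (c • q).1 - c • formOf q.1) p = 0
      rw [quot_sub, this, quot_formOf _ hp, quot_formOf _ hp]
      simp

lemma formMap_bijective (hg : 1 ≤ g) : Function.Bijective (formMap D hg) := by
  constructor
  · refine (injective_iff_map_eq_zero (formMap D hg)).2 fun q hq => ?_
    have h0 : formOf q.1 = 0 := congrArg Subtype.val hq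
    refine Subtype.ext (Polynomial.eq_zero_of_infinite_isRoot _ ?_)
    have hinf : {a : ℂ | ∀ i, a ≠ D.lam i}.Infinite := by
      have : {a : ℂ | ∀ i, a ≠ D.lam i} = (range D.lam)ᶜ := by
        ext a; simp [eq_comm]
      rw [this]
      exact (finite_range D.lam).infinite_compl
    refine hinf.mono fun a ha => ?_
    have hp := isGeneric_of_coe (D := D) (xc_sect a) ha
    have h1 := quot_formOf q.1 hp
    rw [h0, xc_sect, affine_coe] at h1
    have h2 : quot (0 : ∀ p : D.Surface, TangentSpace 𝓘(ℂ) p →L[ℂ] ℂ) (D.sect a) = 0 := by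
      have : formVal (0 : ∀ p : D.Surface, TangentSpace 𝓘(ℂ) p →L[ℂ] ℂ) (D.sect a) = 0 := rfl
      rw [quot, this]; simp
    exact (h1.symm.trans h2)
  · rintro ⟨α, hα⟩
    obtain ⟨P, hP, hPe⟩ := exists_quot_eq hg hα
    refine ⟨⟨P, hP⟩, Subtype.ext (sub_eq_zero.1 (eq_zero_of_generic
      (Submodule.sub_mem _ (formOf_mem hg hP) hα) fun p hp => ?_))⟩
    change quot (formOf P - α) p = 0
    rw [quot_sub, quot_formOf _ hp, hPe p hp, sub_self]

lemma genus_eq (D : BranchData g) (hg : 1 ≤ g) : genus D.Surface = g := by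
  have h := (LinearEquiv.ofBijective (formMap D hg) (formMap_bijective hg)).finrank_eq
  rw [genus, ← h, (Polynomial.degreeLTEquiv ℂ g).finrank_eq, Module.finrank_fin_fun]

end BranchData

/-! ### Holomorphic curves in `ℂ²` as minimal surfaces in `ℝ⁴` -/

lemma toR4_add (a b c d : ℂ) : toR4 (a + c) (b + d) = toR4 a b + toR4 c d := by
  ext i; fin_cases i <;> simp [toR4]

lemma toR4_smul (t : ℝ) (a b : ℂ) : toR4 (t * a) (t * b) = t • toR4 a b := by
  ext i; fin_cases i <;> simp [toR4]

lemma toR4_neg (a b : ℂ) : toR4 (-a) (-b) = -toR4 a b := by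
  ext i; fin_cases i <;> simp [toR4]

/-- The identification of `ℂ²` with `ℝ⁴` as a real linear map. -/
def toR4L : (ℂ × ℂ) →L[ℝ] R4 :=
  LinearMap.toContinuousLinearMap
    { toFun := fun c => toR4 c.1 c.2
      map_add' := fun c d => toR4_add _ _ _ _
      map_smul' := fun t c => by simpa using toR4_smul t c.1 c.2 }

lemma norm_sq_toR4 (a b : ℂ) : ‖toR4 a b‖ ^ 2 = ‖a‖ ^ 2 + ‖b‖ ^ 2 := by
  rw [EuclideanSpace.norm_sq_eq, Complex.sq_norm, Complex.sq_norm]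
  simp [Fin.sum_univ_four, toR4, Complex.normSq_apply]
  ring

lemma inner_toR4 (a b c d : ℂ) :
    inner ℝ (toR4 a b) (toR4 c d) = a.re * c.re + a.im * c.im + b.re * d.re + b.im * d.im := by
  simp [PiLp.inner_apply, Fin.sum_univ_four, toR4]
  ring

lemma toR4_eq_zero {a b : ℂ} : toR4 a b = 0 ↔ a = 0 ∧ b = 0 := by
  constructor
  · intro h
    have h2 := norm_sq_toR4 a b
    rw [h, norm_zero] at h2
    have ha : ‖a‖ ^ 2 = 0 := by nlinarith [sq_nonneg ‖a‖, sq_nonneg ‖b‖]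
    have hb : ‖b‖ ^ 2 = 0 := by nlinarith [sq_nonneg ‖a‖, sq_nonneg ‖b‖]
    exact ⟨by simpa using ha, by simpa using hb⟩
  · rintro ⟨rfl, rfl⟩
    ext i; fin_cases i <;> simp [toR4]

section HolomorphicCurve

variable {F G : ℂ → ℂ} {z : ℂ}

lemma hasFDerivAt_toR4 (hF : DifferentiableAt ℂ F z) (hG : DifferentiableAt ℂ G z) :
    HasFDerivAt (fun ζ => toR4 (F ζ) (G ζ))
      (toR4L.comp (((fderiv ℂ F z).restrictScalars ℝ).prod ((fderiv ℂ G z).restrictScalars ℝ))) z :=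
  toR4L.hasFDerivAt.comp z
    ((hF.hasFDerivAt.restrictScalars ℝ).prodMk (hG.hasFDerivAt.restrictScalars ℝ))

lemma fderiv_toR4 (hF : DifferentiableAt ℂ F z) (hG : DifferentiableAt ℂ G z) (v : ℂ) :
    fderiv ℝ (fun ζ => toR4 (F ζ) (G ζ)) z v = toR4 (deriv F z * v) (deriv G z * v) := by
  rw [(hasFDerivAt_toR4 hF hG).fderiv]
  have h : ∀ (H : ℂ → ℂ), fderiv ℂ H z v = deriv H z * v := fun H => by
    rw [clm_apply_eq_mul (fderiv ℂ H z) v, fderiv_apply_one_eq_deriv, mul_comm]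
  change toR4 (fderiv ℂ F z v) (fderiv ℂ G z v) = _
  rw [h, h]

lemma fderiv_fderiv_toR4 (hF : AnalyticAt ℂ F z) (hG : AnalyticAt ℂ G z) (v w : ℂ) :
    fderiv ℝ (fun ζ => fderiv ℝ (fun ζ => toR4 (F ζ) (G ζ)) ζ v) z w =
      toR4 (deriv (deriv F) z * v * w) (deriv (deriv G) z * v * w) := by
  have h : (fun ζ => fderiv ℝ (fun ζ => toR4 (F ζ) (G ζ)) ζ v) =ᶠ[𝓝 z]
      fun ζ => toR4 (deriv F ζ * v) (deriv G ζ * v) := by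
    filter_upwards [hF.eventually_analyticAt, hG.eventually_analyticAt] with ζ h1 h2
    exact fderiv_toR4 h1.differentiableAt h2.differentiableAt v
  have h1 := hF.deriv.differentiableAt
  have h2 := hG.deriv.differentiableAt
  rw [h.fderiv_eq, fderiv_toR4 (h1.mul_const v) (h2.mul_const v), deriv_mul_const h1,
    deriv_mul_const h2]

/-- The conformal factor `|F'|² + |G'|²`. -/
def confFactor (F G : ℂ → ℂ) (z : ℂ) : ℝ := ‖deriv F z‖ ^ 2 + ‖deriv G z‖ ^ 2

lemma confFactor_pos (h : deriv F z ≠ 0 ∨ deriv G z ≠ 0) : 0 < confFactor F G z := by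
  unfold confFactor
  rcases h with h | h
  · have := norm_pos_iff.2 h; positivity
  · have := norm_pos_iff.2 h; positivity

lemma firstForm_toR4 (hF : DifferentiableAt ℂ F z) (hG : DifferentiableAt ℂ G z) (v w : ℂ) :
    firstForm (fun ζ => toR4 (F ζ) (G ζ)) z v w =
      confFactor F G z * (v.re * w.re + v.im * w.im) := by
  rw [firstForm, fderiv_toR4 hF hG, fderiv_toR4 hF hG, inner_toR4, confFactor, Complex.sq_norm,
    Complex.sq_norm, Complex.normSq_apply, Complex.normSq_apply]
  simp only [Complex.mul_re, Complex.mul_im]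
  ring

lemma metricDet_toR4 (hF : DifferentiableAt ℂ F z) (hG : DifferentiableAt ℂ G z) :
    metricDet (fun ζ => toR4 (F ζ) (G ζ)) z = confFactor F G z ^ 2 := by
  rw [metricDet, firstForm_toR4 hF hG, firstForm_toR4 hF hG, firstForm_toR4 hF hG]
  simp
  ring

lemma injective_fderiv_toR4 (hF : DifferentiableAt ℂ F z) (hG : DifferentiableAt ℂ G z)
    (h : deriv F z ≠ 0 ∨ deriv G z ≠ 0) :
    Function.Injective (fderiv ℝ (fun ζ => toR4 (F ζ) (G ζ)) z) := by
  refine (injective_iff_map_eq_zero _).2 fun v hv => ?_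
  rw [fderiv_toR4 hF hG, toR4_eq_zero] at hv
  rcases h with h | h
  · exact (mul_eq_zero.1 hv.1).resolve_left h
  · exact (mul_eq_zero.1 hv.2).resolve_left h

lemma meanCurvature_toR4 (hF : AnalyticAt ℂ F z) (hG : AnalyticAt ℂ G z) :
    meanCurvature (fun ζ => toR4 (F ζ) (G ζ)) z = 0 := by
  have h1 := hF.differentiableAt
  have h2 := hG.differentiableAt
  have h3 : secondForm (fun ζ => toR4 (F ζ) (G ζ)) z Complex.I Complex.I =
      -secondForm (fun ζ => toR4 (F ζ) (G ζ)) z 1 1 := by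
    rw [secondForm, secondForm, fderiv_fderiv_toR4 hF hG, fderiv_fderiv_toR4 hF hG, ← map_neg,
      ← toR4_neg]
    simp [mul_assoc]
  rw [meanCurvature, h3, firstForm_toR4 h1 h2, firstForm_toR4 h1 h2, firstForm_toR4 h1 h2]
  simp

/-- The tangent plane of a holomorphic curve is a complex line. -/
lemma toR4_mem_tangentPlane (hF : DifferentiableAt ℂ F z) (hG : DifferentiableAt ℂ G z) (c : ℂ) :
    toR4 (c * deriv F z) (c * deriv G z) ∈ tangentPlane (fun ζ => toR4 (F ζ) (G ζ)) z := by
  rw [tangentPlane, Submodule.mem_span_pair]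
  refine ⟨c.re, c.im, ?_⟩
  rw [fderiv_toR4 hF hG, fderiv_toR4 hF hG, ← toR4_smul, ← toR4_smul, ← toR4_add]
  congr 1
  · conv_rhs => rw [← Complex.re_add_im c]
    ring
  · conv_rhs => rw [← Complex.re_add_im c]
    ring

/-- The squared Fubini–Study speed of the holomorphic curve `[P : Q]` in the projective line. -/
def speedSq (P Q : ℂ → ℂ) (z : ℂ) : ℝ :=
  ‖P z * deriv Q z - deriv P z * Q z‖ ^ 2 / (‖P z‖ ^ 2 + ‖Q z‖ ^ 2) ^ 2

/-- The second derivative `(F'', G'')` minus its projection to the complex line of `(F', G')` has norm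
squared `|F' G'' - F'' G'|² / (|F'|² + |G'|²)`. -/
lemma norm_sq_secondForm_le (hF : AnalyticAt ℂ F z) (hG : AnalyticAt ℂ G z)
    (h : deriv F z ≠ 0 ∨ deriv G z ≠ 0) {v w : ℂ} (hv : ‖v‖ = 1) (hw : ‖w‖ = 1) :
    ‖secondForm (fun ζ => toR4 (F ζ) (G ζ)) z v w‖ ^ 2 ≤
      speedSq (deriv F) (deriv G) z * confFactor F G z := by
  have hρ := confFactor_pos h
  set ρ := confFactor F G z with hρdef
  set f1 := deriv F z with hf1
  set g1 := deriv G z with hg1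
  set f2 := deriv (deriv F) z with hf2
  set g2 := deriv (deriv G) z with hg2
  have hρc : (ρ : ℂ) = f1 * starRingEnd ℂ f1 + g1 * starRingEnd ℂ g1 := by
    rw [Complex.mul_conj', Complex.mul_conj', hρdef, confFactor]
    push_cast; rfl
  have hρ0 : (ρ : ℂ) ≠ 0 := by exact_mod_cast hρ.ne'
  -- the orthogonal projection of `(f2, g2)` to the complex line spanned by `(f1, g1)`
  set c : ℂ := (f2 * starRingEnd ℂ f1 + g2 * starRingEnd ℂ g1) / ρ with hc
  have e1 : f2 - c * f1 = starRingEnd ℂ g1 * (f2 * g1 - g2 * f1) / ρ := by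
    rw [hc]; field_simp; rw [hρc]; ring
  have e2 : g2 - c * g1 = -(starRingEnd ℂ f1 * (f2 * g1 - g2 * f1) / ρ) := by
    rw [hc]; field_simp; rw [hρc]; ring
  have hsplit : toR4 (f2 * v * w) (g2 * v * w) =
      toR4 ((f2 - c * f1) * (v * w)) ((g2 - c * g1) * (v * w)) +
        toR4 ((c * v * w) * f1) ((c * v * w) * g1) := by
    rw [← toR4_add]; congr 1 <;> ring
  have hzero : (tangentPlane (fun ζ => toR4 (F ζ) (G ζ)) z)ᗮ.starProjection
      (toR4 ((c * v * w) * f1) ((c * v * w) * g1)) = 0 := by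
    rw [Submodule.starProjection_apply_eq_zero_iff]
    exact Submodule.le_orthogonal_orthogonal _
      (toR4_mem_tangentPlane hF.differentiableAt hG.differentiableAt _)
  have hle : ‖secondForm (fun ζ => toR4 (F ζ) (G ζ)) z v w‖ ≤
      ‖toR4 ((f2 - c * f1) * (v * w)) ((g2 - c * g1) * (v * w))‖ := by
    rw [secondForm, fderiv_fderiv_toR4 hF hG, hsplit, map_add, hzero, add_zero]
    exact Submodule.norm_starProjection_apply_le _ _
  refine (pow_le_pow_left₀ (norm_nonneg _) hle 2).trans (le_of_eq ?_)
  have hvw : ‖v * w‖ = 1 := by rw [norm_mul, hv, hw, one_mul]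
  rw [norm_sq_toR4, norm_mul _ (v * w), norm_mul _ (v * w), hvw, mul_one, mul_one, e1, e2, norm_neg, norm_div, norm_div,
    norm_mul, norm_mul, Complex.norm_conj, Complex.norm_conj, Complex.norm_real, Real.norm_eq_abs,
    abs_of_pos hρ, speedSq]
  have hρ2 : ‖deriv F z‖ ^ 2 + ‖deriv G z‖ ^ 2 = ρ := rfl
  rw [hρ2, ← hf1, ← hg1, ← hf2, ← hg2, show f1 * g2 - f2 * g1 = -(f2 * g1 - g2 * f1) by ring, norm_neg]
  have hρ3 : ‖f1‖ ^ 2 + ‖g1‖ ^ 2 = ρ := rfl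
  field_simp
  rw [← hρ3]
  ring

/-- The curvature density of a holomorphic curve is at most twice the area density of its Gauss map
(in fact it is equal to it). -/
lemma curvature_density_le (hF : AnalyticAt ℂ F z) (hG : AnalyticAt ℂ G z)
    (h : deriv F z ≠ 0 ∨ deriv G z ≠ 0) :
    |gaussCurvature (fun ζ => toR4 (F ζ) (G ζ)) z| * √(metricDet (fun ζ => toR4 (F ζ) (G ζ)) z) ≤
      2 * speedSq (deriv F) (deriv G) z := by
  have hρ := confFactor_pos h
  have h3 : secondForm (fun ζ => toR4 (F ζ) (G ζ)) z Complex.I Complex.I =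
      -secondForm (fun ζ => toR4 (F ζ) (G ζ)) z 1 1 := by
    rw [secondForm, secondForm, fderiv_fderiv_toR4 hF hG, fderiv_fderiv_toR4 hF hG, ← map_neg,
      ← toR4_neg]
    simp [mul_assoc]
  have hA := norm_sq_secondForm_le hF hG h (v := 1) (w := 1) (by simp) (by simp)
  have hB := norm_sq_secondForm_le hF hG h (v := 1) (w := Complex.I) (by simp) (by simp)
  rw [gaussCurvature, metricDet_toR4 hF.differentiableAt hG.differentiableAt, h3, inner_neg_right,
    real_inner_self_eq_norm_sq, Real.sqrt_sq hρ.le, ← neg_add', abs_div, abs_neg,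
    abs_of_nonneg (by positivity), abs_of_pos (by positivity), pow_two (confFactor F G z),
    div_mul_eq_mul_div, mul_div_mul_right _ _ hρ.ne', div_le_iff₀ hρ]
  linarith

end HolomorphicCurve

/-! ### Local boundedness of the curvature density -/

section SpeedBound

variable {P Q : ℂ → ℂ} {z z₀ : ℂ}

lemma speedSq_bounded (hP : AnalyticAt ℂ P z₀) (hQ : AnalyticAt ℂ Q z₀) (h : P z₀ ≠ 0 ∨ Q z₀ ≠ 0) :
    ∃ C, ∀ᶠ z in 𝓝 z₀, speedSq P Q z ≤ C := by
  have hpos : (‖P z₀‖ ^ 2 + ‖Q z₀‖ ^ 2) ^ 2 ≠ 0 := by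
    rcases h with h | h
    · have := norm_pos_iff.2 h; positivity
    · have := norm_pos_iff.2 h; positivity
  have hc : ContinuousAt (speedSq P Q) z₀ := by
    have h1 := hP.continuousAt
    have h2 := hQ.continuousAt
    have h3 := hP.deriv.continuousAt
    have h4 := hQ.deriv.continuousAt
    exact (((h1.mul h4).sub (h3.mul h2)).norm.pow 2).div (((h1.norm.pow 2).add (h2.norm.pow 2)).pow 2)
      hpos
  exact ⟨_, hc.eventually_le_const (lt_add_one _)⟩

/-- The speed depends only on the ratio `[P : Q]`. -/
lemma speedSq_scale {μ p q : ℂ → ℂ} (hμ : DifferentiableAt ℂ μ z) (hp : DifferentiableAt ℂ p z)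
    (hq : DifferentiableAt ℂ q z) (h0 : μ z ≠ 0) (hP : P =ᶠ[𝓝 z] fun ζ => μ ζ * p ζ)
    (hQ : Q =ᶠ[𝓝 z] fun ζ => μ ζ * q ζ) : speedSq P Q z = speedSq p q z := by
  have e1 := hP.deriv_eq.trans (deriv_fun_mul hμ hp)
  have e2 := hQ.deriv_eq.trans (deriv_fun_mul hμ hq)
  have e3 := hP.self_of_nhds
  have e4 := hQ.self_of_nhds
  have hn : ‖μ z‖ ≠ 0 := norm_ne_zero_iff.2 h0
  rw [speedSq, speedSq, e1, e2, e3, e4]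
  have : μ z * p z * (deriv μ z * q z + μ z * deriv q z) -
      (deriv μ z * p z + μ z * deriv p z) * (μ z * q z) =
      μ z ^ 2 * (p z * deriv q z - deriv p z * q z) := by ring
  rw [this, norm_mul, norm_mul, norm_mul, norm_pow]
  have h5 : (‖μ z‖ * ‖p z‖) ^ 2 + (‖μ z‖ * ‖q z‖) ^ 2 = ‖μ z‖ ^ 2 * (‖p z‖ ^ 2 + ‖q z‖ ^ 2) := by ring
  rw [h5, mul_pow, mul_pow, mul_div_mul_left _ _ (by positivity)]

/-- At a simple pole of the curve the Gauss map extends holomorphically, so that the curvature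
density stays bounded. -/
lemma speedSq_bounded_pole {F G f₁ g₁ : ℂ → ℂ} (hf : AnalyticAt ℂ f₁ z₀) (hg : AnalyticAt ℂ g₁ z₀)
    (h : f₁ z₀ ≠ 0 ∨ g₁ z₀ ≠ 0) (hF : ∀ᶠ z in 𝓝[≠] z₀, F z = f₁ z / (z - z₀))
    (hG : ∀ᶠ z in 𝓝[≠] z₀, G z = g₁ z / (z - z₀)) :
    ∃ C, ∀ᶠ z in 𝓝[≠] z₀, speedSq (deriv F) (deriv G) z ≤ C := by
  have key : ∀ {H h₁ : ℂ → ℂ}, AnalyticAt ℂ h₁ z₀ → (∀ᶠ z in 𝓝[≠] z₀, H z = h₁ z / (z - z₀)) →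
      ∀ᶠ z in 𝓝[≠] z₀, deriv H z = ((z - z₀) ^ 2)⁻¹ * (deriv h₁ z * (z - z₀) - h₁ z) := by
    intro H h₁ hh hH
    have h2 := eventually_eventually_nhdsWithin.2 hH
    filter_upwards [h2, self_mem_nhdsWithin,
      eventually_nhdsWithin_of_eventually_nhds hh.eventually_analyticAt] with z h3 h4 h5
    have h6 : H =ᶠ[𝓝 z] fun z => h₁ z / (z - z₀) := by
      rw [nhdsWithin_eq_nhds.2 (isOpen_compl_singleton.mem_nhds h4)] at h3
      exact h3
    have hz : z - z₀ ≠ 0 := sub_ne_zero.2 h4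
    have hd : HasDerivAt (fun z => h₁ z / (z - z₀))
        ((deriv h₁ z * (z - z₀) - h₁ z * 1) / (z - z₀) ^ 2) z :=
      h5.differentiableAt.hasDerivAt.div ((hasDerivAt_id z).sub_const z₀) hz
    rw [h6.deriv_eq, hd.deriv]
    field_simp
  have anal : ∀ {h₁ : ℂ → ℂ}, AnalyticAt ℂ h₁ z₀ →
      AnalyticAt ℂ (fun z => deriv h₁ z * (z - z₀) - h₁ z) z₀ := fun hh =>
    (hh.deriv.mul (analyticAt_id.sub analyticAt_const)).sub hh
  obtain ⟨C, hC⟩ := speedSq_bounded (anal hf) (anal hg) (by simpa using h)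
  refine ⟨C, ?_⟩
  filter_upwards [eventually_eventually_nhdsWithin.2 (key hf hF),
    eventually_eventually_nhdsWithin.2 (key hg hG), self_mem_nhdsWithin,
    eventually_nhdsWithin_of_eventually_nhds hC,
    eventually_nhdsWithin_of_eventually_nhds (anal hf).eventually_analyticAt,
    eventually_nhdsWithin_of_eventually_nhds (anal hg).eventually_analyticAt]
    with z h1 h2 h3 h4 h5 h6
  rw [nhdsWithin_eq_nhds.2 (isOpen_compl_singleton.mem_nhds h3)] at h1 h2
  have hz : z - z₀ ≠ 0 := sub_ne_zero.2 h3
  rw [speedSq_scale (μ := fun z => ((z - z₀) ^ 2)⁻¹) ?_ h5.differentiableAt h6.differentiableAt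
    (inv_ne_zero (pow_ne_zero 2 hz)) h1 h2]
  · exact h4
  · exact DifferentiableAt.inv (by fun_prop) (pow_ne_zero 2 hz)

end SpeedBound

/-! ### Finite total curvature -/

namespace BranchData

variable {g : ℕ} {D : BranchData g}

open MeasureTheory in
/-- If the curvature density is locally bounded in all coordinate charts, the total curvature is
finite, because the atlas is finite and its charts have images with compact closure. -/
lemma totalAbsCurvature_lt_top {X : D.Surface → R4} {U : Set D.Surface}
    (h : ∀ E : OpenPartialHomeomorph D.Surface ℂ, IsCoordChart E → ∀ z ∈ E.target, ∃ C : ℝ,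
      ∀ᶠ ζ in 𝓝 z, E.symm ζ ∈ U →
        |gaussCurvature (X ∘ E.symm) ζ| * √(metricDet (X ∘ E.symm) ζ) ≤ C) :
    totalAbsCurvature X U < ⊤ := by
  classical
  have hbd : ∀ e ∈ atlas ℂ D.Surface, ∃ C : ℝ, ∀ z ∈ e.target, e.symm z ∈ U →
      |gaussCurvature (X ∘ e.symm) z| * √(metricDet (X ∘ e.symm) z) ≤ C := by
    intro e he
    obtain ⟨E, K, hE, hK, heK, hKE, heE⟩ := (isSmallChart_of_mem_atlas he).exists_large
    rw [heE]
    suffices h' : ∃ C : ℝ, ∀ z ∈ K, E.symm z ∈ U →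
        |gaussCurvature (X ∘ E.symm) z| * √(metricDet (X ∘ E.symm) z) ≤ C from
      h'.imp fun C hC z hz => hC z (heK hz)
    refine hK.induction_on (p := fun s => ∃ C : ℝ, ∀ z ∈ s, E.symm z ∈ U →
        |gaussCurvature (X ∘ E.symm) z| * √(metricDet (X ∘ E.symm) z) ≤ C) ?_ ?_ ?_ ?_
    · exact ⟨0, by simp⟩
    · rintro s t hst ⟨C, hC⟩
      exact ⟨C, fun z hz => hC z (hst hz)⟩
    · rintro s t ⟨C, hC⟩ ⟨C', hC'⟩
      refine ⟨max C C', fun z hz hU => ?_⟩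
      rcases hz with hz | hz
      · exact (hC z hz hU).trans (le_max_left _ _)
      · exact (hC' z hz hU).trans (le_max_right _ _)
    · intro z hz
      obtain ⟨C, hC⟩ := h E hE z (hKE hz)
      exact ⟨_, mem_nhdsWithin_of_mem_nhds hC, C, fun z hz => hz⟩
  choose! C hC using hbd
  set 𝒜 : Finset (OpenPartialHomeomorph D.Surface ℂ) := finite_atlas.toFinset with h𝒜
  have hmem : ∀ e, e ∈ 𝒜 ↔ e ∈ atlas ℂ D.Surface := fun e => by simp [h𝒜]
  have hvol : ∀ e ∈ 𝒜, volume e.target < ⊤ := by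
    intro e he
    obtain ⟨E, K, -, hK, heK, -, -⟩ := (isSmallChart_of_mem_atlas ((hmem e).1 he)).exists_large
    exact (measure_mono heK).trans_lt hK.measure_lt_top
  have hfin : ∑ e ∈ 𝒜, ENNReal.ofReal (C e) * volume e.target < ⊤ :=
    ENNReal.sum_lt_top.2 fun e he => ENNReal.mul_lt_top ENNReal.ofReal_lt_top (hvol e he)
  refine lt_of_le_of_lt ?_ hfin
  refine iSup_le fun n => iSup_le fun e => iSup_le fun A => iSup_le fun h1 => iSup_le fun h2 => ?_
  have hle : ∀ i, ∫⁻ z in e i '' A i, ENNReal.ofReal (|gaussCurvature (X ∘ (e i).symm) z| *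
      √(metricDet (X ∘ (e i).symm) z)) ≤ ENNReal.ofReal (C (e i)) * volume (e i '' A i) := by
    intro i
    rw [← setLIntegral_const]
    refine setLIntegral_mono' (h1 i).2.2 ?_
    rintro _ ⟨q, hq, rfl⟩
    have hq' := (h1 i).2.1 hq
    exact ENNReal.ofReal_le_ofReal (hC (e i) (h1 i).1 _ ((e i).map_source hq'.1)
      (by rw [(e i).left_inv hq'.1]; exact hq'.2))
  refine (Finset.sum_le_sum fun i _ => hle i).trans ?_
  rw [← Finset.sum_fiberwise_of_maps_to (s := Finset.univ) (t := 𝒜) (g := e)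
    (fun i _ => (hmem _).2 (h1 i).1)]
  refine Finset.sum_le_sum fun E hE => ?_
  have h3 : ∑ i ∈ Finset.univ.filter (fun i => e i = E),
      ENNReal.ofReal (C (e i)) * volume (e i '' A i) =
      ENNReal.ofReal (C E) * ∑ i ∈ Finset.univ.filter (fun i => e i = E), volume (E '' A i) := by
    rw [Finset.mul_sum]
    refine Finset.sum_congr rfl fun i hi => ?_
    rw [(Finset.mem_filter.1 hi).2]
  rw [h3, ← measure_biUnion_finset]
  · refine mul_le_mul_right (measure_mono ?_) _
    refine iUnion₂_subset fun i hi => ?_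
    rintro _ ⟨q, hq, rfl⟩
    have := ((h1 i).2.1 hq).1
    rw [(Finset.mem_filter.1 hi).2] at this
    exact E.map_source this
  · intro i hi j hj hij
    have hi' := (Finset.mem_filter.1 hi).2
    have hj' := (Finset.mem_filter.1 hj).2
    refine Set.disjoint_left.2 ?_
    rintro _ ⟨q, hq, rfl⟩ ⟨q', hq', hqq⟩
    have s1 := ((h1 i).2.1 hq).1
    have s2 := ((h1 j).2.1 hq').1
    rw [hi'] at s1
    rw [hj'] at s2
    have := E.injOn s2 s1 hqq
    subst this
    exact Set.disjoint_left.1 (h2 hij) hq hq'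
  · intro i hi
    have := (h1 i).2.2
    rwa [(Finset.mem_filter.1 hi).2] at this

end BranchData

/-! ### Planar ends -/

lemma exists_local_inverse {f : ℂ → ℂ} {z₀ : ℂ} (hf : AnalyticAt ℂ f z₀) (hf' : deriv f z₀ ≠ 0) :
    ∃ σ : OpenPartialHomeomorph ℂ ℂ, z₀ ∈ σ.source ∧ (∀ z, σ z = f z) ∧
      AnalyticAt ℂ σ.symm (f z₀) := by
  have hfd := hf.hasStrictDerivAt.hasStrictFDerivAt_equiv hf'
  refine ⟨hfd.toOpenPartialHomeomorph f, hfd.mem_toOpenPartialHomeomorph_source, fun _ => rfl, ?_⟩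
  exact (hfd.toOpenPartialHomeomorph f).analyticAt_symm'
    (i := ContinuousLinearEquiv.unitsEquivAut ℂ (Units.mk0 _ hf'))
    hfd.mem_toOpenPartialHomeomorph_source hf hfd.hasFDerivAt.fderiv

section NormalForm

variable (a b : ℂ)

/-- The complex line spanned by `(a, b)` as a real linear map from `ℂ`. -/
def lineMap : ℂ →ₗ[ℝ] R4 where
  toFun ζ := toR4 (a * ζ) (b * ζ)
  map_add' ζ ξ := by rw [mul_add, mul_add, toR4_add]
  map_smul' t ζ := by
    rw [RingHom.id_apply, ← toR4_smul]; congr 1 <;> simp <;> ring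

/-- The orthogonal complex line, spanned by `(-conj b, conj a)`. -/
def perpMap : ℂ →ₗ[ℝ] R4 := lineMap (-(starRingEnd ℂ b)) (starRingEnd ℂ a)

lemma lineMap_apply (ζ : ℂ) : lineMap a b ζ = toR4 (a * ζ) (b * ζ) := rfl

variable {a b}

lemma norm_lineMap (ζ : ℂ) : ‖lineMap a b ζ‖ = √(‖a‖ ^ 2 + ‖b‖ ^ 2) * ‖ζ‖ := by
  rw [← Real.sqrt_sq (norm_nonneg (lineMap a b ζ)), lineMap_apply, norm_sq_toR4, norm_mul, norm_mul,
    mul_pow, mul_pow, ← add_mul, Real.sqrt_mul (by positivity), Real.sqrt_sq (norm_nonneg ζ)]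

lemma inner_lineMap_perpMap (ζ η : ℂ) : inner ℝ (lineMap a b ζ) (perpMap a b η) = 0 := by
  rw [perpMap, lineMap_apply, lineMap_apply, inner_toR4]
  simp only [Complex.mul_re, Complex.mul_im, Complex.neg_re, Complex.neg_im, Complex.conj_re,
    Complex.conj_im]
  ring

lemma sqrt_pos_of_ne (h : a ≠ 0 ∨ b ≠ 0) : 0 < √(‖a‖ ^ 2 + ‖b‖ ^ 2) := by
  refine Real.sqrt_pos.2 ?_
  rcases h with h | h
  · have := norm_pos_iff.2 h; positivity
  · have := norm_pos_iff.2 h; positivity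

lemma injective_lineMap (h : a ≠ 0 ∨ b ≠ 0) : Function.Injective (lineMap a b) := by
  refine (injective_iff_map_eq_zero _).2 fun ζ hζ => ?_
  have h1 := norm_lineMap (a := a) (b := b) ζ
  rw [hζ, norm_zero, eq_comm, mul_eq_zero] at h1
  exact norm_eq_zero.1 (h1.resolve_left (sqrt_pos_of_ne h).ne')

lemma perpMap_mem (η : ℂ) : perpMap a b η ∈ (LinearMap.range (lineMap a b))ᗮ := by
  rw [Submodule.mem_orthogonal]
  rintro _ ⟨ζ, rfl⟩
  exact inner_lineMap_perpMap ζ η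

/-- The distance to the origin is at least the norm of the component along the line. -/
lemma norm_lineMap_le (ζ η : ℂ) : ‖lineMap a b ζ‖ ≤ ‖lineMap a b ζ + perpMap a b η‖ := by
  have := norm_add_sq_eq_norm_sq_add_norm_sq_of_inner_eq_zero (lineMap a b ζ) (perpMap a b η)
    (inner_lineMap_perpMap ζ η)
  exact abs_le_of_sq_le_sq' (by nlinarith [norm_nonneg (perpMap a b η)]) (norm_nonneg _) |>.2

lemma lineMap_add_perpMap_inj (h : a ≠ 0 ∨ b ≠ 0) {ζ ζ' η η' : ℂ}
    (he : lineMap a b ζ + perpMap a b η = lineMap a b ζ' + perpMap a b η') : ζ = ζ' := by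
  have h1 : lineMap a b (ζ - ζ') + perpMap a b (η - η') = 0 := by
    rw [map_sub, map_sub, sub_add_sub_comm, he, sub_self]
  have h2 := norm_lineMap_le (a := a) (b := b) (ζ - ζ') (η - η')
  rw [h1, norm_zero] at h2
  have h3 : lineMap a b (ζ - ζ') = 0 := norm_eq_zero.1 (le_antisymm h2 (norm_nonneg _))
  exact sub_eq_zero.1 (injective_lineMap h (h3.trans (map_zero _).symm))

/-- Decomposition of a vector of `ℂ²` along the line of `(a, b)` and its orthogonal complement. -/
lemma toR4_eq_lineMap_add (h : a ≠ 0 ∨ b ≠ 0) (u v : ℂ) :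
    toR4 u v = lineMap a b ((starRingEnd ℂ a * u + starRingEnd ℂ b * v) /
        (a * starRingEnd ℂ a + b * starRingEnd ℂ b)) +
      perpMap a b ((a * v - b * u) / (a * starRingEnd ℂ a + b * starRingEnd ℂ b)) := by
  have hN : a * starRingEnd ℂ a + b * starRingEnd ℂ b ≠ 0 := by
    rw [Complex.mul_conj', Complex.mul_conj']
    have := sqrt_pos_of_ne h
    have h2 : ‖a‖ ^ 2 + ‖b‖ ^ 2 ≠ 0 := (Real.sqrt_pos.1 this).ne'
    exact_mod_cast h2
  rw [perpMap, lineMap_apply, lineMap_apply, ← toR4_add]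
  congr 1 <;> rw [mul_div_assoc', mul_div_assoc', ← add_div, eq_div_iff hN] <;> ring

end NormalForm

namespace BranchData

variable {g : ℕ} {D : BranchData g} {p : D.Surface}

/-- A surface which is `s ↦ (a, b) / s + η(s) (-conj b, conj a)` in a coordinate `s` has an embedded
planar end at `s = 0`. -/
lemma hasEmbeddedPlanarEnd_of_normalForm {X : D.Surface → R4} {P : Set D.Surface}
    {E : OpenPartialHomeomorph D.Surface ℂ} {ε : ℝ} (hε : 0 < ε) (hE : Metric.ball 0 ε ⊆ E.target)
    (hp : E.symm 0 = p) {a b : ℂ} (hab : a ≠ 0 ∨ b ≠ 0) {η : ℂ → ℂ}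
    (hη : DifferentiableOn ℂ η (Metric.ball 0 ε))
    (hP : ∀ s ∈ Metric.ball (0 : ℂ) ε, s ≠ 0 → E.symm s ∉ P)
    (hX : ∀ s ∈ Metric.ball (0 : ℂ) ε, s ≠ 0 →
      X (E.symm s) = lineMap a b s⁻¹ + perpMap a b (η s)) :
    HasEmbeddedPlanarEnd X P p := by
  have hN0 := sqrt_pos_of_ne hab
  set N₀ := √(‖a‖ ^ 2 + ‖b‖ ^ 2) with hN₀
  have h0 : (0 : ℂ) ∈ Metric.ball (0 : ℂ) ε := Metric.mem_ball_self hε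
  have hp0 : E.symm 0 = p := hp
  have hηc : ContinuousAt η 0 :=
    (hη.differentiableAt (Metric.ball_mem_nhds _ hε)).continuousAt
  constructor
  · rw [← hp, ← map_symm_nhdsNE (hE h0), tendsto_map'_iff, ← tendsto_norm_atTop_iff_cobounded]
    have h1 : Tendsto (fun s : ℂ => N₀ * ‖s⁻¹‖) (𝓝[≠] 0) atTop :=
      (tendsto_norm_cobounded_atTop.comp Filter.tendsto_inv₀_nhdsNE_zero).const_mul_atTop hN0
    refine tendsto_atTop_mono' _ ?_ h1
    filter_upwards [self_mem_nhdsWithin,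
      mem_nhdsWithin_of_mem_nhds (Metric.ball_mem_nhds (0 : ℂ) hε)] with s hs hsb
    rw [Function.comp_apply, hX s hsb hs, ← norm_lineMap]
    exact norm_lineMap_le _ _
  -- parametrization of the punctured neighbourhood
  set N : Set D.Surface := E.source ∩ E ⁻¹' Metric.ball 0 ε with hN
  have hsymm : ∀ s ∈ Metric.ball (0 : ℂ) ε, E.symm s ∈ N := fun s hs =>
    ⟨E.map_target (hE hs), by rwa [mem_preimage, E.right_inv (hE hs)]⟩
  have hpar : ∀ q ∈ N \ {p}, ∃ s ∈ Metric.ball (0 : ℂ) ε, s ≠ 0 ∧ E.symm s = q := by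
    rintro q ⟨⟨hq1, hq2⟩, hq3⟩
    refine ⟨E q, hq2, fun h => hq3 ?_, E.left_inv hq1⟩
    rw [mem_singleton_iff, ← hp, ← h, E.left_inv hq1]
  have hpar' : ∀ s ∈ Metric.ball (0 : ℂ) ε, s ≠ 0 → E.symm s ∈ N \ {p} := by
    refine fun s hs h => ⟨hsymm s hs, fun h' => h ?_⟩
    rw [mem_singleton_iff, ← hp] at h'
    exact E.symm.injOn (hE hs) (hE h0) h'
  refine ⟨N, E.continuousOn_toFun.isOpen_inter_preimage E.open_source Metric.isOpen_ball,
    hp ▸ hsymm 0 h0, ?_, ?_, ?_⟩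
  · intro q hq
    obtain ⟨s, hs, hs0, rfl⟩ := hpar q hq
    exact hP s hs hs0
  · intro q hq q' hq' hqq
    obtain ⟨s, hs, hs0, rfl⟩ := hpar q hq
    obtain ⟨t, ht, ht0, rfl⟩ := hpar q' hq'
    rw [hX s hs hs0, hX t ht ht0] at hqq
    rw [inv_injective (lineMap_add_perpMap_inj hab hqq)]
  set V := LinearMap.range (lineMap a b) with hV
  set ι : ℂ ≃ₗ[ℝ] V := LinearEquiv.ofInjective (lineMap a b) (injective_lineMap hab) with hι
  have hιv : ∀ ζ, ((ι ζ : V) : R4) = lineMap a b ζ := fun ζ => rfl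
  have hιn : ∀ q : V, ‖q‖ = N₀ * ‖ι.symm q‖ := fun q => by
    rw [← norm_lineMap, ← hιv, LinearEquiv.apply_symm_apply]; rfl
  set M : ℂ →L[ℝ] Vᗮ := LinearMap.toContinuousLinearMap
    ((perpMap a b).codRestrict Vᗮ perpMap_mem) with hM
  have hMv : ∀ ζ, ((M ζ : Vᗮ) : R4) = perpMap a b ζ := fun ζ => rfl
  set T : V →L[ℝ] ℂ := LinearMap.toContinuousLinearMap (ι.symm : V →ₗ[ℝ] ℂ) with hT
  have hTι : ∀ q, T q = ι.symm q := fun q => rfl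
  have hball : ∀ q : V, N₀ / ε < ‖q‖ → (T q)⁻¹ ∈ Metric.ball (0 : ℂ) ε ∧ T q ≠ 0 := by
    intro q hq
    rw [hιn, div_lt_iff₀ hε, mul_assoc] at hq
    have h1 : 1 < ‖ι.symm q‖ * ε := by
      by_contra! h
      nlinarith
    have h2 : 0 < ‖ι.symm q‖ := by
      by_contra! h
      nlinarith [norm_nonneg (ι.symm q)]
    refine ⟨?_, norm_pos_iff.1 h2⟩
    rw [mem_ball_zero_iff, norm_inv, hTι, inv_lt_iff_one_lt_mul₀ h2]
    linarith [mul_comm ‖ι.symm q‖ ε]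
  refine ⟨perpMap a b (η 0), V, fun q => M (η (T q)⁻¹ - η 0), N₀ / ε, ?_, by positivity, ?_, ?_, ?_⟩
  · rw [← ι.finrank_eq, Complex.finrank_real_complex]
  · refine M.contDiff.comp_contDiffOn (ContDiffOn.sub ?_ contDiffOn_const)
    have h1 : ContDiffOn ℝ ∞ η (Metric.ball 0 ε) :=
      (hη.contDiffOn Metric.isOpen_ball).restrict_scalars ℝ
    exact h1.comp (T.contDiff.contDiffOn.inv fun q hq => (hball q hq).2) fun q hq => (hball q hq).1
  · have h1 : Tendsto (fun q : V => (T q)⁻¹) (Bornology.cobounded V) (𝓝 0) := by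
      refine Filter.tendsto_inv₀_cobounded.comp (tendsto_norm_atTop_iff_cobounded.1 ?_)
      have h2 : (fun q : V => ‖T q‖) = fun q : V => N₀⁻¹ * ‖q‖ := by
        ext q; rw [hιn q, hTι]; field_simp
      rw [h2]
      exact tendsto_norm_cobounded_atTop.const_mul_atTop (by positivity)
    have h3 : Tendsto (fun q : V => η (T q)⁻¹ - η 0) (Bornology.cobounded V) (𝓝 0) := by
      have := (hηc.tendsto.comp h1).sub_const (η 0)
      rwa [sub_self] at this
    have h4 := (M.continuous.tendsto 0).comp h3
    rwa [map_zero] at h4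
  · ext y
    constructor
    · rintro ⟨q, hq, rfl⟩
      obtain ⟨s, hs, hs0, rfl⟩ := hpar q hq
      refine ⟨ι s⁻¹, ?_, ?_⟩
      · change N₀ / ε < ‖ι s⁻¹‖
        rw [hιn, LinearEquiv.symm_apply_apply, norm_inv, div_eq_mul_inv]
        have hs1 : ‖s‖ < ε := mem_ball_zero_iff.1 hs
        have hs2 := norm_pos_iff.2 hs0
        gcongr
      · change perpMap a b (η 0) + ((ι s⁻¹ : V) : R4) + ((M _ : Vᗮ) : R4) = _
        rw [hX s hs hs0, hMv, hιv, hTι, LinearEquiv.symm_apply_apply, inv_inv, map_sub]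
        abel
    · rintro ⟨q, hq, rfl⟩
      obtain ⟨h1, h2⟩ := hball q hq
      refine ⟨E.symm (T q)⁻¹, hpar' _ h1 (inv_ne_zero h2), ?_⟩
      change _ = perpMap a b (η 0) + (q : R4) + ((M _ : Vᗮ) : R4)
      rw [hX _ h1 (inv_ne_zero h2), hMv, map_sub, inv_inv, hTι, ← hιv, LinearEquiv.apply_symm_apply]
      abel

/-- A holomorphic curve with a simple pole has an embedded planar end there. A coordinate `s` in
which the component along the asymptotic line is exactly `1 / s` brings it to normal form. -/
lemma hasEmbeddedPlanarEnd_of_simplePole {X : D.Surface → R4} {P : Set D.Surface}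
    {e : OpenPartialHomeomorph D.Surface ℂ} {z₀ : ℂ} (hz : z₀ ∈ e.target) (hp : e.symm z₀ = p)
    {f g₁ : ℂ → ℂ} (hf : AnalyticAt ℂ f z₀) (hg : AnalyticAt ℂ g₁ z₀) (hne : f z₀ ≠ 0 ∨ g₁ z₀ ≠ 0)
    (hP : ∀ᶠ q in 𝓝[≠] p, q ∉ P)
    (hX : ∀ᶠ z in 𝓝[≠] z₀, X (e.symm z) = toR4 (f z / (z - z₀)) (g₁ z / (z - z₀))) :
    HasEmbeddedPlanarEnd X P p := by
  set a := f z₀ with ha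
  set b := g₁ z₀ with hb
  set n : ℂ := a * starRingEnd ℂ a + b * starRingEnd ℂ b with hn
  have hn0 : n ≠ 0 := by
    rw [hn, Complex.mul_conj', Complex.mul_conj']
    have h2 : ‖a‖ ^ 2 + ‖b‖ ^ 2 ≠ 0 := (Real.sqrt_pos.1 (sqrt_pos_of_ne hne)).ne'
    exact_mod_cast h2
  -- `κ / (z - z₀)` and `ν / (z - z₀)` are the components along the line of `(a, b)` and its complement
  set κ : ℂ → ℂ := fun z => (starRingEnd ℂ a * f z + starRingEnd ℂ b * g₁ z) / n with hκ
  have hκa : AnalyticAt ℂ κ z₀ :=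
    ((analyticAt_const.mul hf).add (analyticAt_const.mul hg)).div_const
  have hκ1 : κ z₀ = 1 := by
    simp only [hκ]
    rw [← ha, ← hb, div_eq_one_iff_eq hn0, hn]
    ring
  set ν : ℂ → ℂ := fun z => (a * g₁ z - b * f z) / n with hν
  have hνa : AnalyticAt ℂ ν z₀ :=
    ((analyticAt_const.mul hg).sub (analyticAt_const.mul hf)).div_const
  have hν0 : ν z₀ = 0 := by
    simp only [hν]
    rw [← ha, ← hb, mul_comm, sub_self, zero_div]
  have hda : AnalyticAt ℂ (dslope ν z₀) z₀ := by
    obtain ⟨r, hr⟩ := hνa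
    exact hr.has_fpower_series_dslope_fslope.analyticAt
  -- the component along the line of `(a, b)` is `κ z / (z - z₀)`, so `s` is its reciprocal
  set s : ℂ → ℂ := fun z => (z - z₀) / κ z with hs
  have hκ0 : κ z₀ ≠ 0 := by rw [hκ1]; exact one_ne_zero
  have hsa : AnalyticAt ℂ s z₀ := (analyticAt_id.sub analyticAt_const).div hκa hκ0
  have hs0 : s z₀ = 0 := by simp [hs]
  have hs' : deriv s z₀ ≠ 0 := by
    have h1 : HasDerivAt s ((1 * κ z₀ - (z₀ - z₀) * deriv κ z₀) / κ z₀ ^ 2) z₀ :=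
      ((hasDerivAt_id z₀).sub_const z₀).div hκa.differentiableAt.hasDerivAt hκ0
    rw [h1.deriv, hκ1]
    simp
  obtain ⟨σ, hσ, hσs, hσa⟩ := exists_local_inverse hsa hs'
  rw [hs0] at hσa
  have hσ0 : σ.symm 0 = z₀ := by rw [← hs0, ← hσs, σ.left_inv hσ]
  have h0t : (0 : ℂ) ∈ σ.target := by rw [← hs0, ← hσs]; exact σ.map_source hσ
  -- all conditions needed on the neighbourhood, in the coordinate `z`
  have hPz : ∀ᶠ z in 𝓝[≠] z₀, e.symm z ∉ P := by
    rw [← hp, ← map_symm_nhdsNE hz, eventually_map] at hP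
    exact hP
  have hall : ∀ᶠ z in 𝓝 z₀, (z ∈ e.target ∧ κ z ≠ 0 ∧ AnalyticAt ℂ (dslope ν z₀) z) ∧
      (z ≠ z₀ → e.symm z ∉ P ∧ X (e.symm z) = toR4 (f z / (z - z₀)) (g₁ z / (z - z₀))) :=
    ((e.open_target.eventually_mem hz).and ((hκa.continuousAt.eventually_ne hκ0).and
      hda.eventually_analyticAt)).and (eventually_nhdsWithin_iff.1 (hPz.and hX))
  have hcs : Tendsto σ.symm (𝓝 0) (𝓝 z₀) := by
    have := hσa.continuousAt.tendsto
    rwa [hσ0] at this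
  obtain ⟨ε, hε, hεs⟩ := Metric.mem_nhds_iff.1 (inter_mem (σ.open_target.mem_nhds h0t)
    ((hcs.eventually hall).and hσa.eventually_analyticAt))
  have hEt : Metric.ball 0 ε ⊆ (e ≫ₕ σ).target := by
    intro t ht
    rw [OpenPartialHomeomorph.trans_target]
    exact ⟨(hεs ht).1, (hεs ht).2.1.1.1⟩
  have hEs : ∀ t, (e ≫ₕ σ).symm t = e.symm (σ.symm t) := fun t => rfl
  have hne0 : ∀ t ∈ Metric.ball (0 : ℂ) ε, t ≠ 0 → σ.symm t ≠ z₀ := by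
    intro t ht ht0 h
    apply ht0
    rw [← σ.right_inv (hεs ht).1, h, hσs, hs0]
  refine hasEmbeddedPlanarEnd_of_normalForm (E := e ≫ₕ σ) hε hEt (by rw [hEs, hσ0, hp]) hne
    (η := fun t => dslope ν z₀ (σ.symm t)) ?_ ?_ ?_
  · intro t ht
    obtain ⟨-, ⟨⟨-, -, h1⟩, -⟩, h2⟩ := hεs ht
    exact (h1.comp h2).differentiableAt.differentiableWithinAt
  · intro t ht ht0
    exact ((hεs ht).2.1.2 (hne0 t ht ht0)).1
  · intro t ht ht0
    have hz0 := hne0 t ht ht0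
    obtain ⟨h1, ⟨⟨-, h2, -⟩, h3⟩, -⟩ := hεs ht
    rw [hEs, (h3 hz0).2, toR4_eq_lineMap_add hne]
    have hst : t = s (σ.symm t) := by rw [← hσs, σ.right_inv h1]
    have hsub : σ.symm t - z₀ ≠ 0 := sub_ne_zero.2 hz0
    congr 2
    · conv_rhs => rw [hst]
      simp only [hs, hκ, ← hn]
      rw [inv_div]
      field_simp
    · rw [dslope_of_ne _ hz0, slope_def_field, hν0, sub_zero]
      simp only [hν, ← hn]
      field_simp

/-! ### Smoothness, completeness and properness -/

lemma contMDiffAt_toR4 {F G : D.Surface → ℂ}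
    (hF : ∀ᶠ q in 𝓝 p, MDifferentiableAt 𝓘(ℂ) 𝓘(ℂ) F q)
    (hG : ∀ᶠ q in 𝓝 p, MDifferentiableAt 𝓘(ℂ) 𝓘(ℂ) G q) :
    ContMDiffAt 𝓘(ℝ, ℂ) 𝓘(ℝ, R4) ∞ (fun q => toR4 (F q) (G q)) p := by
  obtain ⟨e, he, hpe⟩ : ∃ e ∈ IsManifold.maximalAtlas 𝓘(ℂ) ω D.Surface, e = chartAt ℂ p :=
    ⟨_, mem_atlas_maximal (chart_mem_atlas ℂ p), rfl⟩
  have hps : p ∈ e.source := hpe ▸ mem_chart_source ℂ p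
  have hz := e.map_source hps
  rw [contMDiffAt_iff]
  constructor
  · exact toR4L.continuous.continuousAt.comp
      (hF.self_of_nhds.continuousAt.prodMk hG.self_of_nhds.continuousAt)
  · have h1 := analyticAt_chart (f := F) he hz (by rwa [e.left_inv hps])
    have h2 := analyticAt_chart (f := G) he hz (by rwa [e.left_inv hps])
    have h3 : ContDiffAt ℝ ∞ (fun ζ => toR4L (F (e.symm ζ), G (e.symm ζ))) (e p) :=
      toR4L.contDiff.contDiffAt.comp (e p)
        ((h1.contDiffAt.restrict_scalars ℝ).prodMk (h2.contDiffAt.restrict_scalars ℝ))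
    subst hpe
    exact h3.contDiffWithinAt

variable {X : D.Surface → R4} {P : Set D.Surface}

/-- If `X` tends to infinity at the punctures, its sublevel sets are compact. -/
lemma isCompact_sublevel (hX : ∀ p ∉ P, ContinuousAt X p)
    (hP : ∀ p ∈ P, Tendsto X (𝓝[≠] p) (Bornology.cobounded R4)) {K : Set R4}
    (hK : IsCompact K) : IsCompact {p | p ∉ P ∧ X p ∈ K} := by
  refine IsClosed.isCompact ?_
  rw [← isOpen_compl_iff, isOpen_iff_mem_nhds]
  intro p hp
  by_cases hpP : p ∈ P
  · have h1 := (hP p hpP).eventually (Bornology.isBounded_def.1 hK.isBounded)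
    filter_upwards [eventually_nhdsWithin_iff.1 h1] with q hq hq'
    refine hq ?_ hq'.2
    rintro rfl
    exact hq'.1 hpP
  · have h1 : X p ∉ K := fun h => hp ⟨hpP, h⟩
    filter_upwards [(hX p hpP).eventually_mem (hK.isClosed.isOpen_compl.mem_nhds h1)] with q hq hq'
    exact hq hq'.2

/-- A curve of finite length has bounded image, so it stays in a compact sublevel set and is not
divergent. -/
lemma isCompleteOn_of_tendsto (hX : ∀ p ∉ P, ContinuousAt X p)
    (hP : ∀ p ∈ P, Tendsto X (𝓝[≠] p) (Bornology.cobounded R4)) :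
    IsCompleteOn X Pᶜ := by
  intro γ hγ hmaps hdiv
  by_contra hne
  have h0 : (0 : ℝ) ∈ Ico (0 : ℝ) 1 := ⟨le_rfl, one_pos⟩
  set L := (eVariationOn (X ∘ γ) (Ico 0 1)).toReal with hL
  have hK := isCompact_sublevel hX hP (isCompact_closedBall (X (γ 0)) L)
  have h1 := hdiv _ (fun p hp => hp.1) hK
  have h2 : ∀ᶠ t in 𝓝[<] (1 : ℝ), t ∈ Ico (0 : ℝ) 1 :=
    Filter.mem_of_superset (Ioo_mem_nhdsLT one_pos) Ioo_subset_Ico_self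
  obtain ⟨t, ht, ht'⟩ := (h1.and h2).exists
  refine ht ⟨hmaps ht', ?_⟩
  have h3 := eVariationOn.edist_le (X ∘ γ) ht' h0
  rw [Metric.mem_closedBall, hL, dist_edist]
  exact ENNReal.toReal_mono hne h3

/-- A proper injective map is an embedding. -/
lemma isEmbedding_of_tendsto (hX : ∀ p ∉ P, ContinuousAt X p)
    (hP : ∀ p ∈ P, Tendsto X (𝓝[≠] p) (Bornology.cobounded R4))
    (hinj : InjOn X Pᶜ) : Topology.IsEmbedding (fun p : {p : D.Surface // p ∉ P} => X p) := by
  have hc : Continuous (fun p : {p : D.Surface // p ∉ P} => X p) :=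
    continuous_iff_continuousAt.2 fun p => (hX p.1 p.2).comp continuous_subtype_val.continuousAt
  have hproper : IsProperMap (fun p : {p : D.Surface // p ∉ P} => X p) := by
    refine isProperMap_iff_isCompact_preimage.2 ⟨hc, fun K hK => ?_⟩
    rw [Subtype.isCompact_iff]
    convert isCompact_sublevel hX hP hK using 1
    ext p
    constructor
    · rintro ⟨q, hq, rfl⟩
      exact ⟨q.2, hq⟩
    · rintro ⟨h1, h2⟩
      exact ⟨⟨p, h1⟩, h2, rfl⟩
  exact (Topology.IsClosedEmbedding.of_continuous_injective_isClosedMap hc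
    (fun p q h => Subtype.ext (hinj p.2 q.2 h)) hproper.isClosedMap).isEmbedding

/-! ### The pair of meromorphic functions -/

variable {A : Finset (Fin (2 * g + 2))} {e : OpenPartialHomeomorph D.Surface ℂ} {z : ℂ}

/-- Conditions on a set `A` of branch values, disjoint from `I`, under which `(f_I, f_J)` with
`J = I ∪ A` is an immersion: `sum_lam_ne` gives immersivity at the points over `x = ∞`, and
`sum_inv_ne` says that `f_I` and `f_J` have no common critical point over the other values which
are not branch values. -/
structure IsAdmissible (D : BranchData g) (A : Finset (Fin (2 * g + 2))) : Prop where
  disj : Disjoint D.I A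
  nonempty : A.Nonempty
  sum_lam_ne : ∑ i ∈ D.I, D.lam i ≠ ∑ j ∈ D.Iᶜ, D.lam j
  sum_inv_ne : ∀ x : ℂ, (∀ k, x ≠ D.lam k) → ∑ a ∈ A, (x - D.lam a)⁻¹ = 0 →
    ∑ i ∈ D.I, (x - D.lam i)⁻¹ ≠ ∑ j ∈ D.Iᶜ, (x - D.lam j)⁻¹

/-- The function `f_I = w` (junk value at its poles). -/
def fstFun (p : D.Surface) : ℂ := affine (wc p)

open Classical in
/-- The function `f_J = w / ∏ a ∈ A, (x - lam a)`, where `J = I ∪ A`; it vanishes over `x = ∞`. -/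
def sndFun (A : Finset (Fin (2 * g + 2))) (p : D.Surface) : ℂ :=
  if xc p = OnePoint.infty then 0 else affine (wc p) / rootProd A D.lam (affine (xc p))

/-- The map `(f_I, f_J)`. -/
def pairMap (A : Finset (Fin (2 * g + 2))) (p : D.Surface) : R4 := toR4 (fstFun p) (sndFun A p)

open Classical in
variable (D) in
/-- The branch points with index in `J = I ∪ A`. -/
def punctures (A : Finset (Fin (2 * g + 2))) : Finset D.Surface :=
  (D.I ∪ A).image fun k => D.sect (D.lam k)

lemma mem_punctures : p ∈ D.punctures A ↔ ∃ k ∈ D.I ∪ A, xc p = (D.lam k : OnePoint ℂ) := by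
  classical
  rw [punctures, Finset.mem_image]
  refine exists_congr fun k => and_congr_right fun _ => ⟨?_, fun h => ?_⟩
  · rintro rfl
    exact xc_sect _
  · exact eq_of_xc_eq_lam (xc_sect _) h

lemma card_punctures : (D.punctures A).card = (D.I ∪ A).card := by
  classical
  rw [punctures, Finset.card_image_of_injective]
  intro k l h
  have := congrArg xc h
  rw [xc_sect, xc_sect] at this
  exact D.inj (OnePoint.coe_injective this)

lemma wc_ne_infty_of_notMem (hp : p ∉ D.punctures A) : wc p ≠ OnePoint.infty := by
  intro h
  have hx := xc_ne_infty_of_wc (Or.inr h)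
  obtain ⟨k, hk, hk'⟩ := rootProd_eq_zero.1 ((den_eq_zero_iff hx).2 h)
  exact hp (mem_punctures.2 ⟨k, Finset.mem_union_left _ hk, by rw [← hk', coe_affine hx]⟩)

lemma rootProd_ne_zero_of_notMem (hp : p ∉ D.punctures A) (hx : xc p ≠ OnePoint.infty) :
    rootProd A D.lam (affine (xc p)) ≠ 0 := by
  intro h
  obtain ⟨k, hk, hk'⟩ := rootProd_eq_zero.1 h
  exact hp (mem_punctures.2 ⟨k, Finset.mem_union_right _ hk, by rw [← hk', coe_affine hx]⟩)

lemma eventually_notMem (hp : p ∉ D.punctures A) : ∀ᶠ q in 𝓝 p, q ∉ D.punctures A :=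
  (D.punctures A).finite_toSet.isClosed.isOpen_compl.mem_nhds hp

lemma eventually_notMem_punctured (p : D.Surface) : ∀ᶠ q in 𝓝[≠] p, q ∉ D.punctures A := by
  filter_upwards [eventually_isGeneric p] with q hq h
  obtain ⟨k, -, hk⟩ := mem_punctures.1 h
  exact (isGeneric_iff.1 hq).2 k hk

lemma sndFun_eq (hx : xc p ≠ OnePoint.infty) :
    sndFun A p = fstFun p / rootProd A D.lam (affine (xc p)) := by
  simp [sndFun, fstFun, hx]

lemma sndFun_infty (hx : xc p = OnePoint.infty) : sndFun A p = 0 := by simp [sndFun, hx]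

lemma sndFun_eq_inv (hA : A.Nonempty) (hx : xc p ≠ ((0 : ℂ) : OnePoint ℂ)) :
    sndFun A p = fstFun p * affineInv (xc p) ^ A.card / rootProdRev A D.lam (affineInv (xc p)) := by
  by_cases h : xc p = OnePoint.infty
  · rw [sndFun_infty h, h, affineInv_infty, zero_pow hA.card_ne_zero, mul_zero, zero_div]
  · have hu := affineInv_ne_zero h hx
    rw [sndFun_eq h, rootProdRev_eq hu, mul_comm (fstFun p), mul_div_mul_left _ _ (pow_ne_zero _ hu),
      affineInv_eq h, inv_inv]

lemma analyticAt_fstFun (he : e ∈ IsManifold.maximalAtlas 𝓘(ℂ) ω D.Surface) (hz : z ∈ e.target)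
    (hp : e.symm z ∉ D.punctures A) : AnalyticAt ℂ (fun ζ => fstFun (e.symm ζ)) z :=
  analyticAt_w he hz (wc_ne_infty_of_notMem hp)

lemma analyticAt_sndFun (hA : A.Nonempty) (he : e ∈ IsManifold.maximalAtlas 𝓘(ℂ) ω D.Surface)
    (hz : z ∈ e.target) (hp : e.symm z ∉ D.punctures A) :
    AnalyticAt ℂ (fun ζ => sndFun A (e.symm ζ)) z := by
  have hF := analyticAt_fstFun he hz hp
  by_cases hx : xc (e.symm z) = OnePoint.infty
  · have hx0 : xc (e.symm z) ≠ ((0 : ℂ) : OnePoint ℂ) := by rw [hx]; exact OnePoint.infty_ne_coe 0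
    have hu := analyticAt_xInv he hz hx0
    have h1 : AnalyticAt ℂ (fun ζ => rootProdRev A D.lam (affineInv (xc (e.symm ζ)))) z :=
      (differentiable_rootProdRev.analyticAt _).comp hu
    refine ((hF.mul (hu.pow A.card)).div h1 (by simp [hx])).congr ?_
    filter_upwards [(e.continuousAt_symm hz).eventually (eventually_x_ne_zero hx0)] with ζ h
    exact (sndFun_eq_inv hA h).symm
  · have h1 : AnalyticAt ℂ (fun ζ => rootProd A D.lam (affine (xc (e.symm ζ)))) z :=
      (differentiable_rootProd.analyticAt _).comp (analyticAt_x he hz hx)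
    refine (hF.div h1 (rootProd_ne_zero_of_notMem hp hx)).congr ?_
    filter_upwards [(e.continuousAt_symm hz).eventually (eventually_x_ne_infty hx)] with ζ h
    exact (sndFun_eq h).symm

lemma mdifferentiableAt_fstFun (hp : p ∉ D.punctures A) :
    MDifferentiableAt 𝓘(ℂ) 𝓘(ℂ) fstFun p :=
  mdifferentiableAt_w (wc_ne_infty_of_notMem hp)

lemma mdifferentiableAt_sndFun (hA : A.Nonempty) (hp : p ∉ D.punctures A) :
    MDifferentiableAt 𝓘(ℂ) 𝓘(ℂ) (sndFun A) p := by
  obtain ⟨e, hea, z, hz, rfl⟩ := exists_atlas_point p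
  have he := mem_atlas_maximal hea
  exact (mdifferentiableAt_iff_chart he hz).2 (analyticAt_sndFun hA he hz hp).differentiableAt

/-! ### Immersivity -/

/-- At the points over `x = ∞`, where `w = ± 1`, the function `f_I = w` is a coordinate. -/
lemma deriv_fstFun_ne_zero_of_infty (h : ∑ i ∈ D.I, D.lam i ≠ ∑ j ∈ D.Iᶜ, D.lam j)
    (he : e ∈ IsManifold.maximalAtlas 𝓘(ℂ) ω D.Surface) (hz : z ∈ e.target)
    (hx : xc (e.symm z) = OnePoint.infty) : deriv (fun ζ => fstFun (e.symm ζ)) z ≠ 0 := by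
  intro h0
  have hx0 : xc (e.symm z) ≠ ((0 : ℂ) : OnePoint ℂ) := by rw [hx]; exact OnePoint.infty_ne_coe 0
  have hw := wc_ne_infty hx
  set u : ℂ → ℂ := fun ζ => affineInv (xc (e.symm ζ)) with hu
  have hu0 : u z = 0 := by simp [hu, hx]
  have hud : HasDerivAt u (deriv u z) z := (analyticAt_xInv he hz hx0).differentiableAt.hasDerivAt
  have hwd : HasDerivAt (fun ζ => fstFun (e.symm ζ)) 0 z :=
    h0 ▸ (analyticAt_w he hz hw).differentiableAt.hasDerivAt
  have hw2 : fstFun (e.symm z) ^ 2 = 1 := wc_sq_of_infty hx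
  have hrev : ∀ T : Finset (Fin (2 * g + 2)), HasDerivAt (fun ζ => rootProdRev T D.lam (u ζ))
      ((-∑ j ∈ T, D.lam j) * deriv u z) z := fun T => by
    have h1 : HasDerivAt (rootProdRev T D.lam) (-∑ j ∈ T, D.lam j) (u z) :=
      hu0 ▸ hasDerivAt_rootProdRev_zero
    exact h1.comp z hud
  have h3 := (hrev D.I).mul (hwd.pow 2)
  have h4 : (fun ζ => D.denRev (u ζ)) * (fun ζ => fstFun (e.symm ζ)) ^ 2 =ᶠ[𝓝 z]
      fun ζ => D.numRev (u ζ) := by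
    filter_upwards [(e.continuousAt_symm hz).eventually (eventually_x_ne_zero hx0),
      (e.continuousAt_symm hz).eventually (eventually_w_ne_infty hw)] with ζ h5 h6
    exact denRev_mul_sq h5 h6
  have h5 := h3.unique ((hrev _).congr_of_eventuallyEq h4)
  simp only [Pi.pow_apply, hw2, mul_one, mul_zero, add_zero] at h5
  exact h (neg_injective (mul_right_cancel₀ (deriv_xInv_ne_zero he hz hx) h5))

/-- A common critical point of `f_I = w` and `f_J = w / m (x)` is a critical point of `m (x)`, and the
logarithmic derivative of `den x * w² = num x` gives a second condition on `x`. -/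
lemma deriv_ne_zero (hA : D.IsAdmissible A) (he : e ∈ IsManifold.maximalAtlas 𝓘(ℂ) ω D.Surface)
    (hz : z ∈ e.target) (hp : e.symm z ∉ D.punctures A) :
    deriv (fun ζ => fstFun (e.symm ζ)) z ≠ 0 ∨ deriv (fun ζ => sndFun A (e.symm ζ)) z ≠ 0 := by
  have hw := wc_ne_infty_of_notMem hp
  by_cases hx : xc (e.symm z) = OnePoint.infty
  · exact Or.inl (deriv_fstFun_ne_zero_of_infty hA.sum_lam_ne he hz hx)
  by_cases hw0 : wc (e.symm z) = ((0 : ℂ) : OnePoint ℂ)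
  · exact Or.inl (deriv_w_ne_zero he hz hw0)
  by_contra! hcon
  obtain ⟨hF0, hG0⟩ := hcon
  have hgen : IsGeneric (e.symm z) := ⟨hx, hw, hw0⟩
  have hm := rootProd_ne_zero_of_notMem hp hx
  have hden := den_ne_zero_of_wc hx hw
  have hnum := num_ne_zero_of_wc hx hw0
  have hFz : fstFun (e.symm z) ≠ 0 := affine_ne_zero hw hw0
  have hF : HasDerivAt (fun ζ => fstFun (e.symm ζ)) 0 z :=
    hF0 ▸ (analyticAt_fstFun he hz hp).differentiableAt.hasDerivAt
  have hG : HasDerivAt (fun ζ => sndFun A (e.symm ζ)) 0 z :=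
    hG0 ▸ (analyticAt_sndFun hA.nonempty he hz hp).differentiableAt.hasDerivAt
  set x : ℂ → ℂ := fun ζ => affine (xc (e.symm ζ)) with hxdef
  have hxd : HasDerivAt x (deriv x z) z := (analyticAt_x he hz hx).differentiableAt.hasDerivAt
  have hx' : deriv x z ≠ 0 := deriv_x_ne_zero he hz hx hw hw0
  have hxev := (e.continuousAt_symm hz).eventually (eventually_x_ne_infty hx)
  have hcomp : ∀ T : Finset (Fin (2 * g + 2)), rootProd T D.lam (x z) ≠ 0 →
      HasDerivAt (fun ζ => rootProd T D.lam (x ζ))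
        (rootProd T D.lam (x z) * (∑ j ∈ T, (x z - D.lam j)⁻¹) * deriv x z) z := fun T hT =>
    (hasDerivAt_rootProd hT).comp z hxd
  refine hA.sum_inv_ne (x z) (fun k hk => (isGeneric_iff.1 hgen).2 k ?_) ?_ ?_
  · rw [← hk, coe_affine hx]
  -- differentiate `f_J m(x) = f_I`
  · have h1 : (fun ζ => sndFun A (e.symm ζ)) * (fun ζ => rootProd A D.lam (x ζ)) =ᶠ[𝓝 z]
        fun ζ => fstFun (e.symm ζ) := by
      filter_upwards [hxev, (e.continuousAt_symm hz).eventually (eventually_notMem hp)] with ζ h2 h3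
      simp only [Pi.mul_apply, sndFun_eq h2, hxdef]
      exact div_mul_cancel₀ _ (rootProd_ne_zero_of_notMem h3 h2)
    have h2 := (hG.mul (hcomp A hm)).unique (hF.congr_of_eventuallyEq h1)
    have hGz : sndFun A (e.symm z) ≠ 0 := by rw [sndFun_eq hx]; exact div_ne_zero hFz hm
    rw [zero_mul, zero_add] at h2
    have h3 := (mul_eq_zero.1 h2).resolve_left hGz
    exact (mul_eq_zero.1 ((mul_eq_zero.1 h3).resolve_right hx')).resolve_left hm
  -- differentiate `den(x) w² = num(x)`
  · have h1 : (fun ζ => D.den (x ζ)) * (fun ζ => fstFun (e.symm ζ)) ^ 2 =ᶠ[𝓝 z]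
        fun ζ => D.num (x ζ) := by
      filter_upwards [hxev, (e.continuousAt_symm hz).eventually (eventually_w_ne_infty hw)]
        with ζ h2 h3
      exact den_mul_sq h2 h3
    have h2 := ((hcomp D.I hden).mul (hF.pow 2)).unique ((hcomp _ hnum).congr_of_eventuallyEq h1)
    have h3 : D.den (x z) * fstFun (e.symm z) ^ 2 = D.num (x z) := den_mul_sq hx hw
    rw [mul_zero, mul_zero, add_zero, Pi.pow_apply] at h2
    have h4 : D.num (x z) * deriv x z * ∑ j ∈ D.I, (x z - D.lam j)⁻¹ =
        D.num (x z) * deriv x z * ∑ j ∈ D.Iᶜ, (x z - D.lam j)⁻¹ := by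
      linear_combination h2 - (∑ j ∈ D.I, (x z - D.lam j)⁻¹) * deriv x z * h3
    exact mul_left_cancel₀ (mul_ne_zero hnum hx') h4

lemma isMinimalImmersionOn (hA : D.IsAdmissible A) :
    IsMinimalImmersionOn (pairMap A) ((D.punctures A : Set D.Surface)ᶜ) := by
  have key : ∀ e ∈ atlas ℂ D.Surface, ∀ p ∈ e.source ∩ (D.punctures A : Set D.Surface)ᶜ,
      AnalyticAt ℂ (fun ζ => fstFun (e.symm ζ)) (e p) ∧
        AnalyticAt ℂ (fun ζ => sndFun A (e.symm ζ)) (e p) ∧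
        (deriv (fun ζ => fstFun (e.symm ζ)) (e p) ≠ 0 ∨
          deriv (fun ζ => sndFun A (e.symm ζ)) (e p) ≠ 0) := by
    rintro e hea p ⟨hp, hpP⟩
    have he := mem_atlas_maximal hea
    have hz := e.map_source hp
    have hpP' : e.symm (e p) ∉ D.punctures A := by rwa [e.left_inv hp]
    exact ⟨analyticAt_fstFun he hz hpP', analyticAt_sndFun hA.nonempty he hz hpP',
      deriv_ne_zero hA he hz hpP'⟩
  constructor
  · intro p hp
    refine (contMDiffAt_toR4 ?_ ?_).contMDiffWithinAt
    · exact (eventually_notMem hp).mono fun q hq => mdifferentiableAt_fstFun hq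
    · exact (eventually_notMem hp).mono fun q hq => mdifferentiableAt_sndFun hA.nonempty hq
  · intro e he p hp
    obtain ⟨h1, h2, h3⟩ := key e he p hp
    exact injective_fderiv_toR4 h1.differentiableAt h2.differentiableAt h3
  · intro e he p hp
    obtain ⟨h1, h2, -⟩ := key e he p hp
    have h := firstForm_toR4 h1.differentiableAt h2.differentiableAt
    have hX : pairMap A ∘ e.symm = fun ζ => toR4 (fstFun (e.symm ζ)) (sndFun A (e.symm ζ)) := rfl
    rw [hX, h, h, h]
    simp
  · intro e he p hp
    obtain ⟨h1, h2, -⟩ := key e he p hp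
    exact meanCurvature_toR4 h1 h2

/-! ### The punctures -/

lemma rootProd_eq_mul_erase {T : Finset (Fin (2 * g + 2))} {k : Fin (2 * g + 2)} (hk : k ∈ T)
    (x : ℂ) : rootProd T D.lam x = (x - D.lam k) * rootProd (T.erase k) D.lam x :=
  (Finset.mul_prod_erase T (fun j => x - D.lam j) hk).symm

lemma rootProd_erase_ne_zero (T : Finset (Fin (2 * g + 2))) (k : Fin (2 * g + 2)) :
    rootProd (T.erase k) D.lam (D.lam k) ≠ 0 := by
  rw [Ne, rootProd_eq_zero]
  rintro ⟨j, hj, h⟩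
  exact (Finset.ne_of_mem_erase hj) (D.inj h).symm

/-- At the punctures the pair has a simple pole: `f_I` and `f_J` both do at the branch points in `I`,
and only `f_J` does at those in `A`. -/
lemma exists_simplePole (hA : D.IsAdmissible A) (he : e ∈ IsManifold.maximalAtlas 𝓘(ℂ) ω D.Surface)
    (hz : z ∈ e.target) (hp : e.symm z ∈ D.punctures A) :
    ∃ f₁ g₁ : ℂ → ℂ, AnalyticAt ℂ f₁ z ∧ AnalyticAt ℂ g₁ z ∧ (f₁ z ≠ 0 ∨ g₁ z ≠ 0) ∧
      (∀ᶠ ζ in 𝓝[≠] z, fstFun (e.symm ζ) = f₁ ζ / (ζ - z)) ∧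
      ∀ᶠ ζ in 𝓝[≠] z, sndFun A (e.symm ζ) = g₁ ζ / (ζ - z) := by
  obtain ⟨k, hk, hxk⟩ := mem_punctures.1 hp
  have hx : xc (e.symm z) ≠ OnePoint.infty := by rw [hxk]; exact OnePoint.coe_ne_infty _
  have hxa : affine (xc (e.symm z)) = D.lam k := by rw [hxk]; rfl
  have hR : ∀ T : Finset (Fin (2 * g + 2)),
      AnalyticAt ℂ (fun ζ => rootProd T D.lam (affine (xc (e.symm ζ)))) z := fun T =>
    (differentiable_rootProd.analyticAt _).comp (analyticAt_x he hz hx)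
  have hgen := eventually_chart_generic hz
  have hdslope : ∀ {h : ℂ → ℂ}, AnalyticAt ℂ h z → AnalyticAt ℂ (dslope h z) z := fun ⟨r, hr⟩ =>
    hr.has_fpower_series_dslope_fslope.analyticAt
  by_cases hkI : k ∈ D.I
  -- at `k ∈ I` the function `w` has a simple pole, and `m` does not vanish
  · have hwi : wc (e.symm z) = OnePoint.infty :=
      (den_eq_zero_iff hx).1 (rootProd_eq_zero.2 ⟨k, hkI, hxa⟩)
    have hm : rootProd A D.lam (affine (xc (e.symm z))) ≠ 0 :=
      rootProd_ne_zero_of_disjoint D.inj hA.disj (rootProd_eq_zero.2 ⟨k, hkI, hxa⟩)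
    set v : ℂ → ℂ := fun ζ => affineInv (wc (e.symm ζ)) with hv
    have hv0 : v z = 0 := by simp [hv, hwi]
    have h1 := hdslope (analyticAt_wInv he hz (by rw [hwi]; exact OnePoint.infty_ne_coe 0))
    have h2 : dslope v z z ≠ 0 := by rw [dslope_same]; exact deriv_wInv_ne_zero he hz hwi
    have h3 : ∀ ζ, ζ ∈ e.target → IsGeneric (e.symm ζ) → ζ ≠ z →
        fstFun (e.symm ζ) = (dslope v z ζ)⁻¹ / (ζ - z) := by
      intro ζ h4 h5 h6
      rw [dslope_of_ne _ h6, slope_def_field, hv0, sub_zero]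
      simp only [hv]
      rw [affineInv_eq h5.w_ne, fstFun]
      have h7 := affine_ne_zero h5.w_ne h5.w_ne_zero
      have h8 := sub_ne_zero.2 h6
      field_simp
    refine ⟨fun ζ => (dslope v z ζ)⁻¹,
      fun ζ => (dslope v z ζ)⁻¹ / rootProd A D.lam (affine (xc (e.symm ζ))),
      h1.inv h2, (h1.inv h2).div (hR A) hm, Or.inl (inv_ne_zero h2), ?_, ?_⟩
    · filter_upwards [hgen, self_mem_nhdsWithin] with ζ h4 h5 using h3 ζ h4.1 h4.2 h5
    · filter_upwards [hgen, self_mem_nhdsWithin] with ζ h4 h5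
      rw [sndFun_eq h4.2.x_ne, h3 ζ h4.1 h4.2 h5, div_right_comm]
  -- at `k ∈ A` the function `w` has a simple zero and `m(x)` a double zero: indeed
  -- `x - lam k = den(x) w² / ∏ j ∈ Iᶜ \ {k}, (x - lam j)`
  · have hkA : k ∈ A := (Finset.mem_union.1 hk).resolve_left hkI
    have hkc : k ∈ D.Iᶜ := Finset.mem_compl.2 hkI
    have hw0 : wc (e.symm z) = ((0 : ℂ) : OnePoint ℂ) :=
      (num_eq_zero_iff hx).1 (rootProd_eq_zero.2 ⟨k, hkc, hxa⟩)
    have hwi : wc (e.symm z) ≠ OnePoint.infty := by rw [hw0]; exact OnePoint.coe_ne_infty 0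
    set w : ℂ → ℂ := fun ζ => affine (wc (e.symm ζ)) with hw
    have hwz : w z = 0 := by simp [hw, hw0]
    have h1 := hdslope (analyticAt_w he hz hwi)
    have h2 : dslope w z z ≠ 0 := by rw [dslope_same]; exact deriv_w_ne_zero he hz hw0
    have hden : D.den (affine (xc (e.symm z))) ≠ 0 := den_ne_zero_of_wc hx hwi
    have hE : ∀ T : Finset (Fin (2 * g + 2)),
        rootProd (T.erase k) D.lam (affine (xc (e.symm z))) ≠ 0 := fun T => by
      rw [hxa]; exact rootProd_erase_ne_zero T k
    have h3 : ∀ ζ, w ζ = (ζ - z) * dslope w z ζ := fun ζ => by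
      have := sub_smul_dslope w z ζ
      rw [hwz, sub_zero, smul_eq_mul] at this
      exact this.symm
    refine ⟨fun ζ => (ζ - z) ^ 2 * dslope w z ζ,
      fun ζ => rootProd (D.Iᶜ.erase k) D.lam (affine (xc (e.symm ζ))) /
        (dslope w z ζ * D.den (affine (xc (e.symm ζ))) *
          rootProd (A.erase k) D.lam (affine (xc (e.symm ζ)))),
      ((analyticAt_id.sub analyticAt_const).pow 2).mul h1,
      (hR _).div ((h1.mul (hR _)).mul (hR _)) (mul_ne_zero (mul_ne_zero h2 hden) (hE A)),
      Or.inr (div_ne_zero (hE _) (mul_ne_zero (mul_ne_zero h2 hden) (hE A))), ?_, ?_⟩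
    · filter_upwards [self_mem_nhdsWithin] with ζ h5
      have h6 := sub_ne_zero.2 h5
      change w ζ = _
      rw [h3]
      field_simp
    · filter_upwards [hgen, self_mem_nhdsWithin,
        eventually_nhdsWithin_of_eventually_nhds ((hR _).continuousAt.eventually_ne (hE D.Iᶜ)),
        eventually_nhdsWithin_of_eventually_nhds ((hR _).continuousAt.eventually_ne (hE A))]
        with ζ ⟨h4, h5⟩ h6 h7 h8
      have h9 := sub_ne_zero.2 h6
      have h10 := den_mul_sq h5.x_ne h5.w_ne
      have h11 := den_ne_zero_of_wc h5.x_ne h5.w_ne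
      have h12 : w ζ ≠ 0 := affine_ne_zero h5.w_ne h5.w_ne_zero
      have h13 : dslope w z ζ ≠ 0 := fun h => h12 (by rw [h3, h, mul_zero])
      have h14 : affine (xc (e.symm ζ)) - D.lam k ≠ 0 := fun h => (isGeneric_iff.1 h5).2 k (by
        rw [← sub_eq_zero.1 h, coe_affine h5.x_ne])
      rw [num, rootProd_eq_mul_erase hkc] at h10
      change _ * w ζ ^ 2 = _ at h10
      rw [sndFun_eq h5.x_ne, rootProd_eq_mul_erase hkA]
      change w ζ / _ = _
      rw [h3] at h10 ⊢
      rw [div_div, div_eq_div_iff (mul_ne_zero h14 h8)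
        (mul_ne_zero (mul_ne_zero (mul_ne_zero h13 h11) h8) h9)]
      linear_combination rootProd (A.erase k) D.lam (affine (xc (e.symm ζ))) * h10

lemma hasEmbeddedPlanarEnd (hA : D.IsAdmissible A) (hp : p ∈ D.punctures A) :
    HasEmbeddedPlanarEnd (pairMap A) (D.punctures A : Set D.Surface) p := by
  obtain ⟨e, hea, z, hz, rfl⟩ := exists_atlas_point p
  obtain ⟨f₁, g₁, hf, hg, hne, hF, hG⟩ := exists_simplePole hA (mem_atlas_maximal hea) hz hp
  refine hasEmbeddedPlanarEnd_of_simplePole hz rfl hf hg hne (eventually_notMem_punctured _) ?_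
  filter_upwards [hF, hG] with ζ h1 h2
  rw [pairMap, h1, h2]

lemma tendsto_pairMap (hA : D.IsAdmissible A) (hp : p ∈ D.punctures A) :
    Tendsto (pairMap A) (𝓝[≠] p) (Bornology.cobounded R4) :=
  (hasEmbeddedPlanarEnd hA hp).1

lemma continuousAt_pairMap (hA : D.IsAdmissible A) (hp : p ∉ D.punctures A) :
    ContinuousAt (pairMap A) p :=
  ((isMinimalImmersionOn hA).smooth.continuousOn).continuousAt (eventually_notMem hp)

lemma totalAbsCurvature_pairMap (hA : D.IsAdmissible A) :
    totalAbsCurvature (pairMap A) ((D.punctures A : Set D.Surface)ᶜ) < ⊤ := by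
  refine totalAbsCurvature_lt_top fun E hE z hz => ?_
  have he := hE.mem_maximalAtlas
  set F : ℂ → ℂ := fun ζ => fstFun (E.symm ζ) with hF
  set G : ℂ → ℂ := fun ζ => sndFun A (E.symm ζ) with hG
  have hX : pairMap A ∘ E.symm = fun ζ => toR4 (F ζ) (G ζ) := rfl
  have hdens : ∀ ζ ∈ E.target, E.symm ζ ∉ D.punctures A →
      |gaussCurvature (pairMap A ∘ E.symm) ζ| * √(metricDet (pairMap A ∘ E.symm) ζ) ≤
        2 * speedSq (deriv F) (deriv G) ζ := fun ζ h1 h2 =>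
    curvature_density_le (analyticAt_fstFun he h1 h2) (analyticAt_sndFun hA.nonempty he h1 h2)
      (deriv_ne_zero hA he h1 h2)
  by_cases hp : E.symm z ∈ D.punctures A
  · obtain ⟨f₁, g₁, hf, hg, hne, hF', hG'⟩ := exists_simplePole hA he hz hp
    obtain ⟨C, hC⟩ := speedSq_bounded_pole hf hg hne hF' hG'
    refine ⟨2 * C, ?_⟩
    filter_upwards [eventually_nhdsWithin_iff.1 hC, E.open_target.eventually_mem hz]
      with ζ h1 h2 h3
    have h4 : ζ ≠ z := by rintro rfl; exact h3 hp
    have := hdens ζ h2 h3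
    have := h1 h4
    linarith
  · obtain ⟨C, hC⟩ := speedSq_bounded (analyticAt_fstFun he hz hp).deriv
      (analyticAt_sndFun hA.nonempty he hz hp).deriv (deriv_ne_zero hA he hz hp)
    refine ⟨2 * C, ?_⟩
    filter_upwards [hC, E.open_target.eventually_mem hz] with ζ h1 h2 h3
    have := hdens ζ h2 h3
    linarith

/-! ### Symmetry, equations, injectivity -/

lemma isSymmetricAboutOrigin :
    IsSymmetricAboutOrigin (pairMap A) (D.punctures A : Set D.Surface) := by
  refine ⟨invol, involutive_invol, mdifferentiable_invol, fun p hp => ⟨fun h => hp ?_, ?_⟩⟩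
  · exact mem_punctures.2 (mem_punctures (p := invol p).1 h)
  · have h1 : fstFun (invol p) = -fstFun p := affine_wc_invol p
    have h2 : sndFun A (invol p) = -sndFun A p := by
      by_cases hx : xc p = OnePoint.infty
      · rw [sndFun_infty hx, sndFun_infty (p := invol p) hx, neg_zero]
      · rw [sndFun_eq hx, sndFun_eq (p := invol p) hx, h1, xc_invol, neg_div]
    rw [pairMap, pairMap, h1, h2, toR4_neg]

lemma isCurvePair (hA : D.IsAdmissible A) :
    IsCurvePair g (pairMap A) (D.punctures A : Set D.Surface) := by
  refine ⟨D.lam, xc, yc, D.I, D.I ∪ A, isHyperellipticCurve, ?_, D.card_I.ge, ?_, fun p => ?_,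
    fun p hp hx => ?_⟩
  · intro h
    obtain ⟨a, ha⟩ := hA.nonempty
    exact Finset.disjoint_right.1 hA.disj ha (h ▸ Finset.mem_union_right _ ha)
  · rw [← D.card_I]; exact Finset.card_le_card Finset.subset_union_left
  · rw [← Finset.union_assoc, Finset.union_self]; exact mem_punctures
  · have hw := wc_ne_infty_of_notMem hp
    have hd : D.den (affine (xc p)) ≠ 0 := den_ne_zero_of_wc hx hw
    rw [affine_yc hx, yFin_eq_w hw, Finset.prod_union hA.disj, pairMap, sndFun_eq hx]
    congr 1
    · exact (mul_div_cancel_right₀ _ hd).symm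
    · rw [mul_comm (affine (wc p))]
      exact (mul_div_mul_left _ _ hd).symm

lemma toR4_injective {a b c d : ℂ} (h : toR4 a b = toR4 c d) : a = c ∧ b = d := by
  have h1 : toR4 (a + -c) (b + -d) = 0 := by rw [toR4_add, toR4_neg, h, add_neg_cancel]
  obtain ⟨h2, h3⟩ := toR4_eq_zero.1 h1
  exact ⟨by linear_combination h2, by linear_combination h3⟩

/-- If `A` has one element `a` and one index `b` remains, then `x - lam a = f_I / f_J` where `f_J` does not
vanish, and the zeros of `f_J` are the points over `x = ∞` and the branch point of index `b`. -/
lemma injOn_pairMap {a b : Fin (2 * g + 2)} (hA : A = {a}) (hb : (D.I ∪ A)ᶜ = {b}) :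
    InjOn (pairMap A) ((D.punctures A : Set D.Surface)ᶜ) := by
  intro p hp q hq h
  obtain ⟨hF, hG⟩ := toR4_injective h
  have hpw := wc_ne_infty_of_notMem hp
  have hqw := wc_ne_infty_of_notMem hq
  have hw : wc p = wc q := by
    rw [← coe_affine hpw, ← coe_affine hqw]
    exact congrArg _ hF
  refine ext_xw ?_ hw
  have hzero : ∀ r : D.Surface, r ∉ D.punctures A → xc r ≠ OnePoint.infty → sndFun A r = 0 →
      fstFun r = 0 := fun r hr hx h0 => by
    rw [sndFun_eq hx] at h0
    exact (div_eq_zero_iff.1 h0).resolve_right (rootProd_ne_zero_of_notMem hr hx)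
  have hinf : ∀ r : D.Surface, xc r = OnePoint.infty → fstFun r ≠ 0 := fun r hx h0 => by
    have h1 : fstFun r ^ 2 = 1 := wc_sq_of_infty hx
    simp [h0] at h1
  by_cases hpx : xc p = OnePoint.infty
  · rw [hpx]
    by_contra hqx
    exact hinf p hpx (hF.trans (hzero q hq (Ne.symm hqx) (hG ▸ sndFun_infty hpx)))
  by_cases hqx : xc q = OnePoint.infty
  · exact absurd (hF ▸ hzero p hp hpx (hG.trans (sndFun_infty hqx))) (hinf q hqx)
  by_cases h0 : fstFun p = 0
  · have key : ∀ r : D.Surface, r ∉ D.punctures A → xc r ≠ OnePoint.infty → fstFun r = 0 →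
        xc r = (D.lam b : OnePoint ℂ) := by
      intro r hr hx hr0
      have h1 : wc r = ((0 : ℂ) : OnePoint ℂ) := by
        rw [← coe_affine (wc_ne_infty_of_notMem hr)]
        exact congrArg _ hr0
      obtain ⟨k, hk⟩ := exists_lam_of_wc (Or.inl h1)
      have h2 : k ∈ (D.I ∪ A)ᶜ := Finset.mem_compl.2 fun h => hr (mem_punctures.2 ⟨k, h, hk⟩)
      rw [hb, Finset.mem_singleton] at h2
      rw [hk, h2]
    rw [key p hp hpx h0, key q hq hqx (hF ▸ h0)]
  · rw [sndFun_eq hpx, sndFun_eq hqx, hF, div_eq_div_iff (rootProd_ne_zero_of_notMem hp hpx)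
      (rootProd_ne_zero_of_notMem hq hqx), mul_right_inj' (hF ▸ h0), hA] at hG
    simp only [rootProd, Finset.prod_singleton, sub_left_inj] at hG
    rw [← coe_affine hpx, ← hG, coe_affine hqx]

/-! ### Integer branch values -/

variable (g) in
/-- Branch values `0, …, 2 g + 1`, with poles of `w` at the upper half of them. -/
def integral : BranchData g where
  lam k := ((k : ℕ) : ℂ)
  inj k l h := Fin.ext (Nat.cast_injective h)
  I := Finset.univ.filter fun k => g + 1 ≤ (k : ℕ)
  card_I := by
    have h := Fin.card_filter_val_lt (n := 2 * g + 2) (m := g + 1)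
    have h2 := Finset.card_filter_add_card_filter_not (s := (Finset.univ : Finset (Fin (2 * g + 2))))
      (fun k => (k : ℕ) < g + 1)
    simp only [not_lt, Finset.card_univ, Fintype.card_fin] at h2
    omega

/-- The indices from `m` to `g`. -/
def middle (g m : ℕ) : Finset (Fin (2 * g + 2)) :=
  Finset.univ.filter fun k => m ≤ (k : ℕ) ∧ (k : ℕ) < g + 1

lemma mem_integral_I {k : Fin (2 * g + 2)} : k ∈ (integral g).I ↔ g + 1 ≤ (k : ℕ) := by
  simp [integral]

lemma mem_middle {m : ℕ} {k : Fin (2 * g + 2)} :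
    k ∈ middle g m ↔ m ≤ (k : ℕ) ∧ (k : ℕ) < g + 1 := by simp [middle]

lemma mem_integral_union {m : ℕ} (hm : m ≤ g) {k : Fin (2 * g + 2)} :
    k ∈ (integral g).I ∪ middle g m ↔ m ≤ (k : ℕ) := by
  rw [Finset.mem_union, mem_integral_I, mem_middle]
  omega

lemma card_integral_union {m : ℕ} (hm : m ≤ g) :
    ((integral g).I ∪ middle g m).card = 2 * g + 2 - m := by
  have h1 : ((integral g).I ∪ middle g m)ᶜ =
      Finset.univ.filter fun k : Fin (2 * g + 2) => (k : ℕ) < m := by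
    ext k
    rw [Finset.mem_compl, mem_integral_union hm]
    simp
  have h2 := Finset.card_compl ((integral g).I ∪ middle g m)
  have h3 := Finset.card_le_univ ((integral g).I ∪ middle g m)
  rw [h1, Fin.card_filter_val_lt] at h2
  rw [Fintype.card_fin] at h2 h3
  omega

/-- For integer branch values, a critical point of `∏ a ∈ A, (x - a)` has real part between the
smallest and the largest element of `A`, so that the real parts of the sums over `I` and its
complement have different signs. -/
lemma isAdmissible_integral {m : ℕ} (hm : m ≤ g) : (integral g).IsAdmissible (middle g m) where
  disj := Finset.disjoint_left.2 fun k h1 h2 => by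
    rw [mem_integral_I] at h1
    rw [mem_middle] at h2
    omega
  nonempty := ⟨⟨g, by omega⟩, mem_middle.2 ⟨hm, Nat.lt_succ_self g⟩⟩
  sum_lam_ne := by
    intro h
    have h1 : ∑ i ∈ (integral g).I, (i : ℕ) = ∑ j ∈ (integral g).Iᶜ, (j : ℕ) := by
      have h2 : ∀ T : Finset (Fin (2 * g + 2)),
          ∑ i ∈ T, (integral g).lam i = ((∑ i ∈ T, (i : ℕ) : ℕ) : ℂ) := fun T => by
        push_cast; rfl
      rw [h2, h2] at h
      exact_mod_cast h
    have h2 := Finset.card_nsmul_le_sum (integral g).I (fun i => (i : ℕ)) (g + 1)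
      fun i hi => mem_integral_I.1 hi
    have h3 := Finset.sum_le_card_nsmul (integral g).Iᶜ (fun i => (i : ℕ)) g fun i hi => by
      rw [Finset.mem_compl, mem_integral_I] at hi
      omega
    rw [card_I, smul_eq_mul] at h2
    rw [card_compl, smul_eq_mul] at h3
    have h4 : (g + 1) * g < (g + 1) * (g + 1) := by nlinarith
    omega
  sum_inv_ne := by
    intro x hx h0 h
    have hre : ∀ T : Finset (Fin (2 * g + 2)), (∑ j ∈ T, (x - (integral g).lam j)⁻¹).re =
        ∑ j ∈ T, (x.re - (j : ℕ)) / Complex.normSq (x - (integral g).lam j) := fun T => by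
      rw [Complex.re_sum]
      refine Finset.sum_congr rfl fun j _ => ?_
      rw [Complex.inv_re, Complex.sub_re]
      rfl
    have hpos : ∀ k, 0 < Complex.normSq (x - (integral g).lam k) := fun k =>
      Complex.normSq_pos.2 (sub_ne_zero.2 (hx k))
    have hne : (middle g m).Nonempty := ⟨⟨g, by omega⟩, mem_middle.2 ⟨hm, Nat.lt_succ_self g⟩⟩
    have h0re := congrArg Complex.re h0
    rw [hre, Complex.zero_re] at h0re
    obtain ⟨a, ha, hax⟩ : ∃ a ∈ middle g m, ((a : ℕ) : ℝ) ≤ x.re := by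
      by_contra! hcon
      exact (Finset.sum_neg (fun k hk => div_neg_of_neg_of_pos
        (sub_neg.2 (hcon k hk)) (hpos k)) hne).ne h0re
    obtain ⟨b, hb, hbx⟩ : ∃ b ∈ middle g m, x.re ≤ ((b : ℕ) : ℝ) := by
      by_contra! hcon
      exact (Finset.sum_pos (fun k hk => div_pos (sub_pos.2 (hcon k hk)) (hpos k)) hne).ne' h0re
    rw [mem_middle] at ha hb
    have hI : (∑ j ∈ (integral g).I, (x - (integral g).lam j)⁻¹).re < 0 := by
      rw [hre]
      refine Finset.sum_neg (fun k hk => div_neg_of_neg_of_pos (sub_neg.2 ?_) (hpos k)) ?_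
      · rw [mem_integral_I] at hk
        have : ((b : ℕ) : ℝ) < ((k : ℕ) : ℝ) := by exact_mod_cast hb.2.trans_le hk
        linarith
      · rw [← Finset.card_pos, card_I]; omega
    have hsub : middle g m ⊆ (integral g).Iᶜ := fun k hk => by
      rw [Finset.mem_compl, mem_integral_I]
      rw [mem_middle] at hk
      omega
    have hIc : 0 ≤ (∑ j ∈ (integral g).Iᶜ, (x - (integral g).lam j)⁻¹).re := by
      rw [← Finset.sum_sdiff hsub, h0, add_zero, hre]
      refine Finset.sum_nonneg fun k hk => div_nonneg (sub_nonneg.2 ?_) (hpos k).le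
      rw [Finset.mem_sdiff, Finset.mem_compl, mem_integral_I, mem_middle] at hk
      have : ((k : ℕ) : ℝ) ≤ ((a : ℕ) : ℝ) := by
        have : (k : ℕ) ≤ (a : ℕ) := by omega
        exact_mod_cast this
      linarith
    rw [h] at hI
    exact absurd hI (not_lt.2 hIc)

end BranchData

end PlanarEnds

end

theorem theorem5p5 (g d : ℕ) (hg : 1 ≤ g) (hd₁ : g + 2 ≤ d) (hd₂ : d ≤ 2 * g + 1) :
    ∃ (S : Type) (_ : TopologicalSpace S) (_ : ChartedSpace ℂ S) (P : Finset S)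
      (X : S → PlanarEnds.R4),
      PlanarEnds.IsClosedRiemannSurface S ∧
      PlanarEnds.genus S = g ∧
      P.card = d ∧
      PlanarEnds.IsMinimalImmersionOn X (P : Set S)ᶜ ∧
      PlanarEnds.IsCompleteOn X (P : Set S)ᶜ ∧
      PlanarEnds.totalAbsCurvature X (P : Set S)ᶜ < ⊤ ∧
      (∀ p ∈ P, PlanarEnds.HasEmbeddedPlanarEnd X (P : Set S) p) ∧
      PlanarEnds.IsSymmetricAboutOrigin X (P : Set S) ∧
      (2 ≤ g → PlanarEnds.IsHyperelliptic S) ∧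
      PlanarEnds.IsCurvePair g X (P : Set S) ∧
      (g = 1 → d = 3 → Topology.IsEmbedding (fun p : {p : S // p ∉ P} => X p)) := by
  -- the `d` largest indices are those from `2 * g + 2 - d` on
  have hm : 2 * g + 2 - d ≤ g := by omega
  have hA := PlanarEnds.BranchData.isAdmissible_integral hm
  set A := PlanarEnds.BranchData.middle g (2 * g + 2 - d) with hAdef
  set D := PlanarEnds.BranchData.integral g with hD
  have hgenus := PlanarEnds.BranchData.genus_eq D hg
  have hc : ∀ p ∉ (D.punctures A : Set D.Surface),
      ContinuousAt (PlanarEnds.BranchData.pairMap A) p := fun p hp =>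
    PlanarEnds.BranchData.continuousAt_pairMap hA hp
  have ht : ∀ p ∈ (D.punctures A : Set D.Surface), Filter.Tendsto (PlanarEnds.BranchData.pairMap A)
      (nhdsWithin p {p}ᶜ) (Bornology.cobounded PlanarEnds.R4) := fun p hp =>
    PlanarEnds.BranchData.tendsto_pairMap hA hp
  refine ⟨D.Surface, inferInstance, inferInstance, D.punctures A,
    PlanarEnds.BranchData.pairMap A, PlanarEnds.BranchData.isClosedRiemannSurface, hgenus, ?_,
    PlanarEnds.BranchData.isMinimalImmersionOn hA,
    PlanarEnds.BranchData.isCompleteOn_of_tendsto hc ht,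
    PlanarEnds.BranchData.totalAbsCurvature_pairMap hA,
    fun p hp => PlanarEnds.BranchData.hasEmbeddedPlanarEnd hA hp,
    PlanarEnds.BranchData.isSymmetricAboutOrigin,
    fun h => PlanarEnds.BranchData.isHyperelliptic (hgenus.symm ▸ h),
    PlanarEnds.BranchData.isCurvePair hA, ?_⟩
  · rw [PlanarEnds.BranchData.card_punctures, hD, hAdef,
      PlanarEnds.BranchData.card_integral_union hm]
    omega
  · rintro rfl rfl
    refine PlanarEnds.BranchData.isEmbedding_of_tendsto hc ht
      (PlanarEnds.BranchData.injOn_pairMap (a := 1) (b := 0) ?_ ?_)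
    · rw [hAdef]; decide
    · rw [hD, hAdef]
      ext k
      rw [Finset.mem_compl, PlanarEnds.BranchData.mem_integral_union hm, Finset.mem_singleton,
        Fin.ext_iff]
      simp
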